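/- **Setting.** Fix sample sizes $n_1,n_2\ge 2$ and put $n=n_1+n_2$. For each dimension $p$ and class $k\in\{1,2\}$ let $\mu_{(k)}\in\mathbb R^p$, let $\Sigma_{(k)}=U_{(k)}\Lambda_{(k)}U_{(k)}^\top$ with $U_{(k)}=[u_{(k),1},\dots,u_{(k),p}]$ orthogonal, and let $\Lambda_{(k)}$ have diagonal entries $\lambda_{(k),1}=\sigma_k^2p+\tau_{(k),1}^2$ (one strong spike) and $\lambda_{(k),i}=\tau_{(k),i}^2$ for $i\ge2$. An observation of class $k$ is $X=\mu_{(k)}+U_{(k)}\Lambda_{(k)}^{1/2}(z_1,\dots,z_p)^\top$, where $z=(z_1,z_2,\dots)$ is a random sequence with a law depending only on $k$. The training data are $n_k$ observations $X_{kj}$ of class $k$ ($k=1,2$), with score sequences $z_{kj}$, all independent. Assume, with $\mu=\mu_{(1)}-\mu_{(2)}$ and limits as $p\to\infty$: 1. $p^{-1/2}\|\mu\|\to\delta$ for some $\delta>0$. 2. $\sigma_k>0$, the $\tau_{(k),i}^2>0$ are uniformly bounded, $p^{-1}\sum_{i\le p}\tau_{(k),i}^2\to\tau_k^2>0$, and $\tau_1^2>\tau_2^2$.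 3. For each class, the $z_i$ have mean $0$ and variance $1$, are uncorrelated and have uniformly bounded fourth moments; each $(z_1,\dots,z_p)$ has a density; $(z_i)$ is $\rho$-mixing after some permutation. 4. The angle between $u_{(k),1}$ and $\mu$ converges to a limit in $[0,\pi/2]$, $k=1,2$. 5. For all large $p$, $\mathcal U=\mathrm{span}(u_{(1),1},u_{(2),1})$ has dimension $m=2$ and it has an orthonormal basis $u_1,u_2$ whose angles with $\mu$ converge to limits in $[0,\pi/2]$ and for which $(u_1^\top u_{(k),1},u_2^\top u_{(k),1})^\top\to R_{(k)}\in\mathbb R^2$, where $R_{(1)},R_{(2)}$ are linearly independent. **The direction.** Let $\bar X_k$ be the class sample means, $d=\bar X_1-\bar X_2$, $S_W=\sum_{k,j}(X_{kj}-\bar X_k)(X_{kj}-\bar X_k)^\top$ with eigenvalues $\hat\lambda_1\ge\dots\ge\hat\lambda_p$ and orthonormal eigenvectors $\hat u_1,\dots,\hat u_p$, and $\hat U_2=[\hat u_{n-1},\dots,\hat u_p]$. Let $\Phi_k=\sigma_k^2\sum_{j}(z_{kj,1}-\bar z_{k,1})^2$, where $\bar z_{k,1}=n_k^{-1}\sum_j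 z_{kj,1}$, and $$\Phi_{\tau_1,\tau_2}=\begin{pmatrix}\Phi_1+\tau_1^2&\Phi_1^{1/2}R_{(1)}^\top R_{(2)}\Phi_2^{1/2}\\ \Phi_2^{1/2}R_{(2)}^\top R_{(1)}\Phi_1^{1/2}&\Phi_2+\tau_2^2\end{pmatrix}$$ with eigenvalues $\phi_1\ge\phi_2$, and $\phi_3:=0$. Let $k_0\in\{1,2\}$ satisfy $\phi_{k_0}\ge\tau_1^2\ge\phi_{k_0+1}$, and let $\mathcal D'=\{1,n_1\}$ if $k_0=1$, $\mathcal D'=\{1,2\}$ if $k_0=2$. For $\alpha\in\mathbb R$ and $\alpha_p=\alpha p$, the conditioned projected ridge direction $v_\alpha^c$ is the unit vector with $$v_\alpha^c\propto\sum_{i\in\mathcal D'}\frac{\alpha_p}{\hat\lambda_i+\alpha_p}\hat u_i\hat u_i^\top d+\hat U_2\hat U_2^\top d .$$ **Second data piling.** Let $Y,Y'$ be test observations of the same class, independent of each other and of the training data. A sequence $\{w\}$ of unit vectors in the sample space (the span of the $X_{kj}-\bar X$, where $\bar X$ is the total sample mean) belongs to the class $\mathcal A$ of second data piling directions if $p^{-1/2}w^\top(Y-Y')\to0$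 in probability as $p\to\infty$, for $Y,Y'$ in class $1$ and for $Y,Y'$ in class $2$. **Theorem.** Under these assumptions, no ridge parameter $\alpha\in\mathbb R$ makes $\{v_\alpha^c\}$ a sequence of second data piling directions, in both of the following senses. (a) For almost every realisation of the training data and every $\alpha\in\mathbb R$ for which $v_\alpha^c$ is defined for all large $p$ (that is, $\hat\lambda_i+\alpha_p\ne0$ for $i\in\mathcal D'$), it is not the case that, conditionally on the training data, $p^{-1/2}(v_\alpha^c)^\top(Y-Y')\to0$ in probability for both classes. (b) For every $\alpha\in\mathbb R$, it is not the case that $p^{-1/2}(v_\alpha^c)^\top(Y-Y')\to0$ in the joint probability of training and test data for both classes; in particular $\{v_\alpha^c\}\notin\mathcal A$. -/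

import Mathlib

open MeasureTheory ProbabilityTheory Filter Topology

/-- The `p`-dimensional Euclidean space. -/
abbrev RR (p : ℕ) : Type := EuclideanSpace ℝ (Fin p)

/-- A process `W 0, W 1, …` is `ρ`-mixing: the maximal correlation between square-integrable
functions of the past `(W i, i ≤ j)` and of the future `(W i, i ≥ j + m)` is at most `ρ m`,
uniformly in `j`, where `ρ m → 0`. (The mixing coefficient is the least such `ρ`; the inequality
is written without dividing by the standard deviations.) -/
def IsRhoMixing {S : Type*} [MeasurableSpace S] (μ : Measure S) (W : ℕ → S → ℝ) : Prop :=
  ∃ ρ : ℕ → ℝ, Tendsto ρ atTop (𝓝 0) ∧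
    ∀ (m j : ℕ) (f g : S → ℝ),
      Measurable[⨆ i ∈ Set.Iic j, MeasurableSpace.comap (W i) inferInstance] f →
      Measurable[⨆ i ∈ Set.Ici (j + m), MeasurableSpace.comap (W i) inferInstance] g →
      MemLp f 2 μ → MemLp g 2 μ →
      |covariance f g μ| ≤ ρ m * (√(variance f μ) * √(variance g μ))

/-- The data of a two-class covariance model with one spike in each class, for all dimensions `p`
at once. Class `1` has index `0`, class `2` has index `1`, and coordinates are counted from `0`. -/
structure SpikedModel where
  /-- training sample sizes `n₁, n₂`, fixed as `p` grows -/
  size : Fin 2 → ℕ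
  /-- population means -/
  mean : Fin 2 → (p : ℕ) → RR p
  /-- eigenvectors of the population covariance matrices; the spike goes with index `0` -/
  axis : Fin 2 → (p : ℕ) → OrthonormalBasis (Fin p) ℝ (RR p)
  /-- the positive square root `σ` of the coefficient `σ²` in the spiked eigenvalue -/
  spike : Fin 2 → ℝ
  /-- the numbers `τ²_{(k),i}` -/
  tail : Fin 2 → ℕ → ℝ
  /-- the law of the infinite sequence of true (standardised) principal component scores -/
  scoreLaw : Fin 2 → Measure (ℕ → ℝ)

namespace SpikedModel

variable (M : SpikedModel)

/-- Total sample size. -/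
def total : ℕ := M.size 0 + M.size 1

/-- Eigenvalues of the `p × p` covariance matrix of class `k`, with a strong spike: the first one
is `σ² p + τ²_{(k),1}`, the others are `τ²_{(k),i}`. -/
noncomputable def eigval (k : Fin 2) (p i : ℕ) : ℝ :=
  if i = 0 then M.spike k ^ 2 * p + M.tail k 0 else M.tail k i

/-- The leading eigenvector of class `k` (the zero vector in the void case `p = 0`). -/
noncomputable def lead (k : Fin 2) (p : ℕ) : RR p :=
  if h : 0 < p then M.axis k p ⟨0, h⟩ else 0

/-- The `p`-dimensional observation of class `k` with score sequence `z`, that is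
`X = μ + U Λ^{1/2} z`; equivalently, `z = Λ^{-1/2} Uᵀ (X - μ)` on the first `p` coordinates. -/
noncomputable def obs (k : Fin 2) (p : ℕ) (z : ℕ → ℝ) : RR p :=
  M.mean k p + ∑ i : Fin p, (√(M.eigval k p i) * z i) • M.axis k p i

/-- Difference of the two population means. -/
noncomputable def meanDiff (p : ℕ) : RR p := M.mean 0 p - M.mean 1 p

/-- The mean difference satisfies `p^{-1/2} ‖μ‖ → δ`. -/
def HasMeanGap (δ : ℝ) : Prop :=
  Tendsto (fun p : ℕ => ‖M.meanDiff p‖ / √(p : ℝ)) atTop (𝓝 δ)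

/-- Strong spikes, and tail eigenvalues that are positive, bounded, and average to `t k`
(which is `τ_k²`). -/
structure HasSpectrum (t : Fin 2 → ℝ) : Prop where
  spike_pos : ∀ k, 0 < M.spike k
  tail_pos : ∀ k i, 0 < M.tail k i
  tail_bdd : ∃ C : ℝ, ∀ k i, M.tail k i ≤ C
  tail_avg : ∀ k, Tendsto (fun p : ℕ => (∑ i ∈ Finset.range p, M.tail k i) / p) atTop (𝓝 (t k))
  limit_pos : ∀ k, 0 < t k

/-- The scores are centred with identity covariance, so that `obs k p` has mean `mean k p` and
covariance matrix `U Λ Uᵀ`; every initial segment has a density, so that `obs k p` has one; fourth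
moments are uniformly bounded, and the sequence is `ρ`-mixing under some permutation. -/
structure HasScores : Prop where
  prob : ∀ k, IsProbabilityMeasure (M.scoreLaw k)
  density : ∀ k (p : ℕ),
    (M.scoreLaw k).map (fun (z : ℕ → ℝ) (i : Fin p) => z i) ≪ (volume : Measure (Fin p → ℝ))
  fourth : ∀ k, ∃ C : ℝ, ∀ i : ℕ,
    Integrable (fun z : ℕ → ℝ => z i ^ 4) (M.scoreLaw k) ∧ ∫ z, z i ^ 4 ∂M.scoreLaw k ≤ C
  centred : ∀ k (i : ℕ), ∫ z, z i ∂M.scoreLaw k = 0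
  uncorrelated : ∀ k (i j : ℕ), ∫ z, z i * z j ∂M.scoreLaw k = if i = j then 1 else 0
  mixing : ∀ k, ∃ π : Equiv.Perm ℕ, IsRhoMixing (M.scoreLaw k) (fun i z => z (π i))

/-- The leading eigenvectors have limiting angles with the mean difference. -/
def HasLeadAngles : Prop :=
  ∀ k, ∃ θ ∈ Set.Icc 0 (Real.pi / 2),
    Tendsto (fun p => InnerProductGeometry.angle (M.lead k p) (M.meanDiff p)) atTop (𝓝 θ)

/-- The common leading eigenspace, spanned by the two leading eigenvectors, has dimension `2`; it
has an orthonormal basis `b` whose vectors have limiting angles with the mean difference and in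
which the coordinates of the leading eigenvector of class `k` tend to `R k`; and the `2 × 2` matrix
with columns `R 0, R 1` has rank `2`. -/
def HasCommonEigenspace (R : Fin 2 → RR 2) : Prop :=
  (∀ᶠ p in atTop, Module.finrank ℝ
      (Submodule.span ℝ (Set.range fun k => M.lead k p) : Submodule ℝ (RR p)) = 2) ∧
  (∃ b : (p : ℕ) → Fin 2 → RR p,
    (∀ᶠ p in atTop, Orthonormal ℝ (b p) ∧
      Submodule.span ℝ (Set.range (b p)) = Submodule.span ℝ (Set.range fun k => M.lead k p)) ∧
    (∀ i, ∃ θ ∈ Set.Icc 0 (Real.pi / 2),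
      Tendsto (fun p => InnerProductGeometry.angle (b p i) (M.meanDiff p)) atTop (𝓝 θ)) ∧
    ∀ k i, Tendsto (fun p => inner ℝ (b p i) (M.lead k p)) atTop (𝓝 (R k i))) ∧
  LinearIndependent ℝ R

/-- The score sequences `Z k j` of the training data: all `n₁ + n₂` of them are independent, and
those of class `k` have the law `scoreLaw k`. -/
structure IsTrainingSample {Ω : Type*} [MeasurableSpace Ω] (P : Measure Ω)
    (Z : (k : Fin 2) → Fin (M.size k) → Ω → ℕ → ℝ) : Prop where
  meas : ∀ k j, Measurable (Z k j)
  law : ∀ k j, P.map (Z k j) = M.scoreLaw k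
  indep : iIndepFun (fun (a : Σ k : Fin 2, Fin (M.size k)) => Z a.1 a.2) P

section Sample

/-! In this section `z k j` is the score sequence of the `j`-th training point of class `k`. -/

variable (p : ℕ) (z : (k : Fin 2) → Fin (M.size k) → ℕ → ℝ)

/-- Sample mean of class `k`. -/
noncomputable def sampleMean (k : Fin 2) : RR p :=
  (M.size k : ℝ)⁻¹ • ∑ j, M.obs k p (z k j)

/-- Sample mean difference `d`. -/
noncomputable def sampleDiff : RR p := M.sampleMean p z 0 - M.sampleMean p z 1

/-- The within-class scatter matrix `S_W = ∑ₖ ∑ⱼ (X_{kj} - X̄_k)(X_{kj} - X̄_k)ᵀ`, acting on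
vectors. -/
noncomputable def withinScatter (x : RR p) : RR p :=
  ∑ k, ∑ j, inner ℝ (M.obs k p (z k j) - M.sampleMean p z k) x •
    (M.obs k p (z k j) - M.sampleMean p z k)

/-- `lam, U` is an eigen-decomposition of the within-class scatter matrix with the eigenvalues in
descending order. -/
def IsEigenDecomp (lam : Fin p → ℝ) (U : OrthonormalBasis (Fin p) ℝ (RR p)) : Prop :=
  Antitone lam ∧ ∀ i, M.withinScatter p z (U i) = lam i • U i

/-- `Φ_k`, the scatter of the scaled leading scores `σ z_{kj,1}` of class `k`. -/
noncomputable def leadScatter (k : Fin 2) : ℝ :=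
  ∑ j, (M.spike k * z k j 0 - (M.size k : ℝ)⁻¹ * ∑ l, M.spike k * z k l 0) ^ 2

/-- The matrix `Φ_{τ₁,τ₂}`. -/
noncomputable def leadMatrix (t : Fin 2 → ℝ) (R : Fin 2 → RR 2) : Matrix (Fin 2) (Fin 2) ℝ :=
  !![M.leadScatter z 0 + t 0,
      √(M.leadScatter z 0) * inner ℝ (R 0) (R 1) * √(M.leadScatter z 1);
    √(M.leadScatter z 1) * inner ℝ (R 1) (R 0) * √(M.leadScatter z 0),
      M.leadScatter z 1 + t 1]

theorem leadMatrix_isHermitian (t : Fin 2 → ℝ) (R : Fin 2 → RR 2) :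
    (M.leadMatrix z t R).IsHermitian := by
  ext i j
  fin_cases i <;> fin_cases j <;>
    simp [leadMatrix, Matrix.conjTranspose_apply, real_inner_comm (R 0) (R 1)] <;> ring

/-- The `l`-th largest eigenvalue of `Φ_{τ₁,τ₂}` for `l = 1, 2`, and `0` for `l = 3`. -/
noncomputable def leadEig (t : Fin 2 → ℝ) (R : Fin 2 → RR 2) (l : ℕ) : ℝ :=
  if h : l - 1 < Fintype.card (Fin 2) then (M.leadMatrix_isHermitian z t R).eigenvalues₀ ⟨l - 1, h⟩
  else 0

/-- `k₀ ∈ {1, 2}` and `φ_{k₀}(Φ_{τ₁,τ₂}) ≥ τ₁² ≥ φ_{k₀+1}(Φ_{τ₁,τ₂})`. -/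
def IsLeadCount (t : Fin 2 → ℝ) (R : Fin 2 → RR 2) (k₀ : ℕ) : Prop :=
  k₀ ∈ Finset.Icc 1 2 ∧ t 0 ≤ M.leadEig z t R k₀ ∧ M.leadEig z t R (k₀ + 1) ≤ t 0

/-- The index set `D' = {1, …, k₀} ∪ {k₀ + (n₁ - 1), …, n₁}`, which is `{1, n₁}` for `k₀ = 1` and
`{1, 2}` for `k₀ = 2`. -/
def signalIndices (k₀ : ℕ) : Finset ℕ :=
  Finset.Icc 1 k₀ ∪ Finset.Icc (k₀ + (M.size 0 - 1)) (M.size 0)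

/-- No denominator vanishes in the definition of the ridge direction. -/
def RidgeDefined (k₀ : ℕ) (α : ℝ) (lam : Fin p → ℝ) : Prop :=
  ∀ i : Fin p, (i : ℕ) + 1 ∈ M.signalIndices k₀ → lam i + α * p ≠ 0

/-- `∑_{i ∈ D'} αₚ / (λ̂ᵢ + αₚ) ûᵢ ûᵢᵀ d + Û₂ Û₂ᵀ d` with `αₚ = α p`, where the columns of `Û₂` are
the `ûᵢ` with (counted from `1`) `i ≥ n - 1`. -/
noncomputable def ridgeVector (k₀ : ℕ) (α : ℝ) (lam : Fin p → ℝ)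
    (U : OrthonormalBasis (Fin p) ℝ (RR p)) : RR p :=
  (∑ i : Fin p, if (i : ℕ) + 1 ∈ M.signalIndices k₀ then
      (α * p / (lam i + α * p) * inner ℝ (U i) (M.sampleDiff p z)) • U i else 0) +
    ∑ i : Fin p, if M.total - 1 ≤ (i : ℕ) + 1 then inner ℝ (U i) (M.sampleDiff p z) • U i else 0

/-- The conditioned projected ridge direction, the unit vector proportional to `ridgeVector`. -/
noncomputable def ridgeDirection (k₀ : ℕ) (α : ℝ) (lam : Fin p → ℝ)
    (U : OrthonormalBasis (Fin p) ℝ (RR p)) : RR p :=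
  ‖M.ridgeVector p z k₀ α lam U‖⁻¹ • M.ridgeVector p z k₀ α lam U

end Sample

/-- Second data piling for fixed training data, hence for a sequence of fixed vectors `w p`: for two
independent test points `Y, Y'` of the same class, `p^{-1/2} wᵀ (Y - Y') → 0` in probability, the
probability being that of the test points. -/
def PilesGiven (w : (p : ℕ) → RR p) : Prop :=
  ∀ k, TendstoInMeasure ((M.scoreLaw k).prod (M.scoreLaw k))
    (fun (p : ℕ) (y : (ℕ → ℝ) × (ℕ → ℝ)) =>
      (√(p : ℝ))⁻¹ * inner ℝ (w p) (M.obs k p y.1 - M.obs k p y.2)) atTop (fun _ => 0)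

/-- Second data piling for a sequence of vectors `w p ω` that depend on the training data `ω`: for
two test points `Y, Y'` of the same class, independent of each other and of the training data,
`p^{-1/2} wᵀ (Y - Y') → 0` in probability, the probability being that of training and test points
together. This is the condition that singles out the class of second data piling directions among
the sequences of unit vectors in the sample space. -/
def Piles {Ω : Type*} [MeasurableSpace Ω] (P : Measure Ω) (w : (p : ℕ) → Ω → RR p) : Prop :=
  ∀ k, TendstoInMeasure (P.prod ((M.scoreLaw k).prod (M.scoreLaw k)))
    (fun (p : ℕ) (x : Ω × (ℕ → ℝ) × (ℕ → ℝ)) =>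
      (√(p : ℝ))⁻¹ * inner ℝ (w p x.1) (M.obs k p x.2.1 - M.obs k p x.2.2)) atTop (fun _ => 0)

end SpikedModel

/-! Let x_a be the training points, centred within their class and divided by √p. Along a suitable
sequence of dimensions their Gram matrix converges almost surely to an explicit matrix G: a part of
rank two, built from the scaled centred leading scores s and the limiting cosine ρ of the two
leading population eigenvectors, plus τ_k² times the centring projection of each class
(`exists_seq_noiseLimit`, `NoiseLimit.sampleLimit`). The noise enters only through its average
variance, by a law of large numbers for the squared scores under ρ-mixing
(`tendsto_lintegral_sqDev`) and by second-moment bounds for all mixed inner products.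

The coordinates of the x_a on the first n - 2 sample eigenvectors converge along an ultrafilter to
orthogonal eigenvectors q_i of G, with |q_i|² = lim λ̂_i / p (`gramLimit`). Generically, an
eigenvector either has a nonzero score against s, and then its eigenvalue is a root of the
characteristic polynomial of Φ_{τ₁,τ₂}, or it is pure noise, supported in one class, with eigenvalue
τ_k². Counting multiplicities puts the two signal eigenvalues exactly at the positions in D'
(`mem_signal_iff`).

Second data piling forces a direction to be asymptotically orthogonal to both leading eigenvectors,
because Y - Y' has a component of order √p along u_{(k),1} while the rest is negligible
(`exists_seq_tendsto_inner_lead`). For the ridge vector these inner products have computable limits: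
e_l + ∑ (g_i - 1) (lim û_iᵀd/√p) (lim û_iᵀu_{(l),1}), with e_l the limit for d itself and g_i the
limiting ridge coefficient, zero on noise rows. They cannot both vanish.

If -α is not a signal eigenvalue (`regular_ridge`), put u = (G + α)⁻¹(s e), taken on the span of the
signal rows, where s e has coordinates s_a e_{cls a}. Vanishing of the limits turns the formula for
G u into G u = s e + τ² u; subtracting it from (G + α) u = s e leaves (τ_k² + α) u = 0 on class k.
As τ₁² ≠ τ₂², u vanishes on one class, so e is a multiple of (1, ρ) or of (ρ, 1), which is not
generic. If -α is a signal eigenvalue (`singular_ridge`), one coefficient diverges and after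
rescaling only one sample eigenvector survives; generically it has limiting components both along d
and in the leading eigenspace.

The genericity conditions say that polynomials in the leading scores do not vanish; these scores
have a joint density, so the conditions hold almost surely (`ae_generic`). In (a) the parameter α
may depend on the realisation, which is why the singular case is needed. In (b) α is fixed, and
almost surely -α is not a signal eigenvalue. -/

namespace SpikedModel

/-! ### Orthogonal families in coordinates -/

/-- This is the counting tool: it bounds the multiplicity of the noise eigenvalues and the rank of
the within-class scatter. -/
theorem card_le_of_orthogonal {ι κ : Type*} [Fintype ι] [Fintype κ] (v : κ → ι → ℝ)
    (ho : ∀ i j, i ≠ j → ∑ a, v i a * v j a = 0) (hv : ∀ i, v i ≠ 0) :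
    Fintype.card κ ≤ Fintype.card ι := by
  have hli : LinearIndependent ℝ (fun i => (WithLp.toLp 2 (v i) : EuclideanSpace ℝ ι)) := by
    refine linearIndependent_of_ne_zero_of_inner_eq_zero (𝕜 := ℝ) (fun i h => hv i ?_) ?_
    · simpa using h
    · intro i j hij
      simp only [PiLp.inner_apply, RCLike.inner_apply, conj_trivial]
      exact ho j i hij.symm
  simpa using hli.fintype_card_le_finrank

theorem exists_orthogonal_of_card_lt {ι κ : Type*} [Fintype ι] [Fintype κ] (v : κ → ι → ℝ)
    (h : Fintype.card κ < Fintype.card ι) : ∃ u : ι → ℝ, u ≠ 0 ∧ ∀ i, ∑ a, v i a * u a = 0 := by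
  have hk : LinearMap.ker (Matrix.mulVecLin (Matrix.of v)) ≠ ⊥ :=
    LinearMap.ker_ne_bot_of_finrank_lt (by simpa using h)
  obtain ⟨u, hu, hu0⟩ := Submodule.exists_mem_ne_zero_of_ne_bot hk
  refine ⟨u, hu0, fun i => ?_⟩
  have := congrFun (LinearMap.mem_ker.1 hu) i
  simpa [Matrix.mulVec, dotProduct] using this

/-- An upper set of indices of size `c` for which membership is passed down is `{i | i < c}`. -/
theorem iff_lt_of_downward {N : ℕ} (S : Finset (Fin N)) (h : ∀ i j : Fin N, i ≤ j → j ∈ S → i ∈ S)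
    (i : Fin N) : i ∈ S ↔ (i : ℕ) < S.card := by
  constructor
  · intro hi
    have : (Finset.Iic i) ⊆ S := fun j hj => h j i (Finset.mem_Iic.1 hj) hi
    have := Finset.card_le_card this
    rw [Fin.card_Iic] at this
    omega
  · intro hi
    by_contra hn
    have : S ⊆ Finset.Iio i := fun j hj => by
      rw [Finset.mem_Iio]
      by_contra hij
      exact hn (h i j (not_lt.1 hij) hj)
    have := Finset.card_le_card this
    rw [Fin.card_Iio] at this
    omega

/-! ### The limiting Gram matrix -/

/-- The correlation matrix with off-diagonal entry `ρ`. -/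
def corr (ρ : ℝ) (k l : Fin 2) : ℝ := if k = l then 1 else ρ

@[simp] theorem corr_00 (ρ : ℝ) : corr ρ 0 0 = 1 := rfl
@[simp] theorem corr_11 (ρ : ℝ) : corr ρ 1 1 = 1 := rfl
@[simp] theorem corr_01 (ρ : ℝ) : corr ρ 0 1 = ρ := rfl
@[simp] theorem corr_10 (ρ : ℝ) : corr ρ 1 0 = ρ := rfl

/-- The sum of `f` over class `k`. -/
def classSum {ι : Type*} [Fintype ι] (cls : ι → Fin 2) (k : Fin 2) (f : ι → ℝ) : ℝ :=
  ∑ a, if cls a = k then f a else 0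

section classSum

variable {ι : Type*} [Fintype ι] (cls : ι → Fin 2)

theorem sum_eq_classSum (f : ι → ℝ) : ∑ a, f a = classSum cls 0 f + classSum cls 1 f := by
  simp only [classSum, ← Finset.sum_add_distrib]
  refine Finset.sum_congr rfl fun a _ => ?_
  generalize cls a = k
  fin_cases k <;> simp

theorem classSum_mul_left (k : Fin 2) (c : Fin 2 → ℝ) (f : ι → ℝ) :
    classSum cls k (fun a => c (cls a) * f a) = c k * classSum cls k f := by
  simp only [classSum, Finset.mul_sum]
  refine Finset.sum_congr rfl fun a _ => ?_
  split_ifs with h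
  · rw [h]
  · simp

theorem classSum_add (k : Fin 2) (f g : ι → ℝ) :
    classSum cls k (fun a => f a + g a) = classSum cls k f + classSum cls k g := by
  simp only [classSum, ← Finset.sum_add_distrib]
  refine Finset.sum_congr rfl fun a _ => ?_
  split_ifs <;> simp

theorem classSum_sub (k : Fin 2) (f g : ι → ℝ) :
    classSum cls k (fun a => f a - g a) = classSum cls k f - classSum cls k g := by
  simp only [classSum, ← Finset.sum_sub_distrib]
  refine Finset.sum_congr rfl fun a _ => ?_
  split_ifs <;> simp

theorem classSum_sum {κ : Type*} (S : Finset κ) (k : Fin 2) (f : κ → ι → ℝ) :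
    classSum cls k (fun a => ∑ i ∈ S, f i a) = ∑ i ∈ S, classSum cls k (f i) := by
  simp only [classSum]
  rw [Finset.sum_comm]
  refine Finset.sum_congr rfl fun a _ => ?_
  split_ifs <;> simp

theorem classSum_const_mul (k : Fin 2) (c : ℝ) (f : ι → ℝ) :
    classSum cls k (fun a => c * f a) = c * classSum cls k f :=
  classSum_mul_left cls k (fun _ => c) f

theorem classSum_eq_sum_subtype (k : Fin 2) (f : ι → ℝ) :
    classSum cls k f = ∑ a : {a // cls a = k}, f a := by
  rw [classSum, ← Finset.sum_filter]
  exact Finset.sum_subtype _ (by simp) f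

end classSum

/-- The limits, as the dimension grows, of the coordinates `q i a` of the scaled training points on
the leading `N = n₁ + n₂ - 2` eigenvectors of the within-class scatter matrix: by `gram` they
produce the limiting Gram matrix, in which `s` are the scaled centred leading scores, `ρ` is the
cosine of the limiting angle of the two leading population eigenvectors and `t` are the average
tail eigenvalues. -/
structure GramLimit {ι : Type*} [Fintype ι] [DecidableEq ι] (cls : ι → Fin 2) (n : Fin 2 → ℕ)
    (t : Fin 2 → ℝ) (ρ : ℝ) (s : ι → ℝ) {N : ℕ} (q : Fin N → ι → ℝ) : Prop where
  card : ∀ k, Fintype.card {a // cls a = k} = n k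
  two_le : ∀ k, 2 ≤ n k
  size : N + 2 = n 0 + n 1
  t_pos : ∀ k, 0 < t k
  t_lt : t 1 < t 0
  rho : ρ ^ 2 < 1
  s_cent : ∀ k, classSum cls k s = 0
  s_pos : ∀ k, 0 < classSum cls k (fun a => s a * s a)
  cent : ∀ i k, classSum cls k (q i) = 0
  orth : ∀ i j, i ≠ j → ∑ a, q i a * q j a = 0
  gram : ∀ a b, ∑ i, q i a * q i b = s a * s b * corr ρ (cls a) (cls b) +
    t (cls a) * ((if a = b then 1 else 0) - if cls a = cls b then (n (cls a) : ℝ)⁻¹ else 0)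

namespace GramLimit

variable {ι : Type*} [Fintype ι] [DecidableEq ι] {cls : ι → Fin 2} {n : Fin 2 → ℕ}
    {t : Fin 2 → ℝ} {ρ : ℝ} {s : ι → ℝ} {N : ℕ} {q : Fin N → ι → ℝ}

/-- The terms `1 / n k` are averages over a class and annihilate class-wise centred vectors, so on
these the Gram matrix is a rank-two operator plus a diagonal one. -/
theorem apply_centred (h : GramLimit cls n t ρ s q) (u : ι → ℝ) (hu : ∀ k, classSum cls k u = 0)
    (a : ι) : ∑ i, q i a * ∑ b, q i b * u b =
      s a * (corr ρ (cls a) 0 * classSum cls 0 (fun b => s b * u b) +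
        corr ρ (cls a) 1 * classSum cls 1 (fun b => s b * u b)) + t (cls a) * u a := by
  have h1 : ∑ i, q i a * ∑ b, q i b * u b = ∑ b, (∑ i, q i a * q i b) * u b := by
    simp only [Finset.mul_sum, Finset.sum_mul]
    rw [Finset.sum_comm]
    simp only [mul_assoc]
  have h2 : ∑ b, (s a * s b * corr ρ (cls a) (cls b)) * u b =
      s a * (corr ρ (cls a) 0 * classSum cls 0 (fun b => s b * u b) +
        corr ρ (cls a) 1 * classSum cls 1 (fun b => s b * u b)) := by
    rw [sum_eq_classSum cls, ← classSum_mul_left cls 0 (fun l => corr ρ (cls a) l),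
      ← classSum_mul_left cls 1 (fun l => corr ρ (cls a) l), mul_add, ← classSum_const_mul,
      ← classSum_const_mul]
    congr 2 <;> · funext b; ring
  have h3 : ∑ b, t (cls a) * ((if a = b then 1 else 0) -
      if cls a = cls b then (n (cls a) : ℝ)⁻¹ else 0) * u b = t (cls a) * u a := by
    have h4 : ∑ b, (if cls a = cls b then (n (cls a) : ℝ)⁻¹ else 0) * u b = 0 := by
      have := hu (cls a)
      rw [classSum] at this
      have h5 : ∑ b, (if cls a = cls b then (n (cls a) : ℝ)⁻¹ else 0) * u b =
          (n (cls a) : ℝ)⁻¹ * ∑ b, if cls b = cls a then u b else 0 := by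
        rw [Finset.mul_sum]
        refine Finset.sum_congr rfl fun b _ => ?_
        simp only [eq_comm (a := cls a)]
        split_ifs <;> simp
      rw [h5, this, mul_zero]
    simp only [mul_assoc, ← Finset.mul_sum, sub_mul, Finset.sum_sub_distrib, h4]
    simp
  rw [h1]
  simp only [h.gram, add_mul, Finset.sum_add_distrib, h2, h3]

/-- The rank-two part contributes B0² + 2ρ B0 B1 + B1², which is nonnegative as ρ² < 1, and the
diagonal part is at least its smaller entry `t 1`. Hence the Gram matrix is positive definite on
centred vectors. -/
theorem quad (h : GramLimit cls n t ρ s q) (u : ι → ℝ) (hu : ∀ k, classSum cls k u = 0) :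
    t 1 * ∑ a, u a ^ 2 ≤ ∑ i, (∑ b, q i b * u b) ^ 2 := by
  have h1 : ∑ i, (∑ b, q i b * u b) ^ 2 = ∑ a, u a * ∑ i, q i a * ∑ b, q i b * u b := by
    simp only [Finset.mul_sum, sq, Finset.sum_mul]
    rw [Finset.sum_comm]
    refine Finset.sum_congr rfl fun a _ => ?_
    refine Finset.sum_congr rfl fun b _ => ?_
    refine Finset.sum_congr rfl fun i _ => ?_
    ring
  have hρ := h.rho
  simp only [h1, h.apply_centred u hu]
  set B0 := classSum cls 0 (fun b => s b * u b) with hB0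
  set B1 := classSum cls 1 (fun b => s b * u b) with hB1
  have h2 : ∑ a, u a * (s a * (corr ρ (cls a) 0 * B0 + corr ρ (cls a) 1 * B1) + t (cls a) * u a)
      = B0 * (B0 + ρ * B1) + B1 * (ρ * B0 + B1) + ∑ a, t (cls a) * u a ^ 2 := by
    have h3 : ∑ a, u a * (s a * (corr ρ (cls a) 0 * B0 + corr ρ (cls a) 1 * B1)) =
        B0 * (B0 + ρ * B1) + B1 * (ρ * B0 + B1) := by
      have := classSum_mul_left cls 0 (fun l => corr ρ l 0 * B0 + corr ρ l 1 * B1)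
        (fun b => s b * u b)
      have h4 := classSum_mul_left cls 1 (fun l => corr ρ l 0 * B0 + corr ρ l 1 * B1)
        (fun b => s b * u b)
      rw [← hB0, corr_00, corr_01] at this
      rw [← hB1, corr_10, corr_11] at h4
      have h5 : B0 * (B0 + ρ * B1) + B1 * (ρ * B0 + B1) =
          (1 * B0 + ρ * B1) * B0 + (ρ * B0 + 1 * B1) * B1 := by ring
      rw [h5, sum_eq_classSum cls, ← this, ← h4]
      congr 2 <;> · funext b; ring
    rw [← h3, ← Finset.sum_add_distrib]
    exact Finset.sum_congr rfl fun a _ => by ring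
  rw [h2, Finset.mul_sum]
  have h5 : ∑ a, t 1 * u a ^ 2 ≤ ∑ a, t (cls a) * u a ^ 2 := by
    refine Finset.sum_le_sum fun a _ => mul_le_mul_of_nonneg_right ?_ (sq_nonneg _)
    generalize cls a = k
    fin_cases k
    · exact h.t_lt.le
    · exact le_rfl
  nlinarith [sq_nonneg (B0 + ρ * B1), mul_nonneg (sub_nonneg.2 hρ.le) (sq_nonneg B1)]

theorem eq_zero_of_orthogonal (h : GramLimit cls n t ρ s q) (u : ι → ℝ)
    (hu : ∀ k, classSum cls k u = 0) (h0 : ∀ i, ∑ b, q i b * u b = 0) : u = 0 := by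
  have h1 := h.quad u hu
  simp only [h0] at h1
  have h2 : ∑ a, u a ^ 2 ≤ 0 := by
    have := h.t_pos 1
    simp at h1
    nlinarith
  have h3 := (Finset.sum_eq_zero_iff_of_nonneg (fun a _ => sq_nonneg (u a))).1
    (le_antisymm h2 (Finset.sum_nonneg fun a _ => sq_nonneg _))
  funext a
  simpa using h3 a (Finset.mem_univ a)

theorem card_index (h : GramLimit cls n t ρ s q) : Fintype.card ι = n 0 + n 1 := by
  have h1 := sum_eq_classSum cls (fun _ : ι => (1 : ℝ))
  rw [classSum_eq_sum_subtype, classSum_eq_sum_subtype] at h1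
  simp only [Finset.sum_const, Finset.card_univ, h.card, nsmul_eq_mul, mul_one] at h1
  exact_mod_cast h1

/-- If one row vanished, the other N - 1 rows and the two class indicators would impose only N + 1
conditions on a space of dimension N + 2. A nonzero centred vector orthogonal to every row would
remain, against positive definiteness. -/
theorem ne_zero (h : GramLimit cls n t ρ s q) (i : Fin N) : q i ≠ 0 := by
  intro hi
  have hv : Fintype.card ({j : Fin N // j ≠ i} ⊕ Fin 2) < Fintype.card ι := by
    have h1 := h.card_index
    have h2 := h.size
    have : Fintype.card {j : Fin N // j ≠ i} = N - 1 := by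
      rw [Fintype.card_subtype_compl]; simp
    simp only [Fintype.card_sum, Fintype.card_fin, this]
    have := i.pos
    omega
  obtain ⟨u, hu0, hu⟩ := exists_orthogonal_of_card_lt
    (Sum.elim (fun j : {j : Fin N // j ≠ i} => q j) (fun k a => if cls a = k then 1 else 0)) hv
  refine hu0 (h.eq_zero_of_orthogonal u (fun k => ?_) fun j => ?_)
  · have := hu (Sum.inr k)
    simpa [classSum] using this
  · by_cases hj : j = i
    · subst hj; simp [hi]
    · simpa using hu (Sum.inl ⟨j, hj⟩)

theorem norm_pos (h : GramLimit cls n t ρ s q) (i : Fin N) : 0 < ∑ a, q i a * q i a := by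
  refine lt_of_le_of_ne (Finset.sum_nonneg fun a _ => mul_self_nonneg _) fun h0 => h.ne_zero i ?_
  have h3 := (Finset.sum_eq_zero_iff_of_nonneg (fun a _ => mul_self_nonneg (q i a))).1 h0.symm
  funext a
  simpa using h3 a (Finset.mem_univ a)

/-- The rows form an orthogonal basis of the centred vectors: the remainder of the expansion is
centred and orthogonal to every row, hence zero. -/
theorem expand (h : GramLimit cls n t ρ s q) (u : ι → ℝ) (hu : ∀ k, classSum cls k u = 0)
    (a : ι) : u a = ∑ i, (∑ b, q i b * u b) / (∑ b, q i b * q i b) * q i a := by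
  have := h.eq_zero_of_orthogonal
    (fun a => u a - ∑ i, (∑ b, q i b * u b) / (∑ b, q i b * q i b) * q i a) (fun k => ?_)
    (fun j => ?_)
  · exact sub_eq_zero.1 (congrFun this a)
  · rw [classSum_sub, hu, classSum_sum, zero_sub, neg_eq_zero]
    exact Finset.sum_eq_zero fun i _ => by rw [classSum_const_mul, h.cent, mul_zero]
  · simp only [mul_sub, Finset.sum_sub_distrib, Finset.mul_sum]
    rw [Finset.sum_comm, Finset.sum_eq_single j]
    · have hj := (h.norm_pos j).ne'
      have : ∀ b, q j b * ((∑ b, q j b * u b) / (∑ b, q j b * q j b) * q j b) =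
        (∑ b, q j b * u b) / (∑ b, q j b * q j b) * (q j b * q j b) := fun b => by ring
      simp only [this, ← Finset.mul_sum]
      rw [div_mul_cancel₀ _ hj, sub_self]
    · intro i _ hi
      have : ∀ b, q j b * ((∑ b, q i b * u b) / (∑ b, q i b * q i b) * q i b) =
        (∑ b, q i b * u b) / (∑ b, q i b * q i b) * (q j b * q i b) := fun b => by ring
      simp only [this, ← Finset.mul_sum, h.orth j i hi.symm, mul_zero]
    · simp

/-- The rows `q i` are eigenvectors of the limiting Gram matrix. -/
theorem eig (h : GramLimit cls n t ρ s q) (i : Fin N) (a : ι) :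
    (∑ b, q i b * q i b) * q i a =
      s a * (corr ρ (cls a) 0 * classSum cls 0 (fun b => s b * q i b) +
        corr ρ (cls a) 1 * classSum cls 1 (fun b => s b * q i b)) + t (cls a) * q i a := by
  rw [← h.apply_centred (q i) (h.cent i), Finset.sum_eq_single i]
  · ring
  · intro j _ hj
    rw [h.orth j i hj, mul_zero]
  · simp

end GramLimit

end SpikedModel

/-! ### Signal and noise eigenvalues of the limiting Gram matrix -/

namespace SpikedModel

namespace GramLimit

variable {ι : Type*} [Fintype ι] [DecidableEq ι] {cls : ι → Fin 2} {n : Fin 2 → ℕ}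
    {t : Fin 2 → ℝ} {ρ : ℝ} {s : ι → ℝ} {N : ℕ} {q : Fin N → ι → ℝ}

/-- The characteristic polynomial of the `2 × 2` matrix that carries the signal eigenvalues. -/
def leadChar (t : Fin 2 → ℝ) (ρ : ℝ) (Φ : Fin 2 → ℝ) (x : ℝ) : ℝ :=
  (Φ 0 + t 0 - x) * (Φ 1 + t 1 - x) - ρ ^ 2 * Φ 0 * Φ 1

/-- The determinant of `g` and of the image of `g` under the limiting Gram matrix, for the vector
`g` with coordinates `s a * e (cls a)`. -/
def crossDet (t : Fin 2 → ℝ) (ρ : ℝ) (Φ e : Fin 2 → ℝ) : ℝ :=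
  e 1 * (Φ 0 * e 0 + ρ * Φ 1 * e 1 + t 0 * e 0) - e 0 * (ρ * Φ 0 * e 0 + Φ 1 * e 1 + t 1 * e 1)

/-- Scatter of the leading scores in class `k`. -/
def scatter (cls : ι → Fin 2) (s : ι → ℝ) (k : Fin 2) : ℝ := classSum cls k (fun a => s a * s a)

/-- Inner product of the leading scores of class `k` with `u`. -/
def score (cls : ι → Fin 2) (s u : ι → ℝ) (k : Fin 2) : ℝ := classSum cls k (fun a => s a * u a)

/-- Squared norm. -/
def nsq (u : ι → ℝ) : ℝ := ∑ a, u a * u a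

/-- Pairing the eigenvalue equation with `s` on each class gives a closed system: the two scores of
a row form an eigenvector, or zero, of a 2 × 2 matrix whose characteristic polynomial is `leadChar`.
-/
theorem score_eq (h : GramLimit cls n t ρ s q) (i : Fin N) (k : Fin 2) :
    nsq (q i) * score cls s (q i) k = scatter cls s k * (corr ρ k 0 * score cls s (q i) 0 +
      corr ρ k 1 * score cls s (q i) 1) + t k * score cls s (q i) k := by
  have h1 : score cls s (fun a => nsq (q i) * q i a) k = nsq (q i) * score cls s (q i) k := by
    rw [score, score, ← classSum_const_mul]
    congr 1; funext a; ring
  have h2 := classSum_mul_left cls k (fun k => corr ρ k 0 * score cls s (q i) 0 +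
      corr ρ k 1 * score cls s (q i) 1) (fun a => s a * s a)
  have h3 := classSum_mul_left cls k t (fun a => s a * q i a)
  rw [← h1]
  refine Eq.trans ?_ (congrArg₂ (· + ·) (h2.trans (mul_comm _ _)) h3)
  rw [← classSum_add, score]
  congr 1; funext a
  rw [nsq, h.eig i a]
  simp only [score]
  ring

theorem leadChar_t0 (Φ : Fin 2 → ℝ) :
    leadChar t ρ Φ (t 0) = Φ 0 * (Φ 1 * (1 - ρ ^ 2) - (t 0 - t 1)) := by
  simp only [leadChar]; ring

theorem leadChar_t1_pos (h : GramLimit cls n t ρ s q) :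
    0 < leadChar t ρ (scatter cls s) (t 1) := by
  have h0 : 0 < scatter cls s 0 := h.s_pos 0
  have h1 : 0 < scatter cls s 1 := h.s_pos 1
  have h2 := h.t_lt
  have h3 := h.rho
  have e : leadChar t ρ (scatter cls s) (t 1) = scatter cls s 0 * scatter cls s 1 * (1 - ρ ^ 2) +
      (t 0 - t 1) * scatter cls s 1 := by simp only [leadChar]; ring
  rw [e]
  have := mul_pos (mul_pos h0 h1) (sub_pos.2 h3)
  have := mul_pos (sub_pos.2 h2) h1
  linarith

/-- The row `q i` carries signal. -/
theorem leadChar_eq_zero (h : GramLimit cls n t ρ s q) (i : Fin N) (k : Fin 2)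
    (hk : score cls s (q i) k ≠ 0) : leadChar t ρ (scatter cls s) (nsq (q i)) = 0 := by
  have h0 := h.score_eq i 0
  have h1 := h.score_eq i 1
  simp only [corr_00, corr_01, corr_10, corr_11, one_mul] at h0 h1
  -- Multiplying the 2 × 2 system by the adjugate matrix leaves the determinant times each score.
  have e0 : leadChar t ρ (scatter cls s) (nsq (q i)) * score cls s (q i) 0 = 0 := by
    simp only [leadChar]
    linear_combination (-(scatter cls s 1 + t 1 - nsq (q i))) * h0 + (scatter cls s 0 * ρ) * h1
  have e1 : leadChar t ρ (scatter cls s) (nsq (q i)) * score cls s (q i) 1 = 0 := by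
    simp only [leadChar]
    linear_combination (-(scatter cls s 0 + t 0 - nsq (q i))) * h1 + (scatter cls s 1 * ρ) * h0
  fin_cases k
  · exact (mul_eq_zero.1 e0).resolve_right hk
  · exact (mul_eq_zero.1 e1).resolve_right hk

theorem noise_eq_zero (h : GramLimit cls n t ρ s q) (i : Fin N)
    (h0 : ∀ k, score cls s (q i) k = 0) (a : ι) (ha : nsq (q i) ≠ t (cls a)) : q i a = 0 := by
  have := h.eig i a
  have e0 := h0 0
  have e1 := h0 1
  simp only [score] at e0 e1
  rw [e0, e1, mul_zero, mul_zero, add_zero, mul_zero, zero_add] at this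
  have h2 : (nsq (q i) - t (cls a)) * q i a = 0 := by rw [sub_mul, sub_eq_zero]; exact this
  exact (mul_eq_zero.1 h2).resolve_left (sub_ne_zero.2 ha)

/-- Without scores the eigenvalue equation is diagonal, so a row lives where its eigenvalue agrees
with `t`; a nonzero row needs at least one such class. -/
theorem exists_nsq_eq (h : GramLimit cls n t ρ s q) (i : Fin N)
    (h0 : ∀ k, score cls s (q i) k = 0) : ∃ k, nsq (q i) = t k := by
  by_contra! hn
  exact h.ne_zero i (funext fun a => h.noise_eq_zero i h0 a (hn _))

section Generic

variable (h : GramLimit cls n t ρ s q) (hgap : scatter cls s 1 * (1 - ρ ^ 2) ≠ t 0 - t 1)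
  {e : Fin 2 → ℝ} (hcross : crossDet t ρ (scatter cls s) e ≠ 0)

include h hgap

/-- The gap condition separates signal from noise: at `t 0` the polynomial is a positive multiple of
the gap expression, and at `t 1` it is always positive. -/
theorem leadChar_t_ne (k : Fin 2) : leadChar t ρ (scatter cls s) (t k) ≠ 0 := by
  fin_cases k
  · exact (leadChar_t0 (t := t) (ρ := ρ) (scatter cls s)).trans_ne
      (mul_ne_zero (h.s_pos 0).ne' (sub_ne_zero.2 hgap))
  · exact h.leadChar_t1_pos.ne'

theorem leadChar_eq_zero_iff (i : Fin N) : leadChar t ρ (scatter cls s) (nsq (q i)) = 0 ↔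
    ∃ k, score cls s (q i) k ≠ 0 := by
  constructor
  · intro h0
    by_contra! hn
    obtain ⟨k, hk⟩ := h.exists_nsq_eq i hn
    exact h.leadChar_t_ne hgap k (hk ▸ h0)
  · rintro ⟨k, hk⟩
    exact h.leadChar_eq_zero i k hk

theorem score_eq_zero_of_nsq (i : Fin N) (k : Fin 2) (hi : nsq (q i) = t k) (l : Fin 2) :
    score cls s (q i) l = 0 := by
  by_contra hl
  exact h.leadChar_t_ne hgap k (hi ▸ h.leadChar_eq_zero i l hl)

/-- Such rows are supported in class `k` and have zero scores. There they are orthogonal to each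
other, to the constants and to `s`, and the last two are nonzero and mutually orthogonal; this costs
two dimensions out of `n k`. -/
theorem card_noise (k : Fin 2) [Fintype {i : Fin N // nsq (q i) = t k}] :
    Fintype.card {i : Fin N // nsq (q i) = t k} + 2 ≤ n k := by
  rw [← h.card k]
  have ht : t 1 ≠ t 0 := h.t_lt.ne
  have key : ∀ f g : ι → ℝ, (∀ a, cls a ≠ k → f a * g a = 0) →
      ∑ a : {a // cls a = k}, f a * g a = ∑ a, f a * g a := by
    intro f g hfg
    rw [← classSum_eq_sum_subtype (cls := cls) k (fun a => f a * g a), classSum]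
    refine Finset.sum_congr rfl fun a _ => ?_
    split_ifs with ha
    · rfl
    · exact (hfg a ha).symm
  have hz : ∀ i : {i : Fin N // nsq (q i) = t k}, ∀ a, cls a ≠ k → q i a = 0 := by
    intro i a ha
    refine h.noise_eq_zero i (h.score_eq_zero_of_nsq hgap i k i.2) a ?_
    rw [i.2]
    intro hk
    revert ha hk
    generalize cls a = l
    fin_cases k <;> fin_cases l <;> simp_all [eq_comm]
  have := card_le_of_orthogonal (ι := {a // cls a = k})
    (κ := {i : Fin N // nsq (q i) = t k} ⊕ Fin 2)
    (Sum.elim (fun i a => q i a) ![fun _ => 1, fun a => s a]) ?_ ?_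
  · simpa using this
  · have c1 : ∀ i, ∑ a : {a // cls a = k}, q i a = 0 := fun i => by
      rw [← classSum_eq_sum_subtype (cls := cls) k (q i)]; exact h.cent i k
    have c2 : ∀ i : {i : Fin N // nsq (q i) = t k}, ∑ a : {a // cls a = k}, s a * q i a = 0 :=
      fun i => by
        rw [← classSum_eq_sum_subtype (cls := cls) k (fun a => s a * q i a)]
        exact h.score_eq_zero_of_nsq hgap i k i.2 k
    have c3 : ∑ a : {a // cls a = k}, s a = 0 := by
      rw [← classSum_eq_sum_subtype (cls := cls) k s]; exact h.s_cent k
    rintro (i | i) (j | j) hij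
    · simp only [Sum.elim_inl]
      rw [key _ _ (fun a ha => by rw [hz i a ha, zero_mul])]
      exact h.orth _ _ (fun he => hij (by rw [Subtype.ext he]))
    · fin_cases j
      · simpa using c1 i
      · simpa [mul_comm] using c2 i
    · fin_cases i
      · simpa using c1 j
      · simpa using c2 j
    · fin_cases i <;> fin_cases j <;> simp_all
  · rintro (i | i) h0
    · refine h.ne_zero i (funext fun a => ?_)
      by_cases ha : cls a = k
      · exact congrFun h0 ⟨a, ha⟩
      · exact hz i a ha
    · have hp := h.s_pos k
      rw [classSum_eq_sum_subtype] at hp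
      have h0' : ∀ a : {a // cls a = k}, Sum.elim (fun (i : {i : Fin N // nsq (q i) = t k})
        (a : {a // cls a = k}) => q i a) ![fun _ => 1, fun a => s a] (Sum.inr i) a = 0 :=
        fun a => congrFun h0 a
      fin_cases i
      · have : Nonempty {a // cls a = k} := by
          rw [← Fintype.card_pos_iff, h.card]; have := h.two_le k; omega
        exact one_ne_zero (h0' this.some)
      · refine hp.ne' (Finset.sum_eq_zero fun a _ => ?_)
        have := h0' a
        simp at this
        simp [this]

include hcross

/-- A scalar 2 × 2 matrix has every vector as an eigenvector and so makes `crossDet` vanish for all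
`e`. This excludes a signal eigenvalue of multiplicity two. -/
theorem score_ne (i : Fin N) :
    ¬ (ρ = 0 ∧ scatter cls s 0 + t 0 = nsq (q i) ∧ scatter cls s 1 + t 1 = nsq (q i)) := by
  rintro ⟨h0, h1, h2⟩
  refine hcross ?_
  simp only [crossDet, h0]
  linear_combination e 0 * e 1 * (h1 - h2)

/-- Independent score vectors for the same eigenvalue would make the 2 × 2 matrix scalar. So they
are parallel, and since the eigenvalue differs from both `t k`, the eigenvalue equation recovers
each row from its scores; the rows are then parallel as well, against orthogonality. -/
theorem signal_unique (i j : Fin N) (hij : nsq (q i) = nsq (q j))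
    (hi : leadChar t ρ (scatter cls s) (nsq (q i)) = 0) : i = j := by
  by_contra hne
  have hk0 := (h.leadChar_eq_zero_iff hgap i).1 hi
  obtain ⟨k0, hk0⟩ := hk0
  have i0 := h.score_eq i 0
  have i1 := h.score_eq i 1
  have j0 := h.score_eq j 0
  have j1 := h.score_eq j 1
  have hs0 : scatter cls s 0 ≠ 0 := (h.s_pos 0).ne'
  have hs1 : scatter cls s 1 ≠ 0 := (h.s_pos 1).ne'
  rw [← hij] at j0 j1
  simp only [corr_00, corr_01, corr_10, corr_11, one_mul] at i0 i1 j0 j1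
  have hdet : score cls s (q i) 0 * score cls s (q j) 1 -
      score cls s (q i) 1 * score cls s (q j) 0 = 0 := by
    by_contra hd
    refine h.score_ne hgap hcross i ⟨?_, ?_, ?_⟩
    · have : (scatter cls s 0 * ρ) * (score cls s (q i) 0 * score cls s (q j) 1 -
        score cls s (q i) 1 * score cls s (q j) 0) = 0 := by
        linear_combination score cls s (q j) 0 * i0 - score cls s (q i) 0 * j0
      simpa [hd, hs0] using this
    · have : (scatter cls s 0 + t 0 - nsq (q i)) * (score cls s (q i) 0 * score cls s (q j) 1 -
        score cls s (q i) 1 * score cls s (q j) 0) = 0 := by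
        linear_combination -score cls s (q j) 1 * i0 + score cls s (q i) 1 * j0
      exact sub_eq_zero.1 ((mul_eq_zero.1 this).resolve_right hd)
    · have : (scatter cls s 1 + t 1 - nsq (q i)) * (score cls s (q i) 0 * score cls s (q j) 1 -
        score cls s (q i) 1 * score cls s (q j) 0) = 0 := by
        linear_combination score cls s (q j) 0 * i1 - score cls s (q i) 0 * j1
      exact sub_eq_zero.1 ((mul_eq_zero.1 this).resolve_right hd)
  have hpar : ∀ k a, score cls s (q i) k * q j a = score cls s (q j) k * q i a := by
    intro k a
    have ei : nsq (q i) * q i a = s a * (corr ρ (cls a) 0 * score cls s (q i) 0 +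
      corr ρ (cls a) 1 * score cls s (q i) 1) + t (cls a) * q i a := h.eig i a
    have ej : nsq (q j) * q j a = s a * (corr ρ (cls a) 0 * score cls s (q j) 0 +
      corr ρ (cls a) 1 * score cls s (q j) 1) + t (cls a) * q j a := h.eig j a
    rw [← hij] at ej
    have hta : nsq (q i) - t (cls a) ≠ 0 := by
      intro h0
      rw [sub_eq_zero] at h0
      exact h.leadChar_t_ne hgap (cls a) (h0 ▸ hi)
    refine sub_eq_zero.1 ((mul_eq_zero.1 (?_ : (nsq (q i) - t (cls a)) *
      (score cls s (q i) k * q j a - score cls s (q j) k * q i a) = 0)).resolve_left hta)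
    fin_cases k
    · simp only [Fin.zero_eta, Fin.isValue]
      linear_combination score cls s (q i) 0 * ej - score cls s (q j) 0 * ei +
        s a * corr ρ (cls a) 1 * hdet
    · simp only [Fin.mk_one, Fin.isValue]
      linear_combination score cls s (q i) 1 * ej - score cls s (q j) 1 * ei -
        s a * corr ρ (cls a) 0 * hdet
  have : score cls s (q i) k0 * nsq (q j) = 0 := by
    rw [nsq, Finset.mul_sum]
    have h1 : ∀ a, score cls s (q i) k0 * (q j a * q j a) =
        score cls s (q j) k0 * (q i a * q j a) := fun a => by
      rw [← mul_assoc, hpar]; ring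
    simp only [h1, ← Finset.mul_sum, h.orth i j hne, mul_zero]
  exact (mul_ne_zero hk0 (h.norm_pos j).ne') this

/-- The discriminant is a square plus 4ρ²Φ₀Φ₁. If it vanishes, then ρ = 0 and the diagonal entries
agree, so the matrix is scalar. -/
theorem roots_ne {φ₁ φ₂ : ℝ} (hφ : ∀ x, leadChar t ρ (scatter cls s) x = (φ₁ - x) * (φ₂ - x)) :
    φ₁ ≠ φ₂ := by
  rintro rfl
  have a0 := hφ 0
  have a1 := hφ 1
  simp only [leadChar] at a0 a1
  have h0 : 0 < scatter cls s 0 := h.s_pos 0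
  have h1 : 0 < scatter cls s 1 := h.s_pos 1
  have hsum : scatter cls s 0 + t 0 + (scatter cls s 1 + t 1) = 2 * φ₁ := by linarith
  have hsq : (scatter cls s 0 + t 0 - (scatter cls s 1 + t 1)) ^ 2 +
      4 * (ρ ^ 2 * scatter cls s 0 * scatter cls s 1) = 0 := by
    linear_combination (scatter cls s 0 + t 0 + (scatter cls s 1 + t 1) + 2 * φ₁) * hsum - 4 * a0
  have p1 : 0 ≤ ρ ^ 2 * scatter cls s 0 * scatter cls s 1 := by positivity
  have p2 := sq_nonneg (scatter cls s 0 + t 0 - (scatter cls s 1 + t 1))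
  have hρ : ρ = 0 := by
    have : ρ ^ 2 * scatter cls s 0 * scatter cls s 1 = 0 := by linarith
    simpa [h0.ne', h1.ne'] using this
  have hd : scatter cls s 0 + t 0 - (scatter cls s 1 + t 1) = 0 :=
    pow_eq_zero_iff two_ne_zero |>.1 (by linarith)
  refine hcross ?_
  simp only [crossDet, hρ]
  linear_combination e 0 * e 1 * hd

/-- The signs of the polynomial at `t 1` and `t 0`, together with the trace, locate the roots; a tie
of the smaller root with `t 0` is what the gap condition forbids. -/
theorem roots_gt {φ₁ φ₂ : ℝ} (hφ : ∀ x, leadChar t ρ (scatter cls s) x = (φ₁ - x) * (φ₂ - x))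
    (hle : φ₂ ≤ φ₁) : t 0 < φ₁ ∧ t 1 < φ₂ ∧ φ₂ ≠ t 0 ∧ φ₂ < φ₁ := by
  have hne := h.roots_ne hgap hcross hφ
  have h0 : 0 < scatter cls s 0 := h.s_pos 0
  have h1 : 0 < scatter cls s 1 := h.s_pos 1
  have a0 := hφ 0
  have a1 := hφ 1
  simp only [leadChar] at a0 a1
  have hsum : scatter cls s 0 + t 0 + (scatter cls s 1 + t 1) = φ₁ + φ₂ := by linarith
  have b1 := h.leadChar_t1_pos
  rw [hφ] at b1
  have b0 := h.leadChar_t_ne hgap 0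
  have b0' := leadChar_t0 (t := t) (ρ := ρ) (scatter cls s)
  rw [hφ] at b0 b0'
  have hlt := h.t_lt
  have c1 : t 1 < φ₂ := by
    rcases mul_pos_iff.1 b1 with h' | h' <;> linarith
  refine ⟨?_, c1, ?_, lt_of_le_of_ne hle hne.symm⟩
  · by_contra! hc
    have h2 : φ₂ < t 0 := lt_of_lt_of_le (lt_of_le_of_ne hle hne.symm) hc
    have h3 : 0 ≤ (φ₁ - t 0) * (φ₂ - t 0) := mul_nonneg_of_nonpos_of_nonpos (by linarith) (by linarith)
    rw [b0'] at h3
    have h4 : 0 ≤ scatter cls s 1 * (1 - ρ ^ 2) - (t 0 - t 1) := nonneg_of_mul_nonneg_right h3 h0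
    have : 0 ≤ scatter cls s 1 * ρ ^ 2 := by positivity
    nlinarith
  · rintro rfl
    simp at b0

/-- The positions of the signal eigenvalues among all limiting eigenvalues. -/
theorem mem_signal_iff {φ₁ φ₂ : ℝ}
    (hφ : ∀ x, leadChar t ρ (scatter cls s) x = (φ₁ - x) * (φ₂ - x)) (hle : φ₂ ≤ φ₁)
    (hanti : Antitone fun i => nsq (q i)) {k₀ : ℕ} (hk : k₀ ∈ Finset.Icc 1 2)
    (hk1 : k₀ = 1 → φ₂ ≤ t 0) (hk2 : k₀ = 2 → t 0 ≤ φ₂) (i : Fin N) :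
    (i : ℕ) + 1 ∈ Finset.Icc 1 k₀ ∪ Finset.Icc (k₀ + (n 0 - 1)) (n 0) ↔
      leadChar t ρ (scatter cls s) (nsq (q i)) = 0 := by
  classical
  obtain ⟨g1, g2, g3, g4⟩ := h.roots_gt hgap hcross hφ hle
  have htl := h.t_lt
  have hroot : ∀ i, leadChar t ρ (scatter cls s) (nsq (q i)) = 0 ↔
      nsq (q i) = φ₁ ∨ nsq (q i) = φ₂ := by
    intro i
    rw [hφ, mul_eq_zero, sub_eq_zero, sub_eq_zero, eq_comm, @eq_comm _ φ₂]
  let S : ℝ → Finset (Fin N) := fun x => Finset.univ.filter fun i => nsq (q i) = x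
  have hS : ∀ x i, i ∈ S x ↔ nsq (q i) = x := fun x i => by simp [S]
  -- The multiplicities are at most 1, 1, n 0 - 2 and n 1 - 2. These bounds add up to N, and the
  -- four levels cover all N rows, so every bound is attained.
  have c1 : (S φ₁).card ≤ 1 := Finset.card_le_one.2 fun a ha b hb => by
    rw [hS] at ha hb
    exact h.signal_unique hgap hcross a b (ha.trans hb.symm) ((hroot a).2 (Or.inl ha))
  have c2 : (S φ₂).card ≤ 1 := Finset.card_le_one.2 fun a ha b hb => by
    rw [hS] at ha hb
    exact h.signal_unique hgap hcross a b (ha.trans hb.symm) ((hroot a).2 (Or.inr ha))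
  have c3 : ∀ k, (S (t k)).card + 2 ≤ n k := fun k => by
    have := h.card_noise hgap k
    rwa [Fintype.card_subtype] at this
  have hall : ∀ i, nsq (q i) = φ₁ ∨ nsq (q i) = φ₂ ∨ nsq (q i) = t 0 ∨ nsq (q i) = t 1 := by
    intro i
    by_cases hi : leadChar t ρ (scatter cls s) (nsq (q i)) = 0
    · rcases (hroot i).1 hi with h' | h' <;> simp [h']
    · have : ∀ k, score cls s (q i) k = 0 := by
        by_contra! hn
        exact hi ((h.leadChar_eq_zero_iff hgap i).2 hn)
      obtain ⟨k, hk⟩ := h.exists_nsq_eq i this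
      fin_cases k
      · exact Or.inr (Or.inr (Or.inl hk))
      · exact Or.inr (Or.inr (Or.inr hk))
  have hcov : N ≤ (S φ₁).card + (S φ₂).card + (S (t 0)).card + (S (t 1)).card := by
    have : (Finset.univ : Finset (Fin N)) ⊆ S φ₁ ∪ S φ₂ ∪ S (t 0) ∪ S (t 1) := fun i _ => by
      simp only [Finset.mem_union, hS]
      rcases hall i with h' | h' | h' | h' <;> simp [h']
    have h1 := Finset.card_le_card this
    have h2 := Finset.card_union_le (S φ₁ ∪ S φ₂ ∪ S (t 0)) (S (t 1))
    have h3 := Finset.card_union_le (S φ₁ ∪ S φ₂) (S (t 0))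
    have h4 := Finset.card_union_le (S φ₁) (S φ₂)
    rw [Finset.card_univ, Fintype.card_fin] at h1
    omega
  have hsz := h.size
  have d0 := c3 0
  have d1 := c3 1
  have hdisj : ∀ x y, x ≠ y → Disjoint (S x) (S y) := fun x y hxy => by
    rw [Finset.disjoint_left]
    intro i hx hy
    rw [hS] at hx hy
    exact hxy (hx.symm.trans hy)
  have hup : ∀ x (i : Fin N), x ≤ nsq (q i) ↔
      (i : ℕ) < (Finset.univ.filter fun i => x ≤ nsq (q i)).card := fun x i => by
    rw [← iff_lt_of_downward]
    · simp
    · intro i j hij hj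
      simp only [Finset.mem_filter, Finset.mem_univ, true_and] at hj ⊢
      exact hj.trans (hanti hij)
  rw [hroot]
  have hne : φ₁ ≠ φ₂ := g4.ne'
  -- If φ₂ < t 0, the descending order is φ₁, then n 0 - 2 copies of t 0, then φ₂, then t 1, which
  -- puts the signal at positions 1 and n 0. Otherwise φ₁ and φ₂ come first, and for k₀ = 2 the
  -- second interval of positions is empty.
  rcases lt_or_gt_of_ne g3 with hlt | hgt
  · have hk0 : k₀ = 1 := by
      rw [Finset.mem_Icc] at hk
      by_contra hne
      have := hk2 (by omega)
      linarith
    have e1 : (Finset.univ.filter fun i => φ₁ ≤ nsq (q i)) = S φ₁ := by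
      ext i
      simp only [Finset.mem_filter, Finset.mem_univ, true_and, hS]
      rcases hall i with h' | h' | h' | h' <;> rw [h'] <;> constructor <;> intro <;> linarith
    have e2 : (Finset.univ.filter fun i => t 0 ≤ nsq (q i)) = S φ₁ ∪ S (t 0) := by
      ext i
      simp only [Finset.mem_filter, Finset.mem_univ, true_and, hS, Finset.mem_union]
      rcases hall i with h' | h' | h' | h' <;> rw [h'] <;> constructor <;> intro h''
      all_goals first | simp | linarith | (rcases h'' with h'' | h'' <;> linarith)
    have e3 : (Finset.univ.filter fun i => φ₂ ≤ nsq (q i)) = S φ₁ ∪ S (t 0) ∪ S φ₂ := by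
      ext i
      simp only [Finset.mem_filter, Finset.mem_univ, true_and, hS, Finset.mem_union]
      rcases hall i with h' | h' | h' | h' <;> rw [h'] <;> constructor <;> intro h''
      all_goals first | simp | linarith | (rcases h'' with (h'' | h'') | h'' <;> linarith)
    have f2 : (S φ₁ ∪ S (t 0)).card = (S φ₁).card + (S (t 0)).card :=
      Finset.card_union_of_disjoint (hdisj _ _ g1.ne')
    have f3 : (S φ₁ ∪ S (t 0) ∪ S φ₂).card = (S φ₁).card + (S (t 0)).card + (S φ₂).card := by
      rw [Finset.card_union_of_disjoint, f2]
      exact Finset.disjoint_union_left.2 ⟨hdisj _ _ hne, hdisj _ _ hlt.ne'⟩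
    have u1 := hup φ₁ i
    have u2 := hup (t 0) i
    have u3 := hup φ₂ i
    rw [e1] at u1
    rw [e2, f2] at u2
    rw [e3, f3] at u3
    subst hk0
    simp only [Finset.mem_union, Finset.mem_Icc]
    constructor
    · rintro (hi | hi)
      · have := u1.2 (by omega)
        rcases hall i with h' | h' | h' | h'
        · exact Or.inl h'
        all_goals exfalso; linarith
      · have v3 := u3.2 (by omega)
        have v2 : ¬ (t 0 ≤ nsq (q i)) := fun h' => by have := u2.1 h'; omega
        rcases hall i with h' | h' | h' | h'
        · exact Or.inl h'
        · exact Or.inr h'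
        all_goals exfalso; linarith
    · rintro (hi | hi)
      · have := u1.1 hi.ge
        omega
      · have := u3.1 hi.ge
        have v2 : ¬ ((i : ℕ) < (S φ₁).card + (S (t 0)).card) := fun h' => by
          have := u2.2 h'; linarith
        omega
  · have hk0 : k₀ = 2 := by
      rw [Finset.mem_Icc] at hk
      by_contra hne
      have := hk1 (by omega)
      linarith
    have e3 : (Finset.univ.filter fun i => φ₂ ≤ nsq (q i)) = S φ₁ ∪ S φ₂ := by
      ext i
      simp only [Finset.mem_filter, Finset.mem_univ, true_and, hS, Finset.mem_union]
      rcases hall i with h' | h' | h' | h' <;> rw [h'] <;> constructor <;> intro h''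
      all_goals first | simp | linarith | (rcases h'' with h'' | h'' <;> linarith)
    have f3 : (S φ₁ ∪ S φ₂).card = (S φ₁).card + (S φ₂).card :=
      Finset.card_union_of_disjoint (hdisj _ _ hne)
    have u3 := hup φ₂ i
    rw [e3, f3] at u3
    subst hk0
    simp only [Finset.mem_union, Finset.mem_Icc]
    constructor
    · intro hi
      have := u3.2 (by omega)
      rcases hall i with h' | h' | h' | h'
      · exact Or.inl h'
      · exact Or.inr h'
      all_goals exfalso; linarith
    · intro hi
      have : φ₂ ≤ nsq (q i) := by rcases hi with hi | hi <;> rw [hi]; exact hle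
      have := u3.1 this
      omega

end Generic

end GramLimit

end SpikedModel

/-! ### The two cases of the ridge parameter, in the limit -/

namespace SpikedModel

namespace GramLimit

variable {ι : Type*} [Fintype ι] [DecidableEq ι] {cls : ι → Fin 2} {n : Fin 2 → ℕ}
    {t : Fin 2 → ℝ} {ρ : ℝ} {s : ι → ℝ} {N : ℕ} {q : Fin N → ι → ℝ}

/-- Limit of the inner product of the `l`-th leading direction with the vector `∑ a, u a • x a`. -/
def leadScore (ρ : ℝ) (cls : ι → Fin 2) (s u : ι → ℝ) (l : Fin 2) : ℝ :=
  ∑ a, u a * (s a * corr ρ (cls a) l)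

/-- Limit of the inner product of the mean difference with the vector `∑ a, u a • x a`. -/
def diffScore (cls : ι → Fin 2) (s : ι → ℝ) (e : Fin 2 → ℝ) (u : ι → ℝ) : ℝ :=
  ∑ a, u a * (s a * e (cls a))

omit [DecidableEq ι] in
theorem diffScore_eq (e : Fin 2 → ℝ) (u : ι → ℝ) :
    diffScore cls s e u = e 0 * score cls s u 0 + e 1 * score cls s u 1 := by
  rw [diffScore, sum_eq_classSum cls, score, score, ← classSum_mul_left, ← classSum_mul_left]
  congr 2 <;> · funext a; ring

omit [DecidableEq ι] in
theorem leadScore_eq (u : ι → ℝ) (l : Fin 2) : leadScore ρ cls s u l =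
    corr ρ 0 l * score cls s u 0 + corr ρ 1 l * score cls s u 1 :=
  diffScore_eq (cls := cls) (s := s) (fun k => corr ρ k l) u

omit [DecidableEq ι] in
theorem corr_symm (k l : Fin 2) : corr ρ k l = corr ρ l k := by
  simp only [corr, eq_comm]

/-- A ridge parameter that is not the negative of a signal eigenvalue leaves a component of the
ridge direction in the leading eigenspace. -/
theorem regular_ridge (h : GramLimit cls n t ρ s q)
    (hgap : scatter cls s 1 * (1 - ρ ^ 2) ≠ t 0 - t 1) {e : Fin 2 → ℝ}
    (he1 : e 1 ≠ ρ * e 0) (he0 : e 0 ≠ ρ * e 1) {α : ℝ} {g : Fin N → ℝ}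
    (hα : ∀ i, leadChar t ρ (scatter cls s) (nsq (q i)) = 0 →
      nsq (q i) + α ≠ 0 ∧ g i = α / (nsq (q i) + α))
    (hz : ∀ l, e l + ∑ i, (g i - 1) * ((nsq (q i))⁻¹ * diffScore cls s e (q i)) *
      ((nsq (q i))⁻¹ * leadScore ρ cls s (q i) l) = 0) : False := by
  classical
  have hnoise : ∀ i, leadChar t ρ (scatter cls s) (nsq (q i)) ≠ 0 → ∀ k, score cls s (q i) k = 0 := by
    intro i hi
    by_contra! hn
    exact hi ((h.leadChar_eq_zero_iff hgap i).2 hn)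
  have hpos : ∀ i, nsq (q i) ≠ 0 := fun i => (h.norm_pos i).ne'
  -- These weights make u equal to (G + α)⁻¹ applied to the vector s_a e_{cls a}, on the span of the
  -- signal rows; noise rows have zero scores and do not occur in that vector.
  let w : Fin N → ℝ := fun i => if leadChar t ρ (scatter cls s) (nsq (q i)) = 0 then
    diffScore cls s e (q i) / (nsq (q i) * (nsq (q i) + α)) else 0
  let u : ι → ℝ := fun a => ∑ i, w i * q i a
  have hu : ∀ k, classSum cls k u = 0 := fun k => by
    simp only [u]
    rw [classSum_sum]
    exact Finset.sum_eq_zero fun i _ => by rw [classSum_const_mul, h.cent, mul_zero]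
  have hsc : ∀ k, score cls s u k = ∑ i, w i * score cls s (q i) k := fun k => by
    simp only [score, ← classSum_const_mul]
    rw [← classSum_sum]
    congr 1
    funext a
    simp only [u, Finset.mul_sum]
    exact Finset.sum_congr rfl fun i _ => by ring
  -- For a signal row g_i - 1 = -nsq / (nsq + α), so the assumed vanishing says that e consists of
  -- the leading scores of u.
  have hlead : ∀ l, e l = corr ρ 0 l * score cls s u 0 + corr ρ 1 l * score cls s u 1 := fun l => by
    rw [hsc, hsc, Finset.mul_sum, Finset.mul_sum, ← Finset.sum_add_distrib,
      ← sub_eq_zero, ← hz l, sub_eq_add_neg, ← Finset.sum_neg_distrib]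
    congr 1
    refine Finset.sum_congr rfl fun i _ => ?_
    rw [leadScore_eq]
    by_cases hi : leadChar t ρ (scatter cls s) (nsq (q i)) = 0
    · obtain ⟨h1, h2⟩ := hα i hi
      have := hpos i
      simp only [w, if_pos hi, h2]
      field_simp
      ring
    · simp [hnoise i hi]
  have hexp : ∀ a, s a * e (cls a) = ∑ i, w i * (nsq (q i) + α) * q i a := fun a => by
    have hc : ∀ k, classSum cls k (fun a => s a * e (cls a)) = 0 := fun k => by
      have := classSum_mul_left cls k e s
      rw [h.s_cent, mul_zero] at this
      rw [← this]
      congr 1; funext a; ring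
    have h1 : s a * e (cls a) = _ := h.expand (fun a => s a * e (cls a)) hc a
    rw [h1]
    refine Finset.sum_congr rfl fun i _ => ?_
    change diffScore cls s e (q i) / nsq (q i) * q i a = _
    by_cases hi : leadChar t ρ (scatter cls s) (nsq (q i)) = 0
    · obtain ⟨h1, h2⟩ := hα i hi
      have := hpos i
      simp only [w, if_pos hi]
      field_simp
    · rw [diffScore_eq, hnoise i hi, hnoise i hi]
      simp [w, hi]
  have happ : ∀ a, ∑ i, w i * nsq (q i) * q i a = s a * e (cls a) + t (cls a) * u a := fun a => by
    rw [hlead (cls a)]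
    have := h.apply_centred u hu a
    rw [corr_symm 0 (cls a), corr_symm 1 (cls a)]
    refine Eq.trans ?_ this
    refine Finset.sum_congr rfl fun i _ => ?_
    have h2 : ∑ b, q i b * u b = w i * nsq (q i) := by
      simp only [u, Finset.mul_sum]
      rw [Finset.sum_comm, Finset.sum_eq_single i]
      · rw [nsq, Finset.mul_sum]
        exact Finset.sum_congr rfl fun b _ => by ring
      · intro j _ hj
        rw [← mul_zero (w j), ← h.orth i j hj.symm, Finset.mul_sum]
        exact Finset.sum_congr rfl fun b _ => by ring
      · simp
    rw [h2]; ring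
  -- By `hexp`, (G + α) u = s e; by `happ`, G u = s e + t u. Their difference is diagonal.
  have hzero : ∀ a, (t (cls a) + α) * u a = 0 := fun a => by
    have h1 := hexp a
    have h2 : ∑ i, w i * (nsq (q i) + α) * q i a = ∑ i, w i * nsq (q i) * q i a + α * u a := by
      simp only [u, Finset.mul_sum, ← Finset.sum_add_distrib]
      exact Finset.sum_congr rfl fun i _ => by ring
    rw [h2, happ a] at h1
    linarith
  have hk : ∀ k, t k + α ≠ 0 → score cls s u k = 0 := fun k hk => by
    refine Finset.sum_eq_zero fun a _ => ?_
    split_ifs with ha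
    · have := hzero a
      rw [ha] at this
      change s a * u a = 0
      rw [(mul_eq_zero.1 this).resolve_left hk, mul_zero]
    · rfl
  have l0 := hlead 0
  have l1 := hlead 1
  simp only [corr_00, corr_01, corr_10, corr_11] at l0 l1
  -- As t 0 ≠ t 1, at most one factor vanishes, so u is zero on some class and e is a multiple of a
  -- single row of the correlation matrix.
  by_cases h0 : t 0 + α = 0
  · have h1 : t 1 + α ≠ 0 := by have := h.t_lt; intro h1; linarith
    rw [hk 1 h1] at l0 l1
    refine he1 ?_
    rw [l0, l1]; ring
  · rw [hk 0 h0] at l0 l1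
    refine he0 ?_
    rw [l0, l1]; ring

/-- Every signal eigenvector has a component along both the mean difference and the leading
eigenspace. -/
theorem singular_ridge (h : GramLimit cls n t ρ s q) {e : Fin 2 → ℝ}
    (hgap : scatter cls s 1 * (1 - ρ ^ 2) ≠ t 0 - t 1)
    (hcross : crossDet t ρ (scatter cls s) e ≠ 0) (i : Fin N)
    (hi : leadChar t ρ (scatter cls s) (nsq (q i)) = 0)
    (hz : ∀ l, ((nsq (q i))⁻¹ * diffScore cls s e (q i)) *
      ((nsq (q i))⁻¹ * leadScore ρ cls s (q i) l) = 0) : False := by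
  obtain ⟨k, hk⟩ := (h.leadChar_eq_zero_iff hgap i).1 hi
  have hpos : nsq (q i) ≠ 0 := (h.norm_pos i).ne'
  have hρ := h.rho
  by_cases hd : diffScore cls s e (q i) = 0
  · have h0 := h.score_eq i 0
    have h1 := h.score_eq i 1
    simp only [corr_00, corr_01, corr_10, corr_11, one_mul] at h0 h1
    rw [diffScore_eq] at hd
    -- The score vector is an eigenvector of the 2 × 2 matrix and is orthogonal to e, hence also to
    -- the image of e under the transposed matrix. `crossDet` is the determinant of e and this
    -- image, up to sign, so the scores vanish.
    have e0 : crossDet t ρ (scatter cls s) e * score cls s (q i) 0 = 0 := by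
      simp only [crossDet]
      linear_combination (-e 1 * e 0) * h0 - e 1 * e 1 * h1 +
        (e 1 * nsq (q i) - (ρ * scatter cls s 0 * e 0 + scatter cls s 1 * e 1 + t 1 * e 1)) * hd
    have e1 : crossDet t ρ (scatter cls s) e * score cls s (q i) 1 = 0 := by
      simp only [crossDet]
      linear_combination (e 0 * e 0) * h0 + e 0 * e 1 * h1 +
        (-e 0 * nsq (q i) + (scatter cls s 0 * e 0 + ρ * scatter cls s 1 * e 1 + t 0 * e 0)) * hd
    fin_cases k
    · exact hk ((mul_eq_zero.1 e0).resolve_left hcross)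
    · exact hk ((mul_eq_zero.1 e1).resolve_left hcross)
  · have hl : ∀ l, leadScore ρ cls s (q i) l = 0 := fun l => by
      simpa [hpos, hd] using hz l
    have l0 := hl 0
    have l1 := hl 1
    rw [leadScore_eq] at l0 l1
    simp only [corr_00, corr_01, corr_10, corr_11] at l0 l1
    -- The correlation matrix is invertible, so vanishing leading scores force both class scores to
    -- vanish.
    have e0 : (1 - ρ ^ 2) * score cls s (q i) 0 = 0 := by linear_combination l0 - ρ * l1
    have e1 : (1 - ρ ^ 2) * score cls s (q i) 1 = 0 := by linear_combination l1 - ρ * l0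
    have hne : 1 - ρ ^ 2 ≠ 0 := by linarith
    fin_cases k
    · exact hk ((mul_eq_zero.1 e0).resolve_left hne)
    · exact hk ((mul_eq_zero.1 e1).resolve_left hne)

end GramLimit

/-! ### Passage to the limit along an ultrafilter -/

theorem exists_tendsto_of_bounded {α : Type*} (𝒰 : Ultrafilter α) (f : α → ℝ) (C : ℝ)
    (hf : ∀ᶠ p in (𝒰 : Filter α), |f p| ≤ C) : ∃ r, Tendsto f 𝒰 (𝓝 r) := by
  obtain ⟨r, _, hr⟩ := (isCompact_Icc (a := -C) (b := C)).ultrafilter_le_nhds (𝒰.map f)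
    (by
      rw [Ultrafilter.coe_map, le_principal_iff, mem_map]
      filter_upwards [hf] with p hp
      exact abs_le.1 hp)
  exact ⟨r, hr⟩

/-- The coordinate of `v` on the `i`-th basis vector, for `i < p`. -/
noncomputable def coordAt {p : ℕ} (U : OrthonormalBasis (Fin p) ℝ (RR p)) (i : ℕ) (v : RR p) : ℝ :=
  if h : i < p then inner ℝ (U ⟨i, h⟩) v else 0

theorem abs_coordAt_le {p : ℕ} (U : OrthonormalBasis (Fin p) ℝ (RR p)) (i : ℕ) (v : RR p) :
    |coordAt U i v| ≤ ‖v‖ := by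
  rw [coordAt]
  split_ifs with h
  · have := abs_real_inner_le_norm (U ⟨i, h⟩) v
    rwa [U.norm_eq_one, one_mul] at this
  · simp

theorem coordAt_of_lt {p : ℕ} (U : OrthonormalBasis (Fin p) ℝ (RR p)) (i : Fin p) (v : RR p) :
    coordAt U i v = inner ℝ (U i) v := by
  simp [coordAt]

theorem sum_fin_eq_sum_of_le {N p : ℕ} (hNp : N ≤ p) (f : ℕ → ℝ) (hf : ∀ i, N ≤ i → f i = 0) :
    ∑ i : Fin p, f i = ∑ i : Fin N, f i := by
  rw [Fin.sum_univ_eq_sum_range f p, Fin.sum_univ_eq_sum_range f N]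
  refine (Finset.sum_subset (Finset.range_mono hNp) fun i _ hi => hf i ?_).symm
  simpa using hi

/-- Limits of the inner products between the scaled centred training points `x`, the scaled sample
mean difference `y` and the leading population eigenvectors `f`. -/
structure SampleLimit {ι : Type*} [Fintype ι] [DecidableEq ι] (cls : ι → Fin 2) (n : Fin 2 → ℕ)
    (t : Fin 2 → ℝ) (ρ : ℝ) (s : ι → ℝ) (e : Fin 2 → ℝ) (x : (p : ℕ) → ι → RR p)
    (y : (p : ℕ) → RR p) (f : Fin 2 → (p : ℕ) → RR p) (F : Filter ℕ) : Prop where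
  gram : ∀ a b, Tendsto (fun p => inner ℝ (x p a) (x p b)) F
    (𝓝 (s a * s b * corr ρ (cls a) (cls b) +
    t (cls a) * ((if a = b then 1 else 0) - if cls a = cls b then (n (cls a) : ℝ)⁻¹ else 0)))
  lead : ∀ a l, Tendsto (fun p => inner ℝ (x p a) (f l p)) F (𝓝 (s a * corr ρ (cls a) l))
  diff : ∀ a, Tendsto (fun p => inner ℝ (x p a) (y p)) F (𝓝 (s a * e (cls a)))
  diff_lead : ∀ l, Tendsto (fun p => inner ℝ (y p) (f l p)) F (𝓝 (e l))
  bdd : ∃ C, ∀ᶠ p in F, ‖y p‖ ≤ C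

/-- `μ, U` is a descending eigen-decomposition of `∑ a, x a (x a)ᵀ`, for class-wise centred `x`. -/
structure EigenSystem {ι : Type*} [Fintype ι] (cls : ι → Fin 2) {p : ℕ} (x : ι → RR p)
    (μ : Fin p → ℝ) (U : OrthonormalBasis (Fin p) ℝ (RR p)) : Prop where
  cent : ∀ k, ∑ a, (if cls a = k then x a else 0) = 0
  anti : Antitone μ
  eig : ∀ i, ∑ a, inner ℝ (x a) (U i) • x a = μ i • U i

namespace EigenSystem

variable {ι : Type*} [Fintype ι] {cls : ι → Fin 2} {p : ℕ} {x : ι → RR p}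
    {μ : Fin p → ℝ} {U : OrthonormalBasis (Fin p) ℝ (RR p)}

/-- Where the eigenvalue is nonzero, a sample eigenvector sees any vector only through its inner
products with the training points. -/
theorem mul_inner (h : EigenSystem cls x μ U) (i : Fin p) (v : RR p) :
    ∑ a, inner ℝ (U i) (x a) * inner ℝ (x a) v = μ i * inner ℝ (U i) v := by
  rw [← real_inner_smul_left, ← h.eig i, sum_inner]
  refine Finset.sum_congr rfl fun a _ => ?_
  rw [real_inner_smul_left, real_inner_comm]

theorem sum_mul (h : EigenSystem cls x μ U) (i j : Fin p) :
    ∑ a, inner ℝ (U i) (x a) * inner ℝ (U j) (x a) = if i = j then μ i else 0 := by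
  have := h.mul_inner i (U j)
  simp only [real_inner_comm (U j)] at this
  rw [this, real_inner_comm, orthonormal_iff_ite.1 U.orthonormal]
  split_ifs <;> simp

theorem nonneg (h : EigenSystem cls x μ U) (i : Fin p) : 0 ≤ μ i := by
  have := h.sum_mul i i
  rw [if_pos rfl] at this
  rw [← this]
  exact Finset.sum_nonneg fun a _ => mul_self_nonneg _

theorem inner_cent (h : EigenSystem cls x μ U) (k : Fin 2) (i : Fin p) :
    classSum cls k (fun a => inner ℝ (U i) (x a)) = 0 := by
  have := congrArg (fun v => inner ℝ (U i) v) (h.cent k)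
  simp only [inner_sum, inner_zero_right] at this
  rw [← this]
  refine Finset.sum_congr rfl fun a _ => ?_
  split_ifs <;> simp

/-- A nonzero eigenvalue at index i ≥ N would give i + 1 nonzero orthogonal coordinate rows, all
orthogonal to the two class indicators: i + 3 orthogonal vectors in dimension N + 2. -/
theorem eq_zero_of_le (h : EigenSystem cls x μ U) {N : ℕ} (hN : Fintype.card ι = N + 2)
    (hne : ∀ k, ∃ a, cls a = k) (i : Fin p) (hi : N ≤ i) : μ i = 0 := by
  by_contra hμ
  have hpos : ∀ j : Fin p, j ≤ i → μ j ≠ 0 := fun j hj =>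
    (((h.nonneg i).lt_of_ne (Ne.symm hμ)).trans_le (h.anti hj)).ne'
  have hcent := h.inner_cent
  have := card_le_of_orthogonal (κ := {j // j ≤ i} ⊕ Fin 2)
    (Sum.elim (fun j a => inner ℝ (U j) (x a)) (fun k a => if cls a = k then 1 else 0)) ?_ ?_
  · have hc : Fintype.card {j // j ≤ i} = i + 1 := by
      rw [Fintype.card_subtype]
      have : (Finset.univ.filter fun j => j ≤ i) = Finset.Iic i := by ext; simp
      rw [this, Fin.card_Iic]
    simp only [Fintype.card_sum, hc, Fintype.card_fin] at this
    omega
  · rintro (j | j) (l | l) hjl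
    · simp only [Sum.elim_inl]
      rw [h.sum_mul, if_neg]
      exact fun he => hjl (by rw [Subtype.ext he])
    · simpa [classSum] using hcent l j
    · simpa [classSum] using hcent j l
    · simp only [Sum.elim_inr]
      refine Finset.sum_eq_zero fun a _ => ?_
      have : j ≠ l := fun he => hjl (by rw [he])
      by_cases ha : cls a = j
      · have : cls a ≠ l := fun hb => this (ha.symm.trans hb)
        simp [this]
      · simp [ha]
  · rintro (j | k) h0
    · have h1 := h.sum_mul j j
      rw [if_pos rfl] at h1
      refine hpos j j.2 ?_
      rw [← h1]
      exact Finset.sum_eq_zero fun a _ => by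
        have : inner ℝ (U j) (x a) = 0 := congrFun h0 a
        rw [this, zero_mul]
    · obtain ⟨a, ha⟩ := hne k
      have : (if cls a = k then (1 : ℝ) else 0) = 0 := congrFun h0 a
      rw [if_pos ha] at this
      exact one_ne_zero this

theorem inner_eq_zero_of_le (h : EigenSystem cls x μ U) {N : ℕ} (hN : Fintype.card ι = N + 2)
    (hne : ∀ k, ∃ a, cls a = k) (i : Fin p) (hi : N ≤ i) (a : ι) : inner ℝ (U i) (x a) = 0 := by
  have h1 := h.sum_mul i i
  rw [if_pos rfl, h.eq_zero_of_le hN hne i hi] at h1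
  have := (Finset.sum_eq_zero_iff_of_nonneg (fun a _ => mul_self_nonneg _)).1 h1 a
    (Finset.mem_univ a)
  simpa using this

end EigenSystem

end SpikedModel

/-! ### Spectral filters and their limits -/

namespace SpikedModel

/-- The vector with multiples `c i` of the coordinates of `y` in the basis `U`. -/
noncomputable def filtered {p : ℕ} (U : OrthonormalBasis (Fin p) ℝ (RR p)) (c : ℕ → ℝ) (y : RR p) :
    RR p := ∑ i : Fin p, (c i * inner ℝ (U i) y) • U i

theorem norm_filtered_le {p : ℕ} (U : OrthonormalBasis (Fin p) ℝ (RR p)) (c : ℕ → ℝ) (y : RR p)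
    (C : ℝ) (hC : 0 ≤ C) (hc : ∀ i : Fin p, |c i| ≤ C) : ‖filtered U c y‖ ≤ C * ‖y‖ := by
  refine le_of_sq_le_sq ?_ (by positivity)
  have h1 : ∀ i, inner ℝ (U i) (filtered U c y) = c i * inner ℝ (U i) y := fun i => by
    rw [filtered, U.orthonormal.inner_right_fintype]
  rw [← U.sum_sq_norm_inner_right, mul_pow, ← U.sum_sq_norm_inner_right y, Finset.mul_sum]
  refine Finset.sum_le_sum fun i _ => ?_
  rw [h1, norm_mul, mul_pow]
  exact mul_le_mul_of_nonneg_right (pow_le_pow_left₀ (abs_nonneg _) (hc i) 2) (by positivity)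

/-- The filter is constant beyond `N`, so subtracting that constant leaves a sum of fixed length.
The sample eigenvectors of the growing null space need not be controlled. -/
theorem inner_filtered {N p : ℕ} (hNp : N ≤ p) (U : OrthonormalBasis (Fin p) ℝ (RR p))
    (c : ℕ → ℝ) (δ : ℝ) (hc : ∀ i, N ≤ i → c i = δ) (y f : RR p) :
    inner ℝ (filtered U c y) f = δ * inner ℝ y f +
      ∑ i : Fin N, (c i - δ) * coordAt U i y * coordAt U i f := by
  have h1 : inner ℝ (filtered U c y) f = ∑ i : Fin p, c i * coordAt U i y * coordAt U i f := by
    rw [filtered, sum_inner]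
    refine Finset.sum_congr rfl fun i _ => ?_
    rw [real_inner_smul_left, coordAt_of_lt, coordAt_of_lt]
  have h2 : inner ℝ y f = ∑ i : Fin p, coordAt U i y * coordAt U i f := by
    rw [← U.sum_inner_mul_inner]
    refine Finset.sum_congr rfl fun i _ => ?_
    rw [coordAt_of_lt, coordAt_of_lt, real_inner_comm]
  rw [h1, h2, ← sum_fin_eq_sum_of_le hNp (fun i => (c i - δ) * coordAt U i y * coordAt U i f),
    Finset.mul_sum, ← Finset.sum_add_distrib]
  · exact Finset.sum_congr rfl fun i _ => by ring
  · intro i hi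
    simp [hc i hi]

/-- Any rescaling `κ` that keeps the vectors bounded may replace normalisation to unit length. This
permits κ → 0 when a ridge coefficient diverges. -/
theorem limit_eq_zero_of_normalized {F : Filter ℕ} [F.NeBot] (v f : (p : ℕ) → RR p) (κ : ℕ → ℝ)
    (C L : ℝ) (hv : ∀ᶠ p in F, ‖κ p • v p‖ ≤ C)
    (hL : Tendsto (fun p => inner ℝ (κ p • v p) (f p)) F (𝓝 L))
    (hw : Tendsto (fun p => inner ℝ (‖v p‖⁻¹ • v p) (f p)) F (𝓝 0)) : L = 0 := by
  refine tendsto_nhds_unique hL (squeeze_zero_norm' (a := fun p =>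
    C * ‖inner ℝ (‖v p‖⁻¹ • v p) (f p)‖) ?_ ?_)
  · filter_upwards [hv] with p hp
    have : inner ℝ (κ p • v p) (f p) = (κ p * ‖v p‖) * inner ℝ (‖v p‖⁻¹ • v p) (f p) := by
      rw [real_inner_smul_left, real_inner_smul_left]
      by_cases h0 : v p = 0
      · simp [h0]
      · have := norm_ne_zero_iff.2 h0
        field_simp
    rw [this, norm_mul]
    refine mul_le_mul_of_nonneg_right ?_ (norm_nonneg _)
    rwa [norm_mul, norm_norm, ← norm_smul]
  · simpa using (hw.norm).const_mul C

section Limit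

variable {ι : Type*} [Fintype ι] [DecidableEq ι] {cls : ι → Fin 2} {n : Fin 2 → ℕ}
  {t : Fin 2 → ℝ} {ρ : ℝ} {s : ι → ℝ} {N : ℕ} {e : Fin 2 → ℝ} {x : (p : ℕ) → ι → RR p}
  {y : (p : ℕ) → RR p} {f : Fin 2 → (p : ℕ) → RR p} {𝒰 : Ultrafilter ℕ}
  {μ : (p : ℕ) → Fin p → ℝ} {U : (p : ℕ) → OrthonormalBasis (Fin p) ℝ (RR p)}

theorem SampleLimit.exists_rows (hs : SampleLimit cls n t ρ s e x y f 𝒰) :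
    ∃ q : Fin N → ι → ℝ, ∀ (i : Fin N) a, Tendsto (fun p => coordAt (U p) i (x p a)) 𝒰 (𝓝 (q i a)) := by
  have : ∀ (i : Fin N) (a : ι), ∃ r, Tendsto (fun p => coordAt (U p) i (x p a)) 𝒰 (𝓝 r) := by
    intro i a
    have h1 := hs.gram a a
    obtain ⟨C, hC⟩ := h1.isBoundedUnder_le
    refine exists_tendsto_of_bounded 𝒰 _ √C ?_
    filter_upwards [eventually_map.1 hC] with p hp
    refine (abs_coordAt_le _ _ _).trans (Real.le_sqrt_of_sq_le ?_)
    rwa [← real_inner_self_eq_norm_sq]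
  choose q hq using this
  exact ⟨q, hq⟩

variable (h𝒰 : (𝒰 : Filter ℕ) ≤ atTop) (hs : SampleLimit cls n t ρ s e x y f 𝒰)
  (hE : ∀ᶠ p in 𝒰, EigenSystem cls (x p) (μ p) (U p)) {q : Fin N → ι → ℝ}
  (hq : ∀ (i : Fin N) a, Tendsto (fun p => coordAt (U p) i (x p a)) 𝒰 (𝓝 (q i a)))

include h𝒰 hE hq

theorem tendsto_eigval_nsq (i : Fin N) :
    Tendsto (fun p => if h : (i : ℕ) < p then μ p ⟨i, h⟩ else 0) 𝒰 (𝓝 (GramLimit.nsq (q i))) := by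
  have h1 : Tendsto (fun p => ∑ a, coordAt (U p) i (x p a) * coordAt (U p) i (x p a)) 𝒰
      (𝓝 (GramLimit.nsq (q i))) := tendsto_finsetSum _ fun a _ => (hq i a).mul (hq i a)
  refine h1.congr' ?_
  filter_upwards [hE, h𝒰 (eventually_gt_atTop (i : ℕ))] with p hp hip
  have := hp.sum_mul ⟨i, hip⟩ ⟨i, hip⟩
  simp only [if_true] at this
  simp only [coordAt, hip, dif_pos, this]

theorem antitone_nsq : Antitone fun i => GramLimit.nsq (q i) := by
  intro i j hij
  refine le_of_tendsto_of_tendsto (tendsto_eigval_nsq h𝒰 hE hq j) (tendsto_eigval_nsq h𝒰 hE hq i) ?_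
  filter_upwards [hE, h𝒰 (eventually_gt_atTop (i : ℕ)), h𝒰 (eventually_gt_atTop (j : ℕ))]
    with p hp hi hj
  simp only [hi, hj, dif_pos]
  exact hp.anti hij

include hs

/-- All sample eigenvalues beyond `N` vanish, so Parseval's identity for the Gram entries has only
`N` terms and passes to the limit. -/
theorem gramLimit (hcard : ∀ k, Fintype.card {a // cls a = k} = n k) (hn : ∀ k, 2 ≤ n k)
    (hN : N + 2 = n 0 + n 1) (htpos : ∀ k, 0 < t k) (ht : t 1 < t 0) (hρ : ρ ^ 2 < 1)
    (hsc : ∀ k, classSum cls k s = 0) (hsp : ∀ k, 0 < classSum cls k (fun a => s a * s a)) :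
    GramLimit cls n t ρ s q where
  card := hcard
  two_le := hn
  size := hN
  t_pos := htpos
  t_lt := ht
  rho := hρ
  s_cent := hsc
  s_pos := hsp
  cent i k := by
    have h1 : Tendsto (fun p => classSum cls k fun a => coordAt (U p) i (x p a)) 𝒰
        (𝓝 (classSum cls k (q i))) := by
      refine tendsto_finsetSum _ fun a _ => ?_
      split_ifs
      · exact hq i a
      · exact tendsto_const_nhds
    refine tendsto_nhds_unique h1 (tendsto_const_nhds.congr' ?_)
    filter_upwards [hE, h𝒰 (eventually_gt_atTop (i : ℕ))] with p hp hip
    simp only [coordAt, hip, dif_pos]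
    exact (hp.inner_cent k _).symm
  orth i j hij := by
    have h1 : Tendsto (fun p => ∑ a, coordAt (U p) i (x p a) * coordAt (U p) j (x p a)) 𝒰
        (𝓝 (∑ a, q i a * q j a)) := tendsto_finsetSum _ fun a _ => (hq i a).mul (hq j a)
    refine tendsto_nhds_unique h1 (tendsto_const_nhds.congr' ?_)
    filter_upwards [hE, h𝒰 (eventually_gt_atTop (i : ℕ)), h𝒰 (eventually_gt_atTop (j : ℕ))]
      with p hp hi hj
    simp only [coordAt, hi, hj, dif_pos]
    rw [hp.sum_mul, if_neg]
    simpa [Fin.ext_iff] using hij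
  gram a b := by
    have h1 : Tendsto (fun p => ∑ i : Fin N, coordAt (U p) i (x p a) * coordAt (U p) i (x p b)) 𝒰
        (𝓝 (∑ i, q i a * q i b)) := tendsto_finsetSum _ fun i _ => (hq i a).mul (hq i b)
    have hc : Fintype.card ι = N + 2 := by
      have h1 := sum_eq_classSum cls (fun _ : ι => (1 : ℝ))
      rw [classSum_eq_sum_subtype, classSum_eq_sum_subtype] at h1
      simp only [Finset.sum_const, Finset.card_univ, hcard, nsmul_eq_mul, mul_one] at h1
      rw [hN]
      exact_mod_cast h1
    have hne : ∀ k, ∃ a, cls a = k := fun k => by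
      have : Nonempty {a // cls a = k} := by
        rw [← Fintype.card_pos_iff, hcard]; have := hn k; omega
      exact ⟨this.some.1, this.some.2⟩
    refine tendsto_nhds_unique h1 ((hs.gram a b).congr' ?_)
    filter_upwards [hE, h𝒰 (eventually_ge_atTop N)] with p hp hNp
    rw [← (U p).sum_inner_mul_inner, ← sum_fin_eq_sum_of_le hNp
      (fun i => coordAt (U p) i (x p a) * coordAt (U p) i (x p b))]
    · refine Finset.sum_congr rfl fun i _ => ?_
      rw [coordAt_of_lt, coordAt_of_lt, real_inner_comm]
    · intro i hi
      rw [coordAt]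
      split_ifs with h
      · rw [hp.inner_eq_zero_of_le hc hne ⟨i, h⟩ hi, zero_mul]
      · rw [zero_mul]

/-- The limiting eigenvalue is positive, so `mul_inner` may be divided by it before passing to the
limit. -/
theorem tendsto_coord {v : (p : ℕ) → RR p} {c : ι → ℝ} (hG : GramLimit cls n t ρ s q)
    (hv : ∀ a, Tendsto (fun p => inner ℝ (x p a) (v p)) 𝒰 (𝓝 (c a))) (i : Fin N) :
    Tendsto (fun p => coordAt (U p) i (v p)) 𝒰
      (𝓝 ((GramLimit.nsq (q i))⁻¹ * ∑ a, q i a * c a)) := by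
  have hpos : GramLimit.nsq (q i) ≠ 0 := (hG.norm_pos i).ne'
  have h1 := tendsto_eigval_nsq h𝒰 hE hq i
  have h2 := (h1.inv₀ hpos).mul
    (tendsto_finsetSum Finset.univ fun a _ => (hq i a).mul (hv a))
  refine h2.congr' ?_
  filter_upwards [hE, h𝒰 (eventually_gt_atTop (i : ℕ)), h1.eventually_ne hpos] with p hp hi hμ
  simp only [coordAt, hi, dif_pos] at hμ ⊢
  rw [hp.mul_inner, inv_mul_cancel_left₀ hμ]

/-- Limits for a vector obtained from the sample mean difference by a spectral filter. -/
theorem filter_limit_eq_zero (hG : GramLimit cls n t ρ s q) (c : ℕ → ℕ → ℝ) (δ κ : ℕ → ℝ) (γ : ℝ)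
    (g : Fin N → ℝ) (hδ : Tendsto (fun p => κ p * δ p) 𝒰 (𝓝 γ))
    (hcδ : ∀ p i, N ≤ i → c p i = δ p)
    (hg : ∀ i : Fin N, Tendsto (fun p => κ p * c p i) 𝒰 (𝓝 (g i))) (l : Fin 2)
    (hw : Tendsto (fun p => inner ℝ (‖filtered (U p) (c p) (y p)‖⁻¹ •
      filtered (U p) (c p) (y p)) (f l p)) 𝒰 (𝓝 0)) :
    γ * e l + ∑ i, (g i - γ) * ((GramLimit.nsq (q i))⁻¹ * GramLimit.diffScore cls s e (q i)) *
      ((GramLimit.nsq (q i))⁻¹ * GramLimit.leadScore ρ cls s (q i) l) = 0 := by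
  obtain ⟨Cy, hCy⟩ := hs.bdd
  have hb : ∀ᶠ p in (𝒰 : Filter ℕ), ∀ i : Fin N, |κ p * c p i| ≤ ∑ j, (|g j| + 1) + (|γ| + 1) := by
    rw [eventually_all]
    intro i
    filter_upwards [(hg i).abs.eventually_lt_const (lt_add_one |g i|)] with p hp
    have h1 : |g i| + 1 ≤ ∑ j, (|g j| + 1) :=
      Finset.single_le_sum (f := fun j => |g j| + 1) (fun j _ => by positivity) (Finset.mem_univ i)
    have := abs_nonneg γ
    linarith
  have hsmul : ∀ p, κ p • filtered (U p) (c p) (y p) =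
      filtered (U p) (fun i => κ p * c p i) (y p) := fun p => by
    rw [filtered, filtered, Finset.smul_sum]
    exact Finset.sum_congr rfl fun i _ => by rw [smul_smul, mul_assoc]
  refine limit_eq_zero_of_normalized (F := (𝒰 : Filter ℕ))
    (fun p => filtered (U p) (c p) (y p)) (f l) κ ((∑ j, (|g j| + 1) + (|γ| + 1)) * Cy) _ ?_ ?_ hw
  · filter_upwards [hb, hCy, hδ.abs.eventually_lt_const (lt_add_one |γ|)] with p hp hy hd
    rw [hsmul]
    have h0 : 0 ≤ ∑ j, (|g j| + 1) := Finset.sum_nonneg fun j _ => by positivity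
    have hK : 0 ≤ ∑ j, (|g j| + 1) + (|γ| + 1) := by positivity
    refine (norm_filtered_le _ _ _ _ hK fun i => ?_).trans (mul_le_mul_of_nonneg_left hy hK)
    by_cases hi : (i : ℕ) < N
    · exact hp ⟨i, hi⟩
    · rw [hcδ p i (not_lt.1 hi)]
      linarith
  · have h1 := (hδ.mul (hs.diff_lead l)).add (tendsto_finsetSum Finset.univ fun (i : Fin N) _ =>
      (((hg i).sub hδ).mul (tendsto_coord h𝒰 hs hE hq hG hs.diff i)).mul
      (tendsto_coord h𝒰 hs hE hq hG (fun a => hs.lead a l) i))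
    refine h1.congr' ?_
    filter_upwards [h𝒰 (eventually_ge_atTop N)] with p hp
    rw [hsmul, inner_filtered hp (U p) (fun i => κ p * c p i) (κ p * δ p)]
    intro i hi
    rw [hcδ p i hi]

/-- The core of the argument: no ridge direction is asymptotically orthogonal to both leading
eigenvectors. -/
theorem not_tendsto_ridge (hG : GramLimit cls n t ρ s q)
    (hgap : GramLimit.scatter cls s 1 * (1 - ρ ^ 2) ≠ t 0 - t 1)
    (he1 : e 1 ≠ ρ * e 0) (he0 : e 0 ≠ ρ * e 1)
    (hcross : GramLimit.crossDet t ρ (GramLimit.scatter cls s) e ≠ 0)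
    {α : ℝ} {D : Finset ℕ} (hDN : ∀ i ∈ D, i < N)
    (hD : ∀ i : Fin N, (i : ℕ) ∈ D ↔
      GramLimit.leadChar t ρ (GramLimit.scatter cls s) (GramLimit.nsq (q i)) = 0)
    (hdef : GramLimit.leadChar t ρ (GramLimit.scatter cls s) (-α) ≠ 0 ∨
      ∀ᶠ p in 𝒰, ∀ i : Fin p, (i : ℕ) ∈ D → μ p i + α ≠ 0)
    (c : ℕ → ℕ → ℝ)
    (hc : ∀ p (i : Fin p), c p i = if (i : ℕ) ∈ D then α / (μ p i + α) else if N ≤ i then 1 else 0)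
    (hw : ∀ l, Tendsto (fun p => inner ℝ (‖filtered (U p) (c p) (y p)‖⁻¹ •
      filtered (U p) (c p) (y p)) (f l p)) 𝒰 (𝓝 0)) : False := by
  classical
  -- the filter, with its values beyond the dimension normalised
  let c' : ℕ → ℕ → ℝ := fun p i => if i < p then c p i else if N ≤ i then 1 else 0
  have hfilt : ∀ p, filtered (U p) (c' p) (y p) = filtered (U p) (c p) (y p) := fun p => by
    simp only [filtered, c', Fin.is_lt, if_true]
  simp only [← hfilt] at hw
  have hcδ : ∀ p i, N ≤ i → c' p i = 1 := fun p i hi => by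
    simp only [c']
    split_ifs with h
    · have : i ∉ D := fun hd => absurd (hDN i hd) (by omega)
      have h2 := hc p ⟨i, h⟩
      simp only [if_neg this, if_pos hi] at h2
      exact h2
    · rfl
  have hsig : ∀ i : Fin N, (i : ℕ) ∈ D → GramLimit.nsq (q i) + α ≠ 0 →
      Tendsto (fun p => c' p i) 𝒰 (𝓝 (α / (GramLimit.nsq (q i) + α))) := by
    intro i hi hne
    have h1 := (tendsto_eigval_nsq h𝒰 hE hq i).add_const α
    refine (tendsto_const_nhds.div h1 hne).congr' ?_
    filter_upwards [h𝒰 (eventually_gt_atTop (i : ℕ))] with p hp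
    simp only [Pi.div_apply, hp, dif_pos, c', if_true]
    rw [hc p ⟨i, hp⟩, if_pos hi]
  have hnoi : ∀ i : Fin N, (i : ℕ) ∉ D → Tendsto (fun p => c' p i) 𝒰 (𝓝 0) := by
    intro i hi
    refine tendsto_const_nhds.congr' ?_
    filter_upwards [h𝒰 (eventually_gt_atTop (i : ℕ))] with p hp
    have h2 := hc p ⟨i, hp⟩
    simp only [if_neg hi, if_neg (not_le.2 i.2)] at h2
    simp only [c', hp, if_true, h2]
  -- In the regular case all ridge coefficients converge and no rescaling is needed.
  by_cases hreg : ∀ i : Fin N, (i : ℕ) ∈ D → GramLimit.nsq (q i) + α ≠ 0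
  · let g : Fin N → ℝ := fun i => if (i : ℕ) ∈ D then α / (GramLimit.nsq (q i) + α) else 0
    refine hG.regular_ridge hgap he1 he0 (α := α) (g := g) (fun i hi => ?_) fun l => ?_
    · have hi' := (hD i).2 hi
      exact ⟨hreg i hi', by simp only [g, if_pos hi']⟩
    · have := filter_limit_eq_zero h𝒰 hs hE hq hG c' (fun _ => 1) (fun _ => 1) 1 g
        (by simp) hcδ (fun i => ?_) l (hw l)
      · simpa using this
      · simp only [one_mul, g]
        split_ifs with hi
        · exact hsig i hi (hreg i hi)
        · exact hnoi i hi
  · push Not at hreg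
    obtain ⟨i₀, hi₀, hz⟩ := hreg
    have hdef' := hdef.resolve_left (by
      rw [not_not, ← (hD i₀).1 hi₀]
      congr 1
      linarith)
    have hα : α ≠ 0 := by
      have h1 : 0 < GramLimit.nsq (q i₀) := hG.norm_pos i₀
      intro h0
      linarith
    -- The scale is the reciprocal of the diverging coefficient: it sends the null-space part to
    -- zero and makes the coefficient of row i₀ equal to 1. The denominators must be nonzero here,
    -- since a division by zero would give the coefficient 0.
    have hκ : Tendsto (fun p => (c' p i₀)⁻¹) 𝒰 (𝓝 0) := by
      have h1 := ((tendsto_eigval_nsq h𝒰 hE hq i₀).add_const α).div_const α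
      rw [hz, zero_div] at h1
      refine h1.congr' ?_
      filter_upwards [h𝒰 (eventually_gt_atTop (i₀ : ℕ))] with p hp
      simp only [hp, dif_pos, c', if_true]
      rw [hc p ⟨i₀, hp⟩, if_pos hi₀, inv_div]
    refine hG.singular_ridge hgap hcross i₀ ((hD i₀).1 hi₀) fun l => ?_
    have := filter_limit_eq_zero h𝒰 hs hE hq hG c' (fun _ => 1) (fun p => (c' p i₀)⁻¹) 0
      (fun i => if i = i₀ then 1 else 0) (by simpa using hκ) hcδ (fun i => ?_) l (hw l)
    · simpa [Finset.sum_ite_eq] using this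
    · split_ifs with hi
      · subst hi
        refine tendsto_const_nhds.congr' ?_
        filter_upwards [hdef', h𝒰 (eventually_gt_atTop (i : ℕ))] with p hd hp
        have : c' p i ≠ 0 := by
          simp only [c', hp, if_true]
          rw [hc p ⟨i, hp⟩, if_pos hi₀]
          exact div_ne_zero hα (hd ⟨i, hp⟩ hi₀)
        rw [inv_mul_cancel₀ this]
      · by_cases hiD : (i : ℕ) ∈ D
        · have hne : GramLimit.nsq (q i) + α ≠ 0 := fun h0 => hi <|
            hG.signal_unique hgap hcross i i₀ (by linarith) ((hD i).1 hiD)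
          simpa using hκ.mul (hsig i hiD hne)
        · simpa using hκ.mul (hnoi i hiD)

end Limit

end SpikedModel

/-! ### Leading scores and noise in the training data -/

namespace SpikedModel

variable (M : SpikedModel)

/-- Indices of the training points. -/
abbrev Idx : Type := Σ k : Fin 2, Fin (M.size k)

theorem classSum_sigma (k : Fin 2) (g : M.Idx → ℝ) :
    classSum Sigma.fst k g = ∑ j, g ⟨k, j⟩ := by
  rw [classSum, Fintype.sum_sigma, Finset.sum_eq_single k]
  · simp
  · intro l _ hl; simp [hl]
  · simp

theorem card_fiber (k : Fin 2) : Fintype.card {a : M.Idx // a.1 = k} = M.size k := by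
  rw [Fintype.card_congr (Equiv.sigmaSubtype k)]; simp

/-- The part of an observation that is spanned by the non-leading eigenvectors. -/
noncomputable def noise (k : Fin 2) (p : ℕ) (z : ℕ → ℝ) : RR p :=
  ∑ i : Fin p, ((if (i : ℕ) = 0 then 0 else √(M.tail k i)) * z i) • M.axis k p i

theorem obs_eq (k : Fin 2) (p : ℕ) (z : ℕ → ℝ) : M.obs k p z =
    M.mean k p + (√(M.eigval k p 0) * z 0) • M.lead k p + M.noise k p z := by
  rw [obs, noise, lead, add_assoc]
  congr 1
  split_ifs with h
  · have : (√(M.eigval k p 0) * z 0) • M.axis k p ⟨0, h⟩ =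
        ∑ i : Fin p, ((if (i : ℕ) = 0 then √(M.eigval k p 0) else 0) * z i) • M.axis k p i := by
      rw [Finset.sum_eq_single ⟨0, h⟩]
      · simp
      · intro i _ hi
        have : (i : ℕ) ≠ 0 := fun h0 => hi (Fin.ext h0)
        simp [this]
      · simp
    rw [this, ← Finset.sum_add_distrib]
    refine Finset.sum_congr rfl fun i _ => ?_
    rw [← add_smul, ← add_mul]
    congr 2
    by_cases hi : (i : ℕ) = 0
    · simp [hi]
    · simp [hi, eigval]
  · have : p = 0 := by omega
    subst this
    simp

theorem norm_lead_le (k : Fin 2) (p : ℕ) : ‖M.lead k p‖ ≤ 1 := by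
  rw [lead]
  split_ifs
  · exact ((M.axis k p).norm_eq_one _).le
  · simp

section Sample

variable (z : (k : Fin 2) → Fin (M.size k) → ℕ → ℝ)

/-- Sample mean of the leading scores in class `k`. -/
noncomputable def leadMean (k : Fin 2) : ℝ := (M.size k : ℝ)⁻¹ * ∑ l, z k l 0

/-- Scaled and centred leading scores. -/
noncomputable def leadDev (a : M.Idx) : ℝ :=
  M.spike a.1 * z a.1 a.2 0 - (M.size a.1 : ℝ)⁻¹ * ∑ l, M.spike a.1 * z a.1 l 0

theorem leadDev_eq (a : M.Idx) :
    M.leadDev z a = M.spike a.1 * (z a.1 a.2 0 - M.leadMean z a.1) := by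
  rw [leadDev, leadMean, ← Finset.mul_sum]; ring

theorem scatter_leadDev (k : Fin 2) :
    GramLimit.scatter Sigma.fst (M.leadDev z) k = M.leadScatter z k := by
  rw [GramLimit.scatter, classSum_sigma, leadScatter]
  exact Finset.sum_congr rfl fun j _ => (sq _).symm

theorem leadDev_centred (hn : ∀ k, 2 ≤ M.size k) (k : Fin 2) :
    classSum Sigma.fst k (M.leadDev z) = 0 := by
  have : (M.size k : ℝ) ≠ 0 := by have := hn k; positivity
  rw [classSum_sigma]
  simp only [leadDev, Finset.sum_sub_distrib]
  change ∑ j, M.spike k * z k j 0 -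
    ∑ _j : Fin (M.size k), (M.size k : ℝ)⁻¹ * ∑ l, M.spike k * z k l 0 = 0
  rw [Finset.sum_const, Finset.card_univ, Fintype.card_fin, nsmul_eq_mul,
    mul_inv_cancel_left₀ this, sub_self]

/-- Limit of the inner products of the scaled sample mean difference with the leading
eigenvectors, where `m` is the corresponding limit for the population mean difference. -/
noncomputable def diffLimit (ρ : ℝ) (m : Fin 2 → ℝ) (l : Fin 2) : ℝ :=
  m l + M.spike 0 * M.leadMean z 0 * corr ρ 0 l - M.spike 1 * M.leadMean z 1 * corr ρ 1 l

/-- The scaled noise of a training point. -/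
noncomputable def scaledNoise (p : ℕ) (a : M.Idx) : RR p := (√(p : ℝ))⁻¹ • M.noise a.1 p (z a.1 a.2)

/-- The scaled mean noise of a class. -/
noncomputable def meanNoise (p : ℕ) (k : Fin 2) : RR p :=
  (M.size k : ℝ)⁻¹ • ∑ j, M.scaledNoise z p ⟨k, j⟩

/-- The scaled centred training points. -/
noncomputable def scaledPoint (p : ℕ) (a : M.Idx) : RR p :=
  (√(p : ℝ))⁻¹ • (M.obs a.1 p (z a.1 a.2) - M.sampleMean p z a.1)

/-- The scaled sample mean difference. -/
noncomputable def scaledDiff (p : ℕ) : RR p := (√(p : ℝ))⁻¹ • M.sampleDiff p z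

/-- The scaled standard deviation in the leading direction. -/
noncomputable def scaledSpike (k : Fin 2) (p : ℕ) : ℝ := (√(p : ℝ))⁻¹ * √(M.eigval k p 0)

theorem sampleMean_eq (hn : ∀ k, 2 ≤ M.size k) (p : ℕ) (k : Fin 2) :
    (√(p : ℝ))⁻¹ • M.sampleMean p z k = (√(p : ℝ))⁻¹ • M.mean k p +
      (M.scaledSpike k p * M.leadMean z k) • M.lead k p + M.meanNoise z p k := by
  have hk : (M.size k : ℝ) ≠ 0 := by have := hn k; positivity
  simp only [sampleMean, obs_eq, Finset.sum_add_distrib, Finset.sum_const, Finset.card_univ,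
    Fintype.card_fin, meanNoise, scaledNoise, ← Finset.smul_sum, ← Finset.sum_smul, smul_add,
    ← Finset.mul_sum, leadMean, scaledSpike]
  refine congrArg₂ (· + ·) (congrArg₂ (· + ·) ?_ ?_) (smul_comm _ _ _)
  · rw [← Nat.cast_smul_eq_nsmul ℝ, inv_smul_smul₀ hk]
  · simp only [smul_smul]
    congr 1
    ring

theorem scaledPoint_eq (hn : ∀ k, 2 ≤ M.size k) (p : ℕ) (a : M.Idx) :
    M.scaledPoint z p a = (M.scaledSpike a.1 p * (z a.1 a.2 0 - M.leadMean z a.1)) • M.lead a.1 p +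
      (M.scaledNoise z p a - M.meanNoise z p a.1) := by
  rw [scaledPoint, smul_sub, sampleMean_eq M z hn, obs_eq, smul_add, smul_add, smul_smul,
    ← scaledNoise, ← mul_assoc, ← scaledSpike, mul_sub, sub_smul]
  abel

/-- The scaled difference of the population means. -/
noncomputable def scaledMean (p : ℕ) : RR p := (√(p : ℝ))⁻¹ • M.meanDiff p

theorem scaledDiff_eq (hn : ∀ k, 2 ≤ M.size k) (p : ℕ) :
    M.scaledDiff z p = M.scaledMean p +
      (M.scaledSpike 0 p * M.leadMean z 0) • M.lead 0 p -
      (M.scaledSpike 1 p * M.leadMean z 1) • M.lead 1 p +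
      (M.meanNoise z p 0 - M.meanNoise z p 1) := by
  rw [scaledDiff, sampleDiff, smul_sub, sampleMean_eq M z hn, sampleMean_eq M z hn, scaledMean,
    meanDiff, smul_sub]
  abel

/-- Limits of the inner products between noise, leading eigenvectors and population mean
difference. -/
structure NoiseLimit (t : Fin 2 → ℝ) (ρ : ℝ) (m : Fin 2 → ℝ) (F : Filter ℕ) : Prop where
  noise : ∀ a b, Tendsto (fun p => inner ℝ (M.scaledNoise z p a) (M.scaledNoise z p b)) F
    (𝓝 (if a = b then t a.1 else 0))
  noise_mean : ∀ a, Tendsto (fun p => inner ℝ (M.scaledNoise z p a) (M.scaledMean p))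
    F (𝓝 0)
  noise_lead : ∀ a l, Tendsto (fun p => inner ℝ (M.scaledNoise z p a) (M.lead l p)) F (𝓝 0)
  lead : ∀ k l, Tendsto (fun p => inner ℝ (M.lead k p) (M.lead l p)) F (𝓝 (corr ρ k l))
  mean_lead : ∀ l, Tendsto (fun p : ℕ => inner ℝ (M.scaledMean p) (M.lead l p)) F (𝓝 (m l))
  mean_bdd : ∃ C, ∀ᶠ p : ℕ in F, ‖M.scaledMean p‖ ≤ C
  spike : ∀ k, Tendsto (M.scaledSpike k) F (𝓝 (M.spike k))

variable {M z} {t : Fin 2 → ℝ} {ρ : ℝ} {m : Fin 2 → ℝ} {F : Filter ℕ}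

namespace NoiseLimit

theorem tendsto_meanNoise (k : Fin 2) {v : (p : ℕ) → RR p} {c : M.Idx → ℝ}
    (h : ∀ a, Tendsto (fun p => inner ℝ (M.scaledNoise z p a) (v p)) F (𝓝 (c a))) :
    Tendsto (fun p => inner ℝ (M.meanNoise z p k) (v p)) F
      (𝓝 ((M.size k : ℝ)⁻¹ * ∑ j, c ⟨k, j⟩)) := by
  simp only [meanNoise, real_inner_smul_left, sum_inner]
  exact (tendsto_finsetSum _ fun j _ => h ⟨k, j⟩).const_mul _

variable (h : M.NoiseLimit z t ρ m F) (hn : ∀ k, 2 ≤ M.size k)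
include h

theorem meanNoise_noise (k : Fin 2) (b : M.Idx) :
    Tendsto (fun p => inner ℝ (M.meanNoise z p k) (M.scaledNoise z p b)) F
      (𝓝 (if k = b.1 then t k * (M.size k : ℝ)⁻¹ else 0)) := by
  have := tendsto_meanNoise k fun a => h.noise a b
  convert this using 2
  split_ifs with hk
  · obtain ⟨l, j⟩ := b
    subst hk
    rw [Finset.sum_eq_single j]
    · simp [mul_comm]
    · intro i _ hi; simp [hi]
    · simp
  · rw [Finset.sum_eq_zero, mul_zero]
    intro j _
    rw [if_neg]
    rintro rfl
    exact hk rfl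

theorem meanNoise_lead (k l : Fin 2) :
    Tendsto (fun p => inner ℝ (M.meanNoise z p k) (M.lead l p)) F (𝓝 0) := by
  simpa using tendsto_meanNoise k fun a => h.noise_lead a l

theorem meanNoise_mean (k : Fin 2) :
    Tendsto (fun p => inner ℝ (M.meanNoise z p k) (M.scaledMean p)) F (𝓝 0) := by
  simpa using tendsto_meanNoise k h.noise_mean

include hn

theorem meanNoise_meanNoise (k l : Fin 2) :
    Tendsto (fun p => inner ℝ (M.meanNoise z p k) (M.meanNoise z p l)) F
      (𝓝 (if k = l then t k * (M.size k : ℝ)⁻¹ else 0)) := by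
  have := tendsto_meanNoise (M := M) (z := z) (F := F) k (v := fun p => M.meanNoise z p l) fun a => by
    simp only [real_inner_comm (M.meanNoise _ _ _)]
    exact h.meanNoise_noise l a
  convert this using 2
  have hk : (M.size k : ℝ) ≠ 0 := by have := hn k; positivity
  by_cases hkl : k = l
  · subst hkl
    simp [hk]
  · simp [hkl, Ne.symm hkl]

/-- Points and mean difference are combinations of leading eigenvectors, population mean difference
and noise. Centred noise is asymptotically orthogonal to the class mean noise, so noise contributes
to the Gram matrix but not to the products of training points with d. -/
theorem sampleLimit : SampleLimit Sigma.fst M.size t ρ (M.leadDev z) (M.diffLimit z ρ m)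
    (M.scaledPoint z) (M.scaledDiff z) M.lead F := by
  -- centred noise against the building blocks
  have cn : ∀ (a b : M.Idx), Tendsto (fun p => inner ℝ (M.scaledNoise z p a - M.meanNoise z p a.1)
      (M.scaledNoise z p b - M.meanNoise z p b.1)) F (𝓝 (t a.1 * ((if a = b then 1 else 0) -
        if a.1 = b.1 then (M.size a.1 : ℝ)⁻¹ else 0))) := by
    intro a b
    simp only [inner_sub_left, inner_sub_right]
    have e : t a.1 * ((if a = b then 1 else 0) - if a.1 = b.1 then (M.size a.1 : ℝ)⁻¹ else 0) =
        (if a = b then t a.1 else 0) - (if a.1 = b.1 then t a.1 * (M.size a.1 : ℝ)⁻¹ else 0) -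
        ((if b.1 = a.1 then t b.1 * (M.size b.1 : ℝ)⁻¹ else 0) -
          if a.1 = b.1 then t a.1 * (M.size a.1 : ℝ)⁻¹ else 0) := by
      by_cases hab : a.1 = b.1
      · simp only [hab, if_true, sub_self, sub_zero]
        split_ifs <;> ring
      · have : a ≠ b := fun h => hab (by rw [h])
        simp [hab, this, Ne.symm hab]
    rw [e]
    refine ((h.noise a b).sub (h.meanNoise_noise a.1 b)).sub (Tendsto.sub ?_
      (h.meanNoise_meanNoise hn a.1 b.1))
    simp only [real_inner_comm (M.meanNoise z _ b.1)]
    exact h.meanNoise_noise b.1 a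
  have cm : ∀ (a : M.Idx) l, Tendsto (fun p => inner ℝ (M.scaledNoise z p a - M.meanNoise z p a.1)
      (M.meanNoise z p l)) F (𝓝 0) := by
    intro a l
    simp only [inner_sub_left]
    have e : (0 : ℝ) = (if l = a.1 then t l * (M.size l : ℝ)⁻¹ else 0) -
        if a.1 = l then t a.1 * (M.size a.1 : ℝ)⁻¹ else 0 := by
      by_cases hab : a.1 = l
      · simp [hab]
      · simp [hab, Ne.symm hab]
    rw [e]
    refine Tendsto.sub ?_ (h.meanNoise_meanNoise hn a.1 l)
    simp only [real_inner_comm (M.meanNoise z _ l)]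
    exact h.meanNoise_noise l a
  have cl : ∀ (a : M.Idx) l, Tendsto (fun p => inner ℝ (M.scaledNoise z p a - M.meanNoise z p a.1)
      (M.lead l p)) F (𝓝 0) := by
    intro a l
    simp only [inner_sub_left]
    simpa using (h.noise_lead a l).sub (h.meanNoise_lead a.1 l)
  have cd : ∀ (a : M.Idx), Tendsto (fun p => inner ℝ (M.scaledNoise z p a - M.meanNoise z p a.1)
      (M.scaledMean p)) F (𝓝 0) := by
    intro a
    simp only [inner_sub_left]
    simpa using (h.noise_mean a).sub (h.meanNoise_mean a.1)
  have hsp : ∀ (a : M.Idx), Tendsto (fun p => M.scaledSpike a.1 p * (z a.1 a.2 0 - M.leadMean z a.1))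
      F (𝓝 (M.leadDev z a)) := fun a => by
    rw [leadDev_eq]; exact (h.spike a.1).mul_const _
  have hsm : ∀ k, Tendsto (fun p => M.scaledSpike k p * M.leadMean z k)
      F (𝓝 (M.spike k * M.leadMean z k)) := fun k => (h.spike k).mul_const _
  refine ⟨fun a b => ?_, fun a l => ?_, fun a => ?_, fun l => ?_, ?_⟩
  · simp only [scaledPoint_eq M z hn, inner_add_left (_ • _), inner_add_right _ (_ • _),
      real_inner_smul_left, real_inner_smul_right]
    have h1 := ((hsp a).mul ((hsp b).mul (h.lead a.1 b.1))).add ((hsp a).mul (cl b a.1))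
    have h2 := ((hsp b).mul (cl a b.1)).add (cn a b)
    have h3 := h1.add h2
    rw [mul_zero, add_zero, mul_zero, zero_add, ← mul_assoc] at h3
    refine h3.congr fun p => ?_
    rw [real_inner_comm (M.lead a.1 p) (M.scaledNoise z p b - M.meanNoise z p b.1)]
    ring
  · simp only [scaledPoint_eq M z hn, inner_add_left (_ • _), real_inner_smul_left]
    simpa using ((hsp a).mul (h.lead a.1 l)).add (cl a l)
  · simp only [scaledPoint_eq M z hn, scaledDiff_eq M z hn, inner_add_left (_ • _),
      inner_add_right, inner_sub_right, real_inner_smul_left, real_inner_smul_right]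
    have h1 := (hsp a).mul (((h.mean_lead a.1).add ((hsm 0).mul (h.lead a.1 0))).sub
      ((hsm 1).mul (h.lead a.1 1)) |>.add ((h.meanNoise_lead 0 a.1).sub (h.meanNoise_lead 1 a.1)))
    have h2 := (((cd a).add ((hsm 0).mul (cl a 0))).sub ((hsm 1).mul (cl a 1))).add
      ((cm a 0).sub (cm a 1))
    have h3 := h1.add h2
    convert h3 using 2
    · simp only [real_inner_comm (M.lead a.1 _) (M.scaledMean _),
        real_inner_comm (M.lead a.1 _) (M.meanNoise _ _ _)]
      ring
    · simp only [diffLimit, GramLimit.corr_symm (ρ := ρ) _ a.1]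
      ring
  · simp only [scaledDiff_eq M z hn, inner_add_left, inner_sub_left]
    simp only [real_inner_smul_left _ (M.lead _ _)]
    have h1 := (((h.mean_lead l).add ((hsm 0).mul (h.lead 0 l))).sub
      ((hsm 1).mul (h.lead 1 l))).add ((h.meanNoise_lead 0 l).sub (h.meanNoise_lead 1 l))
    simpa [diffLimit] using h1
  · obtain ⟨C, hC⟩ := h.mean_bdd
    have hb : ∀ k, ∃ B, ∀ᶠ p in F, ‖M.meanNoise z p k‖ ≤ B := fun k => by
      obtain ⟨B, hB⟩ := (h.meanNoise_meanNoise hn k k).isBoundedUnder_le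
      refine ⟨√B, ?_⟩
      filter_upwards [eventually_map.1 hB] with p hp
      refine Real.le_sqrt_of_sq_le ?_
      rwa [← real_inner_self_eq_norm_sq]
    have hl : ∀ k, ∃ B, ∀ᶠ p in F, ‖(M.scaledSpike k p * M.leadMean z k) • M.lead k p‖ ≤ B :=
      fun k => by
        obtain ⟨B, hB⟩ := (hsm k).abs.isBoundedUnder_le
        refine ⟨B, ?_⟩
        filter_upwards [eventually_map.1 hB] with p hp
        rw [norm_smul]
        refine le_trans ?_ hp
        have := M.norm_lead_le k p
        simpa using mul_le_mul_of_nonneg_left this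
          (abs_nonneg (M.scaledSpike k p * M.leadMean z k))
    obtain ⟨B0, hB0⟩ := hb 0
    obtain ⟨B1, hB1⟩ := hb 1
    obtain ⟨C0, hC0⟩ := hl 0
    obtain ⟨C1, hC1⟩ := hl 1
    refine ⟨C + C0 + C1 + (B0 + B1), ?_⟩
    filter_upwards [hC, hB0, hB1, hC0, hC1] with p h1 h2 h3 h4 h5
    rw [scaledDiff_eq M z hn]
    refine (norm_add_le _ _).trans (add_le_add ((norm_sub_le _ _).trans
      (add_le_add ((norm_add_le _ _).trans (add_le_add h1 h4)) h5))
      ((norm_sub_le _ _).trans (add_le_add h2 h3)))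

end NoiseLimit

end Sample

end SpikedModel

/-! ### The matrix Φ, the sample eigenvectors and the ridge direction -/

namespace SpikedModel

variable (M : SpikedModel) (z : (k : Fin 2) → Fin (M.size k) → ℕ → ℝ)

theorem leadScatter_nonneg (k : Fin 2) : 0 ≤ M.leadScatter z k :=
  Finset.sum_nonneg fun _ _ => sq_nonneg _

theorem leadEig_order (t : Fin 2 → ℝ) (R : Fin 2 → RR 2) : M.leadEig z t R 2 ≤ M.leadEig z t R 1 := by
  rw [leadEig, leadEig, dif_pos (by simp), dif_pos (by simp)]
  exact (M.leadMatrix_isHermitian z t R).eigenvalues₀_antitone (by simp)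

theorem sum_prod_leadEig (t : Fin 2 → ℝ) (R : Fin 2 → RR 2) :
    M.leadEig z t R 1 + M.leadEig z t R 2 = (M.leadMatrix z t R).trace ∧
    M.leadEig z t R 1 * M.leadEig z t R 2 = (M.leadMatrix z t R).det := by
  have hH := M.leadMatrix_isHermitian z t R
  have e : ∀ (g : Fin (Fintype.card (Fin 2)) → ℝ), (∑ i, g i = g ⟨0, by simp⟩ + g ⟨1, by simp⟩) ∧
      ∏ i, g i = g ⟨0, by simp⟩ * g ⟨1, by simp⟩ := by
    -- The index type is `Fin (Fintype.card (Fin 2))`; generalising the cardinality to a variable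
    -- lets it be replaced by 2.
    have key : ∀ (c : ℕ) (hc : c = 2) (g : Fin c → ℝ), (∑ i, g i = g ⟨0, by omega⟩ +
        g ⟨1, by omega⟩) ∧ ∏ i, g i = g ⟨0, by omega⟩ * g ⟨1, by omega⟩ := by
      rintro c rfl g
      exact ⟨Fin.sum_univ_two g, Fin.prod_univ_two g⟩
    exact key _ (Fintype.card_fin 2)
  rw [leadEig, leadEig, dif_pos (by simp), dif_pos (by simp)]
  constructor
  · rw [hH.trace_eq_sum_eigenvalues]
    simp only [Matrix.IsHermitian.eigenvalues, RCLike.ofReal_real_eq_id, id]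
    rw [Equiv.sum_comp (Fintype.equivOfCardEq (Fintype.card_fin _)).symm hH.eigenvalues₀]
    exact (e _).1.symm
  · rw [hH.det_eq_prod_eigenvalues]
    simp only [Matrix.IsHermitian.eigenvalues, RCLike.ofReal_real_eq_id, id]
    rw [Equiv.prod_comp (Fintype.equivOfCardEq (Fintype.card_fin _)).symm hH.eigenvalues₀]
    exact (e _).2.symm

theorem leadChar_eq (t : Fin 2 → ℝ) (R : Fin 2 → RR 2) (x : ℝ) :
    GramLimit.leadChar t (inner ℝ (R 0) (R 1)) (M.leadScatter z) x =
      (M.leadEig z t R 1 - x) * (M.leadEig z t R 2 - x) := by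
  obtain ⟨h1, h2⟩ := M.sum_prod_leadEig z t R
  have s0 := Real.mul_self_sqrt (M.leadScatter_nonneg z 0)
  have s1 := Real.mul_self_sqrt (M.leadScatter_nonneg z 1)
  rw [leadMatrix, Matrix.trace_fin_two_of] at h1
  rw [leadMatrix, Matrix.det_fin_two_of, real_inner_comm (R 0) (R 1)] at h2
  have h3 : M.leadEig z t R 1 * M.leadEig z t R 2 =
      (M.leadScatter z 0 + t 0) * (M.leadScatter z 1 + t 1) -
        (inner ℝ (R 0) (R 1)) ^ 2 * M.leadScatter z 0 * M.leadScatter z 1 := by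
    rw [h2]
    linear_combination (-(inner ℝ (R 0) (R 1) : ℝ) ^ 2 * (√(M.leadScatter z 1) * √(M.leadScatter z 1)))
      * s0 - (inner ℝ (R 0) (R 1) : ℝ) ^ 2 * M.leadScatter z 0 * s1
  simp only [GramLimit.leadChar]
  linear_combination (-1 : ℝ) * h3 + x * h1

/-- Dividing the points by √p divides the scatter eigenvalues by p, which matches the scaling α_p =
α p. -/
theorem eigenSystem (hn : ∀ k, 2 ≤ M.size k) {p : ℕ} {lam : Fin p → ℝ}
    {U : OrthonormalBasis (Fin p) ℝ (RR p)} (h : M.IsEigenDecomp p z lam U) :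
    EigenSystem Sigma.fst (M.scaledPoint z p) (fun i => lam i / p) U where
  cent k := by
    have hk : (M.size k : ℝ) ≠ 0 := by have := hn k; positivity
    rw [Fintype.sum_sigma, Finset.sum_eq_single k]
    · simp only [if_true, scaledPoint, ← Finset.smul_sum]
      rw [Finset.sum_sub_distrib, Finset.sum_const, Finset.card_univ, Fintype.card_fin,
        ← Nat.cast_smul_eq_nsmul ℝ, sampleMean, smul_inv_smul₀ hk, sub_self, smul_zero]
    · intro l _ hl; simp [hl]
    · simp
  anti i j hij := div_le_div_of_nonneg_right (h.1 hij) (Nat.cast_nonneg p)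
  eig i := by
    have h1 := congrArg (fun v => (p : ℝ)⁻¹ • v) (h.2 i)
    simp only [withinScatter] at h1
    rw [Fintype.sum_sigma, div_eq_inv_mul, mul_smul, ← h1, Finset.smul_sum]
    refine Finset.sum_congr rfl fun k _ => ?_
    rw [Finset.smul_sum]
    refine Finset.sum_congr rfl fun j _ => ?_
    have hp : (√(p : ℝ))⁻¹ * (√(p : ℝ))⁻¹ = (p : ℝ)⁻¹ := by
      rw [← mul_inv, Real.mul_self_sqrt (Nat.cast_nonneg p)]
    simp only [scaledPoint, real_inner_smul_left, smul_smul]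
    rw [← hp]
    congr 1
    ring

theorem add_one_le_of_mem_signalIndices (hn : ∀ k, 2 ≤ M.size k) {k₀ : ℕ} (hk : k₀ ∈ Finset.Icc 1 2)
    {i : ℕ} (hi : i ∈ M.signalIndices k₀) : i + 2 ≤ M.total := by
  have h0 := hn 0
  have h1 := hn 1
  simp only [signalIndices, Finset.mem_union, Finset.mem_Icc, total] at hi hk ⊢
  omega

/-- The multiplier of the `i`-th sample eigenvector in the ridge direction. -/
noncomputable def ridgeCoef (k₀ : ℕ) (α : ℝ) (lam : (p : ℕ) → Fin p → ℝ) (p i : ℕ) : ℝ :=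
  if h : i < p then if i + 1 ∈ M.signalIndices k₀ then α / (lam p ⟨i, h⟩ / p + α)
    else if M.total - 2 ≤ i then 1 else 0 else 0

theorem ridgeVector_eq (hn : ∀ k, 2 ≤ M.size k) {k₀ : ℕ} (hk : k₀ ∈ Finset.Icc 1 2) (α : ℝ)
    (lam : (p : ℕ) → Fin p → ℝ) {p : ℕ} (U : OrthonormalBasis (Fin p) ℝ (RR p)) :
    M.ridgeVector p z k₀ α (lam p) U = filtered U (M.ridgeCoef k₀ α lam p) (M.sampleDiff p z) := by
  rw [ridgeVector, filtered, ← Finset.sum_add_distrib]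
  refine Finset.sum_congr rfl fun i _ => ?_
  have hp : (p : ℝ) ≠ 0 := by have := i.pos; positivity
  simp only [ridgeCoef, i.2, dif_pos]
  have ht : 4 ≤ M.total := by have := hn 0; have := hn 1; simp only [total]; omega
  split_ifs with h1 h2 h3 h4
  · have := M.add_one_le_of_mem_signalIndices hn hk h1
    omega
  · rw [add_zero]
    congr 2
    have : lam p i + α * p = (lam p i / p + α) * p := by field_simp
    rw [this, mul_div_mul_right _ _ hp]
  · rw [zero_add, one_mul]
  · omega
  · omega
  · simp

theorem ridgeDirection_eq (hn : ∀ k, 2 ≤ M.size k) {k₀ : ℕ} (hk : k₀ ∈ Finset.Icc 1 2) (α : ℝ)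
    (lam : (p : ℕ) → Fin p → ℝ) {p : ℕ} (hp : 0 < p) (U : OrthonormalBasis (Fin p) ℝ (RR p)) :
    M.ridgeDirection p z k₀ α (lam p) U =
      ‖filtered U (M.ridgeCoef k₀ α lam p) (M.scaledDiff z p)‖⁻¹ •
        filtered U (M.ridgeCoef k₀ α lam p) (M.scaledDiff z p) := by
  have h1 : filtered U (M.ridgeCoef k₀ α lam p) (M.scaledDiff z p) =
      (√(p : ℝ))⁻¹ • M.ridgeVector p z k₀ α (lam p) U := by
    rw [ridgeVector_eq M z hn hk, filtered, filtered, Finset.smul_sum]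
    refine Finset.sum_congr rfl fun i _ => ?_
    rw [scaledDiff, real_inner_smul_right, smul_smul]
    congr 1; ring
  have hp' : 0 < √(p : ℝ) := by positivity
  rw [h1, ridgeDirection, norm_smul, smul_smul, norm_inv, Real.norm_of_nonneg hp'.le]
  congr 1
  field_simp

theorem norm_ridgeDirection_le {p : ℕ} (k₀ : ℕ) (α : ℝ) (lam : Fin p → ℝ)
    (U : OrthonormalBasis (Fin p) ℝ (RR p)) : ‖M.ridgeDirection p z k₀ α lam U‖ ≤ 1 := by
  rw [ridgeDirection, norm_smul, norm_inv, norm_norm]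
  exact inv_mul_le_one

/-- Conditions on the training data, which hold almost surely, under which no ridge direction is
asymptotically orthogonal to both leading eigenvectors. -/
structure Generic (t : Fin 2 → ℝ) (ρ : ℝ) (m : Fin 2 → ℝ) : Prop where
  scatter_pos : ∀ k, 0 < M.leadScatter z k
  gap : M.leadScatter z 1 * (1 - ρ ^ 2) ≠ t 0 - t 1
  diff_one : M.diffLimit z ρ m 1 ≠ ρ * M.diffLimit z ρ m 0
  diff_zero : M.diffLimit z ρ m 0 ≠ ρ * M.diffLimit z ρ m 1
  cross : GramLimit.crossDet t ρ (M.leadScatter z) (M.diffLimit z ρ m) ≠ 0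

theorem not_tendsto_ridgeDirection (hn : ∀ k, 2 ≤ M.size k) {t : Fin 2 → ℝ} (R : Fin 2 → RR 2)
    (htpos : ∀ k, 0 < t k) (ht : t 1 < t 0) (hρ : (inner ℝ (R 0) (R 1) : ℝ) ^ 2 < 1)
    {m : Fin 2 → ℝ} {F : Filter ℕ} [F.NeBot] (hF : F ≤ atTop)
    (hL : M.NoiseLimit z t (inner ℝ (R 0) (R 1)) m F) (hG : M.Generic z t (inner ℝ (R 0) (R 1)) m)
    {lam : (p : ℕ) → Fin p → ℝ} {U : (p : ℕ) → OrthonormalBasis (Fin p) ℝ (RR p)}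
    (hE : ∀ p, M.IsEigenDecomp p z (lam p) (U p)) {k₀ : ℕ} (hk : M.IsLeadCount z t R k₀) {α : ℝ}
    (hdef : GramLimit.leadChar t (inner ℝ (R 0) (R 1)) (M.leadScatter z) (-α) ≠ 0 ∨
      ∀ᶠ p in F, M.RidgeDefined p k₀ α (lam p))
    (hw : ∀ l, Tendsto (fun p => inner ℝ (M.ridgeDirection p z k₀ α (lam p) (U p)) (M.lead l p)) F
      (𝓝 0)) : False := by
  -- Along an ultrafilter all bounded coordinates converge at once, without further subsequences.
  have hUF : (Ultrafilter.of F : Filter ℕ) ≤ F := Ultrafilter.of_le F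
  have hS := (hL.sampleLimit hn)
  have hS' : SampleLimit Sigma.fst M.size t (inner ℝ (R 0) (R 1)) (M.leadDev z)
      (M.diffLimit z (inner ℝ (R 0) (R 1)) m) (M.scaledPoint z) (M.scaledDiff z) M.lead
      (Ultrafilter.of F : Filter ℕ) :=
    ⟨fun a b => (hS.gram a b).mono_left hUF, fun a l => (hS.lead a l).mono_left hUF,
      fun a => (hS.diff a).mono_left hUF, fun l => (hS.diff_lead l).mono_left hUF,
      hS.bdd.imp fun C hC => hUF hC⟩
  have hES := fun p => M.eigenSystem z hn (hE p)
  have hsc : GramLimit.scatter Sigma.fst (M.leadDev z) = M.leadScatter z :=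
    funext fun k => M.scatter_leadDev z k
  have ht4 : 4 ≤ M.total := by have := hn 0; have := hn 1; simp only [total]; omega
  obtain ⟨q, hq⟩ := hS'.exists_rows (N := M.total - 2) (U := U)
  have hGL := gramLimit (hUF.trans hF) hS' (Eventually.of_forall hES) hq M.card_fiber hn
    (by rw [← total]; omega) htpos ht hρ (M.leadDev_centred z hn)
    (fun k => by
      have h1 := hG.scatter_pos k
      rw [← hsc] at h1
      exact h1)
  have hgap := hG.gap
  have hcross := hG.cross
  rw [← hsc] at hgap hcross hdef
  have hroots := M.leadChar_eq z t R
  rw [← hsc] at hroots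
  obtain ⟨hk1, hk2, hk3⟩ := hk
  have hD := hGL.mem_signal_iff hgap hcross hroots (M.leadEig_order z t R)
    (antitone_nsq (hUF.trans hF) (Eventually.of_forall hES) hq) hk1
    (by rintro rfl; exact hk3) (by rintro rfl; exact hk2)
  -- Signal indices are counted from 1, the set `D` from 0.
  refine not_tendsto_ridge (hUF.trans hF) hS' (Eventually.of_forall hES) hq hGL hgap hG.diff_one
    hG.diff_zero hcross (α := α)
    (D := (Finset.range (M.total - 2)).filter fun i => i + 1 ∈ M.signalIndices k₀)
    (fun i hi => Finset.mem_range.1 (Finset.mem_filter.1 hi).1) (fun i => ?_) ?_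
    (M.ridgeCoef k₀ α lam) (fun p i => ?_) fun l => ?_
  · rw [← hD i, Finset.mem_filter, Finset.mem_range]
    exact and_iff_right i.2
  · refine hdef.imp id fun h => ?_
    filter_upwards [hUF h] with p hp i hi hz
    have hp0 : (p : ℝ) ≠ 0 := by have := i.pos; positivity
    refine hp i (Finset.mem_filter.1 hi).2 ?_
    have : lam p i + α * p = (lam p i / p + α) * p := by field_simp
    rw [this, hz, zero_mul]
  · simp only [ridgeCoef, i.2, dif_pos]
    have : (i : ℕ) ∈ ((Finset.range (M.total - 2)).filter fun i => i + 1 ∈ M.signalIndices k₀) ↔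
        (i : ℕ) + 1 ∈ M.signalIndices k₀ := by
      rw [Finset.mem_filter, Finset.mem_range]
      refine and_iff_right_of_imp fun h => ?_
      have := M.add_one_le_of_mem_signalIndices hn hk1 h
      omega
    simp only [this]
  · refine ((hw l).mono_left hUF).congr' ?_
    filter_upwards [(hUF.trans hF) (eventually_gt_atTop 0)] with p hp
    rw [M.ridgeDirection_eq z hn hk1 α lam hp]

end SpikedModel

namespace SpikedModel

/-! ### Genericity of the leading scores -/

theorem pi_fin_absolutelyContinuous : ∀ (n : ℕ) (μ ν : Fin n → Measure ℝ) [∀ i, SigmaFinite (μ i)]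
    [∀ i, SigmaFinite (ν i)], (∀ i, μ i ≪ ν i) → Measure.pi μ ≪ Measure.pi ν
  | 0, μ, ν, _, _, _ => by
    rw [Measure.pi_of_empty μ, Measure.pi_of_empty ν]
  | n + 1, μ, ν, _, _, h => by
    have hμ := (measurePreserving_piFinSuccAbove μ 0).symm
    have hν := (measurePreserving_piFinSuccAbove ν 0).symm
    rw [← hμ.map_eq, ← hν.map_eq]
    exact ((h 0).prod (pi_fin_absolutelyContinuous n _ _ fun i => h _)).map hμ.measurable

theorem pi_absolutelyContinuous {ι : Type*} [Fintype ι] (μ ν : ι → Measure ℝ)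
    [∀ i, SigmaFinite (μ i)] [∀ i, SigmaFinite (ν i)] (h : ∀ i, μ i ≪ ν i) :
    Measure.pi μ ≪ Measure.pi ν := by
  have hμ := measurePreserving_piCongrLeft μ (Fintype.equivFin ι).symm
  have hν := measurePreserving_piCongrLeft ν (Fintype.equivFin ι).symm
  rw [← hμ.map_eq, ← hν.map_eq]
  exact (pi_fin_absolutelyContinuous _ _ _ fun i => h _).map hμ.measurable

theorem ae_quadratic_ne_zero (a b c : ℝ) (h : a ≠ 0 ∨ b ≠ 0) :
    ∀ᵐ r : ℝ, a * r ^ 2 + b * r + c ≠ 0 := by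
  have hp : (Polynomial.C a * Polynomial.X ^ 2 + Polynomial.C b * Polynomial.X +
      Polynomial.C c : Polynomial ℝ) ≠ 0 := by
    intro h0
    have h1 := congrArg (fun p => Polynomial.coeff p 1) h0
    have h2 := congrArg (fun p => Polynomial.coeff p 2) h0
    simp [Polynomial.coeff_C] at h1 h2
    rcases h with h | h
    · exact h h2
    · exact h h1
  have hf : Set.Finite {r : ℝ | ¬ a * r ^ 2 + b * r + c ≠ 0} := by
    refine (Polynomial.finite_setOfPred_isRoot hp).subset fun r hr => ?_
    simpa [Polynomial.IsRoot] using hr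
  exact hf.measure_zero volume

/-- On each line parallel to `w`, a nonconstant polynomial of degree at most two has finitely many
zeros, and Fubini does the rest. `H` allows lines on which the relevant coefficient degenerates to
be left aside. -/
theorem ae_ne_zero_of_quadratic {ι : Type*} [Fintype ι] (w : ι → ℝ) (H G : (ι → ℝ) → ℝ)
    (hH : Continuous H) (hG : Continuous G)
    (h : ∀ y, (∀ r : ℝ, H (y + r • w) = 0) ∨
      ∃ a b c : ℝ, (a ≠ 0 ∨ b ≠ 0) ∧ ∀ r : ℝ, G (y + r • w) = a * r ^ 2 + b * r + c) :
    ∀ᵐ x : ι → ℝ, H x ≠ 0 → G x ≠ 0 := by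
  have hm : MeasurableSet {x : ι → ℝ | H x ≠ 0 → G x ≠ 0} := by
    have : {x : ι → ℝ | H x ≠ 0 → G x ≠ 0} = {x | H x = 0} ∪ {x | G x = 0}ᶜ := by
      ext x; simp [imp_iff_not_or]
    rw [this]
    exact (isClosed_eq hH continuous_const).measurableSet.union
      (isClosed_eq hG continuous_const).measurableSet.compl
  refine ae_mem_of_ae_add_linearMap_mem (LinearMap.toSpanSingleton ℝ (ι → ℝ) w) (volume : Measure ℝ)
    (volume : Measure (ι → ℝ)) hm fun y => ?_
  rcases h y with h0 | ⟨a, b, c, hab, hq⟩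
  · exact Eventually.of_forall fun r hr => absurd (h0 r) hr
  · filter_upwards [ae_quadratic_ne_zero a b c hab] with r hr _
    rw [LinearMap.toSpanSingleton_apply, hq]
    exact hr

variable (M : SpikedModel)

/-- Score sequences with prescribed leading scores. -/
def ofLead (x : M.Idx → ℝ) (k : Fin 2) (j : Fin (M.size k)) (_ : ℕ) : ℝ := x ⟨k, j⟩

theorem leadDev_add (y w : M.Idx → ℝ) (r : ℝ) (a : M.Idx) :
    M.leadDev (M.ofLead (y + r • w)) a = M.leadDev (M.ofLead y) a + r * M.leadDev (M.ofLead w) a := by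
  simp only [leadDev, ofLead, Pi.add_apply, Pi.smul_apply, smul_eq_mul, mul_add,
    Finset.sum_add_distrib, mul_left_comm _ r, ← Finset.mul_sum]
  ring

theorem leadScatter_add (y w : M.Idx → ℝ) (r : ℝ) (k : Fin 2) :
    M.leadScatter (M.ofLead (y + r • w)) k = M.leadScatter (M.ofLead w) k * r ^ 2 +
      (2 * ∑ j, M.leadDev (M.ofLead y) ⟨k, j⟩ * M.leadDev (M.ofLead w) ⟨k, j⟩) * r +
      M.leadScatter (M.ofLead y) k := by
  change ∑ j, M.leadDev (M.ofLead (y + r • w)) ⟨k, j⟩ ^ 2 =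
    (∑ j, M.leadDev (M.ofLead w) ⟨k, j⟩ ^ 2) * r ^ 2 + _ * r +
      ∑ j, M.leadDev (M.ofLead y) ⟨k, j⟩ ^ 2
  simp only [leadDev_add, Finset.mul_sum, Finset.sum_mul, ← Finset.sum_add_distrib]
  exact Finset.sum_congr rfl fun j _ => by ring

theorem leadMean_add (y w : M.Idx → ℝ) (r : ℝ) (k : Fin 2) :
    M.leadMean (M.ofLead (y + r • w)) k = M.leadMean (M.ofLead y) k +
      r * M.leadMean (M.ofLead w) k := by
  simp only [leadMean, ofLead, Pi.add_apply, Pi.smul_apply, smul_eq_mul,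
    Finset.sum_add_distrib, ← Finset.mul_sum]
  ring

/-- All points of class `k` are moved by the same amount. -/
def classShift (k : Fin 2) (a : M.Idx) : ℝ := if a.1 = k then 1 else 0

section Directions

variable (hn : ∀ k, 2 ≤ M.size k)
include hn

theorem leadMean_classShift (k l : Fin 2) :
    M.leadMean (M.ofLead (M.classShift k)) l = if l = k then 1 else 0 := by
  have : (M.size l : ℝ) ≠ 0 := by have := hn l; positivity
  simp only [leadMean, ofLead, classShift]
  split_ifs <;> simp [this]

theorem leadDev_classShift (k : Fin 2) (a : M.Idx) :
    M.leadDev (M.ofLead (M.classShift k)) a = 0 := by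
  rw [leadDev_eq, leadMean_classShift M hn]
  simp [ofLead, classShift]

theorem leadScatter_classShift (k l : Fin 2) :
    M.leadScatter (M.ofLead (M.classShift k)) l = 0 := by
  change ∑ j, M.leadDev (M.ofLead (M.classShift k)) ⟨l, j⟩ ^ 2 = 0
  simp [M.leadDev_classShift hn]

theorem leadScatter_shift (k l : Fin 2) (y : M.Idx → ℝ) (r : ℝ) :
    M.leadScatter (M.ofLead (y + r • M.classShift k)) l = M.leadScatter (M.ofLead y) l := by
  rw [leadScatter_add, leadScatter_classShift M hn]
  simp [M.leadDev_classShift hn]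

/-- Moving a single training point changes the scatter of its own class only, and does so
quadratically with a positive leading coefficient. -/
theorem exists_single (hs : ∀ k, 0 < M.spike k) (k : Fin 2) : ∃ w : M.Idx → ℝ,
    0 < M.leadScatter (M.ofLead w) k ∧ ∀ l, l ≠ k → ∀ y (r : ℝ),
      M.leadScatter (M.ofLead (y + r • w)) l = M.leadScatter (M.ofLead y) l := by
  classical
  have h2 := hn k
  refine ⟨Pi.single ⟨k, ⟨0, by omega⟩⟩ 1, ?_, fun l hl y r => ?_⟩
  · refine lt_of_lt_of_le ?_ (Finset.single_le_sum (f := fun j => (M.spike k *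
      M.ofLead (Pi.single ⟨k, ⟨0, by omega⟩⟩ 1) k j 0 - (M.size k : ℝ)⁻¹ * ∑ l, M.spike k *
      M.ofLead (Pi.single ⟨k, ⟨0, by omega⟩⟩ 1) k l 0) ^ 2) (fun j _ => sq_nonneg _)
      (Finset.mem_univ ⟨0, by omega⟩))
    refine sq_pos_of_pos ?_
    have : ∑ l, M.spike k * M.ofLead (Pi.single ⟨k, ⟨0, by omega⟩⟩ 1) k l 0 = M.spike k := by
      rw [Finset.sum_eq_single ⟨0, by omega⟩]
      · simp [ofLead]
      · intro j _ hj
        rw [ofLead, Pi.single_eq_of_ne, mul_zero]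
        intro h
        exact hj (by simpa using h)
      · simp
    rw [this]
    simp only [ofLead, Pi.single_eq_same, mul_one]
    have h3 : (M.size k : ℝ)⁻¹ < 1 := by
      rw [inv_lt_one₀ (by positivity)]
      exact_mod_cast (by omega : 1 < M.size k)
    nlinarith [hs k]
  · have hz : ∀ j i, M.ofLead (y + r • Pi.single ⟨k, ⟨0, by omega⟩⟩ 1) l j i = M.ofLead y l j i := by
      intro j i
      simp only [ofLead, Pi.add_apply, Pi.smul_apply]
      rw [Pi.single_eq_of_ne, smul_zero, add_zero]
      intro h
      exact hl (congrArg Sigma.fst h)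
    simp only [leadScatter, hz]

end Directions

theorem continuous_leadScatter (k : Fin 2) : Continuous fun x => M.leadScatter (M.ofLead x) k := by
  simp only [leadScatter, ofLead]
  fun_prop

theorem continuous_diffLimit (ρ : ℝ) (m : Fin 2 → ℝ) (k : Fin 2) :
    Continuous fun x => M.diffLimit (M.ofLead x) ρ m k := by
  simp only [diffLimit, leadMean, ofLead]
  fun_prop

theorem diffLimit_shift (hn : ∀ k, 2 ≤ M.size k) (ρ : ℝ) (m : Fin 2 → ℝ) (y : M.Idx → ℝ)
    (r : ℝ) (k : Fin 2) :
    M.diffLimit (M.ofLead (y + r • M.classShift 0)) ρ m k =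
      M.diffLimit (M.ofLead y) ρ m k + M.spike 0 * corr ρ 0 k * r ∧
    M.diffLimit (M.ofLead (y + r • M.classShift 1)) ρ m k =
      M.diffLimit (M.ofLead y) ρ m k - M.spike 1 * corr ρ 1 k * r := by
  simp only [diffLimit, leadMean_add, M.leadMean_classShift hn]
  constructor <;> simp <;> ring

theorem ae_scatter_affine (hn : ∀ k, 2 ≤ M.size k) (hs : ∀ k, 0 < M.spike k) (k : Fin 2) (u v : ℝ)
    (hu : u ≠ 0) : ∀ᵐ x : M.Idx → ℝ, u * M.leadScatter (M.ofLead x) k + v ≠ 0 := by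
  obtain ⟨w, hw, -⟩ := M.exists_single hn hs k
  have hc := M.continuous_leadScatter k
  filter_upwards [ae_ne_zero_of_quadratic w (fun _ => 1)
    (fun x => u * M.leadScatter (M.ofLead x) k + v) continuous_const (by fun_prop) fun y => Or.inr
      ⟨u * M.leadScatter (M.ofLead w) k,
        u * (2 * ∑ j, M.leadDev (M.ofLead y) ⟨k, j⟩ * M.leadDev (M.ofLead w) ⟨k, j⟩),
        u * M.leadScatter (M.ofLead y) k + v, Or.inl (mul_ne_zero hu hw.ne'), fun r => by
          rw [leadScatter_add]; ring⟩] with x hx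
  exact hx one_ne_zero

theorem ae_scatter_bilinear (hn : ∀ k, 2 ≤ M.size k) (hs : ∀ k, 0 < M.spike k) (u v v' c : ℝ) :
    ∀ᵐ x : M.Idx → ℝ, u * M.leadScatter (M.ofLead x) 0 + v ≠ 0 →
      (u * M.leadScatter (M.ofLead x) 0 + v) * M.leadScatter (M.ofLead x) 1 +
        v' * M.leadScatter (M.ofLead x) 0 + c ≠ 0 := by
  obtain ⟨w, hw, hw'⟩ := M.exists_single hn hs 1
  have hc := M.continuous_leadScatter
  refine ae_ne_zero_of_quadratic w (fun x => u * M.leadScatter (M.ofLead x) 0 + v) _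
    (by have := hc 0; fun_prop) (by have := hc 0; have := hc 1; fun_prop) fun y => ?_
  simp only [hw' 0 (by simp)]
  by_cases h0 : u * M.leadScatter (M.ofLead y) 0 + v = 0
  · exact Or.inl fun _ => h0
  · refine Or.inr ⟨(u * M.leadScatter (M.ofLead y) 0 + v) * M.leadScatter (M.ofLead w) 1,
      (u * M.leadScatter (M.ofLead y) 0 + v) *
        (2 * ∑ j, M.leadDev (M.ofLead y) ⟨1, j⟩ * M.leadDev (M.ofLead w) ⟨1, j⟩),
      (u * M.leadScatter (M.ofLead y) 0 + v) * M.leadScatter (M.ofLead y) 1 +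
        v' * M.leadScatter (M.ofLead y) 0 + c, Or.inl (mul_ne_zero h0 hw.ne'), fun r => ?_⟩
    rw [leadScatter_add]; ring

theorem ae_generic_ofLead (hn : ∀ k, 2 ≤ M.size k) (hs : ∀ k, 0 < M.spike k) {t : Fin 2 → ℝ} {ρ : ℝ}
    (hρ : ρ ^ 2 < 1) (m : Fin 2 → ℝ) : ∀ᵐ x : M.Idx → ℝ, M.Generic (M.ofLead x) t ρ m := by
  have hρ' : 1 - ρ ^ 2 ≠ 0 := by linarith
  have hc := M.continuous_leadScatter
  have hc0 := hc 0
  have hc1 := hc 1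
  have he0 := M.continuous_diffLimit ρ m 0
  have he1 := M.continuous_diffLimit ρ m 1
  have h3 : ∀ᵐ x : M.Idx → ℝ, (1 : ℝ) ≠ 0 →
      M.diffLimit (M.ofLead x) ρ m 1 - ρ * M.diffLimit (M.ofLead x) ρ m 0 ≠ 0 := by
    refine ae_ne_zero_of_quadratic (M.classShift 1) (fun _ => 1) _ continuous_const (by fun_prop)
      fun y => Or.inr ⟨0, -M.spike 1 * (1 - ρ ^ 2), M.diffLimit (M.ofLead y) ρ m 1 -
        ρ * M.diffLimit (M.ofLead y) ρ m 0,
        Or.inr (mul_ne_zero (neg_ne_zero.2 (hs 1).ne') hρ'), fun r => ?_⟩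
    rw [(M.diffLimit_shift hn ρ m y r 1).2, (M.diffLimit_shift hn ρ m y r 0).2]
    simp only [corr_11, corr_10]; ring
  have h4 : ∀ᵐ x : M.Idx → ℝ, (1 : ℝ) ≠ 0 →
      M.diffLimit (M.ofLead x) ρ m 0 - ρ * M.diffLimit (M.ofLead x) ρ m 1 ≠ 0 := by
    refine ae_ne_zero_of_quadratic (M.classShift 0) (fun _ => 1) _ continuous_const (by fun_prop)
      fun y => Or.inr ⟨0, M.spike 0 * (1 - ρ ^ 2), M.diffLimit (M.ofLead y) ρ m 0 -
        ρ * M.diffLimit (M.ofLead y) ρ m 1,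
        Or.inr (mul_ne_zero (hs 0).ne' hρ'), fun r => ?_⟩
    rw [(M.diffLimit_shift hn ρ m y r 1).1, (M.diffLimit_shift hn ρ m y r 0).1]
    simp only [corr_00, corr_01]; ring
  -- Shifting class 0 fixes both scatters and moves e along (1, ρ). The r² coefficient of the
  -- determinant is, up to a nonzero factor, ρ times the gap expression.
  have h5 : ∀ᵐ x : M.Idx → ℝ,
      ρ * ((1 - ρ ^ 2) * M.leadScatter (M.ofLead x) 1 + -(t 0 - t 1)) ≠ 0 →
      GramLimit.crossDet t ρ (M.leadScatter (M.ofLead x)) (M.diffLimit (M.ofLead x) ρ m) ≠ 0 := by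
    refine ae_ne_zero_of_quadratic (M.classShift 0)
      (fun x => ρ * ((1 - ρ ^ 2) * M.leadScatter (M.ofLead x) 1 + -(t 0 - t 1))) _ (by fun_prop)
      (by simp only [GramLimit.crossDet]; fun_prop) fun y => ?_
    simp only [GramLimit.crossDet, M.leadScatter_shift hn]
    by_cases h0 : ρ * ((1 - ρ ^ 2) * M.leadScatter (M.ofLead y) 1 + -(t 0 - t 1)) = 0
    · exact Or.inl fun _ => h0
    · set Φ0 := M.leadScatter (M.ofLead y) 0
      set Φ1 := M.leadScatter (M.ofLead y) 1
      set e0 := M.diffLimit (M.ofLead y) ρ m 0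
      set e1 := M.diffLimit (M.ofLead y) ρ m 1
      refine Or.inr ⟨-(M.spike 0 ^ 2 * (ρ * ((1 - ρ ^ 2) * Φ1 + -(t 0 - t 1)))),
        M.spike 0 * (e1 * (Φ0 + ρ * Φ1 * ρ + t 0) + ρ * (Φ0 * e0 + ρ * Φ1 * e1 + t 0 * e0) -
          e0 * (ρ * Φ0 + Φ1 * ρ + t 1 * ρ) - (ρ * Φ0 * e0 + Φ1 * e1 + t 1 * e1)),
        e1 * (Φ0 * e0 + ρ * Φ1 * e1 + t 0 * e0) - e0 * (ρ * Φ0 * e0 + Φ1 * e1 + t 1 * e1),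
        Or.inl (neg_ne_zero.2 (mul_ne_zero (pow_ne_zero 2 (hs 0).ne') h0)), fun r => ?_⟩
      rw [(M.diffLimit_shift hn ρ m y r 1).1, (M.diffLimit_shift hn ρ m y r 0).1]
      simp only [corr_00, corr_01]; ring
  filter_upwards [M.ae_scatter_affine hn hs 0 1 0 one_ne_zero,
    M.ae_scatter_affine hn hs 1 1 0 one_ne_zero,
    M.ae_scatter_affine hn hs 1 (1 - ρ ^ 2) (-(t 0 - t 1)) hρ', h3, h4, h5,
    M.ae_scatter_bilinear hn hs 0 (-1) 1 (t 0 - t 1)] with x a0 a1 a2 a3 a4 a5 a6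
  have b3 := sub_ne_zero.1 (a3 one_ne_zero)
  have b4 := sub_ne_zero.1 (a4 one_ne_zero)
  refine ⟨fun k => (M.leadScatter_nonneg _ k).lt_of_ne' ?_, fun h => a2 (by linarith), b3, b4, ?_⟩
  · fin_cases k
    · simpa using a0
    · simpa using a1
  -- For ρ = 0 that coefficient is lost, but the determinant factors as e₀ e₁ times the difference
  -- of the diagonal entries.
  · by_cases hz : ρ = 0
    · have b6 := a6 (by norm_num)
      simp only [hz, zero_mul] at b3 b4
      have : GramLimit.crossDet t ρ (M.leadScatter (M.ofLead x)) (M.diffLimit (M.ofLead x) ρ m) =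
        M.diffLimit (M.ofLead x) ρ m 1 * M.diffLimit (M.ofLead x) ρ m 0 *
          ((0 * M.leadScatter (M.ofLead x) 0 + -1) * M.leadScatter (M.ofLead x) 1 +
            1 * M.leadScatter (M.ofLead x) 0 + (t 0 - t 1)) := by
        simp only [GramLimit.crossDet, hz]; ring
      rw [this]
      rw [hz] at *
      exact mul_ne_zero (mul_ne_zero b3 b4) b6
    · exact a5 (mul_ne_zero hz a2)

/-- For a fixed argument the polynomial is affine in each scatter; the coefficient of the second
scatter is (1 - ρ²)Φ₀ + t₀ - x₀, which is almost everywhere nonzero. -/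
theorem ae_leadChar_ofLead (hn : ∀ k, 2 ≤ M.size k) (hs : ∀ k, 0 < M.spike k) (t : Fin 2 → ℝ) {ρ : ℝ}
    (hρ : ρ ^ 2 < 1) (x₀ : ℝ) : ∀ᵐ x : M.Idx → ℝ,
      GramLimit.leadChar t ρ (M.leadScatter (M.ofLead x)) x₀ ≠ 0 := by
  have hρ' : 1 - ρ ^ 2 ≠ 0 := by linarith
  filter_upwards [M.ae_scatter_affine hn hs 0 (1 - ρ ^ 2) (t 0 - x₀) hρ',
    M.ae_scatter_bilinear hn hs (1 - ρ ^ 2) (t 0 - x₀) (t 1 - x₀) ((t 0 - x₀) * (t 1 - x₀))]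
    with x h1 h2
  convert h2 h1 using 1
  simp only [GramLimit.leadChar]; ring

/-! ### Transfer to the training sample -/

theorem scoreLaw_lead_absolutelyContinuous (hM : M.HasScores) (k : Fin 2) :
    (M.scoreLaw k).map (fun z => z 0) ≪ volume := by
  have hm : Measurable fun y : Fin 1 → ℝ => y 0 := by fun_prop
  have h1 := (hM.density k 1).map hm
  rw [Measure.map_map hm (by fun_prop)] at h1
  refine h1.trans ?_
  have := volume_preserving_funUnique (Fin 1) ℝ
  exact (this.map_eq).absolutelyContinuous

variable {M} {Ω : Type*} [MeasurableSpace Ω] {P : Measure Ω} [IsProbabilityMeasure P]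
  {Z : (k : Fin 2) → Fin (M.size k) → Ω → ℕ → ℝ}

/-- The leading scores are independent and each has a density, so their joint law is absolutely
continuous and Lebesgue-generic statements hold almost surely. -/
theorem IsTrainingSample.ae_lead (hZ : M.IsTrainingSample P Z) (hM : M.HasScores)
    {p : (M.Idx → ℝ) → Prop} (hp : ∀ᵐ x, p x) : ∀ᵐ ω ∂P, p fun a => Z a.1 a.2 ω 0 := by
  have hmeas : ∀ a : M.Idx, Measurable fun ω => Z a.1 a.2 ω 0 := fun a =>
    (measurable_pi_apply 0).comp (hZ.meas a.1 a.2)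
  have hind : iIndepFun (fun (a : M.Idx) ω => Z a.1 a.2 ω 0) P :=
    hZ.indep.comp (fun _ z => z 0) fun _ => measurable_pi_apply 0
  have hlaw := hind.map_fun_eq_pi_map fun a => (hmeas a).aemeasurable
  have hac : P.map (fun ω (a : M.Idx) => Z a.1 a.2 ω 0) ≪ volume := by
    rw [hlaw, volume_pi]
    have : ∀ a : M.Idx, IsProbabilityMeasure (P.map fun ω => Z a.1 a.2 ω 0) := fun a =>
      Measure.isProbabilityMeasure_map (hmeas a).aemeasurable
    refine pi_absolutelyContinuous _ _ fun a => ?_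
    have h1 : P.map (fun ω => Z a.1 a.2 ω 0) = (M.scoreLaw a.1).map (fun z => z 0) := by
      rw [← hZ.law a.1 a.2, Measure.map_map (measurable_pi_apply 0) (hZ.meas a.1 a.2)]
      rfl
    rw [h1]
    exact M.scoreLaw_lead_absolutelyContinuous hM a.1
  exact ae_of_ae_map (measurable_pi_lambda _ hmeas).aemeasurable (hac.ae_le hp)

end SpikedModel

/-! ### Limiting angles among leading eigenvectors and mean difference -/

namespace SpikedModel

theorem inner_eq_of_mem_span {E : Type*} [NormedAddCommGroup E] [InnerProductSpace ℝ E] {b : Fin 2 → E}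
    (hb : Orthonormal ℝ b) {x : E} (hx : x ∈ Submodule.span ℝ (Set.range b)) (v : E) :
    inner ℝ v x = ∑ i, inner ℝ (b i) v * inner ℝ (b i) x := by
  obtain ⟨c, rfl⟩ := (Submodule.mem_span_range_iff_exists_fun ℝ).1 hx
  rw [inner_sum]
  refine Finset.sum_congr rfl fun i _ => ?_
  rw [hb.inner_right_fintype, real_inner_smul_right, real_inner_comm]
  ring

variable (M : SpikedModel)

theorem norm_lead {p : ℕ} (hp : 0 < p) (k : Fin 2) : ‖M.lead k p‖ = 1 := by
  rw [lead, dif_pos hp]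
  exact (M.axis k p).norm_eq_one _

theorem tendsto_scaledSpike {t : Fin 2 → ℝ} (h : M.HasSpectrum t) (k : Fin 2) :
    Tendsto (M.scaledSpike k) atTop (𝓝 (M.spike k)) := by
  have h1 : Tendsto (fun p : ℕ => √(M.spike k ^ 2 + M.tail k 0 / p)) atTop
      (𝓝 √(M.spike k ^ 2 + 0)) :=
    ((tendsto_const_div_atTop_nhds_zero_nat _).const_add _).sqrt
  rw [add_zero, Real.sqrt_sq (h.spike_pos k).le] at h1
  refine h1.congr' ?_
  filter_upwards [eventually_gt_atTop 0] with p hp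
  have hp' : (0 : ℝ) < p := by exact_mod_cast hp
  rw [scaledSpike, eigval, if_pos rfl, inv_mul_eq_div, ← Real.sqrt_div' _ hp'.le]
  congr 1
  field_simp

theorem norm_scaledMean (p : ℕ) : ‖M.scaledMean p‖ = ‖M.meanDiff p‖ / √(p : ℝ) := by
  rw [scaledMean, norm_smul, norm_inv, Real.norm_of_nonneg (Real.sqrt_nonneg _), inv_mul_eq_div]

variable {M} {R : Fin 2 → RR 2}

theorem HasCommonEigenspace.tendsto_lead (hR : M.HasCommonEigenspace R) (k l : Fin 2) :
    Tendsto (fun p => inner ℝ (M.lead k p) (M.lead l p)) atTop (𝓝 (inner ℝ (R k) (R l))) := by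
  obtain ⟨-, ⟨b, hb, -, hlim⟩, -⟩ := hR
  have h1 : Tendsto (fun p => ∑ i, inner ℝ (b p i) (M.lead k p) * inner ℝ (b p i) (M.lead l p)) atTop
      (𝓝 (∑ i, R k i * R l i)) := tendsto_finsetSum _ fun i _ => (hlim k i).mul (hlim l i)
  have h2 : inner ℝ (R k) (R l) = ∑ i, R k i * R l i := by
    simp only [PiLp.inner_apply, RCLike.inner_apply, conj_trivial, mul_comm]
  rw [h2]
  refine h1.congr' ?_
  filter_upwards [hb] with p hp
  refine (inner_eq_of_mem_span hp.1 ?_ _).symm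
  rw [hp.2]
  exact Submodule.subset_span ⟨l, rfl⟩

theorem HasCommonEigenspace.norm_eq_one (hR : M.HasCommonEigenspace R) (k : Fin 2) : ‖R k‖ = 1 := by
  have h1 := hR.tendsto_lead k k
  have h2 : (inner ℝ (R k) (R k) : ℝ) = 1 := by
    refine tendsto_nhds_unique h1 (tendsto_const_nhds.congr' ?_)
    filter_upwards [eventually_gt_atTop 0] with p hp
    rw [real_inner_self_eq_norm_sq, M.norm_lead hp, one_pow]
  rw [real_inner_self_eq_norm_sq] at h2
  exact (pow_eq_one_iff_of_nonneg (norm_nonneg _) two_ne_zero).1 h2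

theorem HasCommonEigenspace.inner_eq_corr (hR : M.HasCommonEigenspace R) (k l : Fin 2) :
    inner ℝ (R k) (R l) = corr (inner ℝ (R 0) (R 1)) k l := by
  fin_cases k <;> fin_cases l
  · simp [hR.norm_eq_one]
  · simp
  · simp [real_inner_comm]
  · simp [hR.norm_eq_one]

/-- The Gram–Schmidt remainder of the independent unit vectors `R 0`, `R 1` has squared norm 1 - ρ².
-/
theorem HasCommonEigenspace.corr_sq_lt_one (hR : M.HasCommonEigenspace R) :
    (inner ℝ (R 0) (R 1) : ℝ) ^ 2 < 1 := by
  have hne : R 1 - (inner ℝ (R 0) (R 1) : ℝ) • R 0 ≠ 0 := by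
    intro h
    have hli := hR.2.2
    have e : R = ![R 0, R 1] := by ext i; fin_cases i <;> rfl
    rw [e, LinearIndependent.pair_iff] at hli
    have := hli (-(inner ℝ (R 0) (R 1) : ℝ)) 1 (by rw [← h]; simp; abel)
    exact one_ne_zero this.2
  have h1 : 0 < ‖R 1 - (inner ℝ (R 0) (R 1) : ℝ) • R 0‖ ^ 2 := by positivity
  rw [norm_sub_sq_real, norm_smul, real_inner_smul_right, hR.norm_eq_one, hR.norm_eq_one,
    real_inner_comm (R 0) (R 1), mul_one, Real.norm_eq_abs, sq_abs] at h1
  nlinarith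

/-- The angles of the common basis with the mean difference, together with its norm, fix the
limiting coordinates of the scaled mean; the leading eigenvectors lie in the span of that basis. -/
theorem HasCommonEigenspace.exists_tendsto_mean (hR : M.HasCommonEigenspace R) {δ : ℝ}
    (hgap : M.HasMeanGap δ) : ∃ m : Fin 2 → ℝ, ∀ l,
      Tendsto (fun p => inner ℝ (M.scaledMean p) (M.lead l p)) atTop (𝓝 (m l)) := by
  obtain ⟨-, ⟨b, hb, hang, hlim⟩, -⟩ := hR
  choose θ _ hθ using hang
  have hbm : ∀ i, Tendsto (fun p => inner ℝ (b p i) (M.scaledMean p)) atTop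
      (𝓝 (Real.cos (θ i) * δ)) := fun i => by
    have h1 := ((Real.continuous_cos.tendsto _).comp (hθ i)).mul hgap
    refine h1.congr' ?_
    filter_upwards [hb] with p hp
    have h2 := InnerProductGeometry.cos_angle_mul_norm_mul_norm (b p i) (M.meanDiff p)
    rw [hp.1.1 i, one_mul] at h2
    rw [scaledMean, real_inner_smul_right, ← h2, Function.comp_apply]
    ring
  refine ⟨fun l => ∑ i, (Real.cos (θ i) * δ) * R l i, fun l => ?_⟩
  have h1 : Tendsto (fun p => ∑ i, inner ℝ (b p i) (M.scaledMean p) * inner ℝ (b p i) (M.lead l p))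
      atTop (𝓝 (∑ i, (Real.cos (θ i) * δ) * R l i)) :=
    tendsto_finsetSum _ fun i _ => (hbm i).mul (hlim l i)
  refine h1.congr' ?_
  filter_upwards [hb] with p hp
  refine (inner_eq_of_mem_span hp.1 ?_ _).symm
  rw [hp.2]
  exact Submodule.subset_span ⟨l, rfl⟩

end SpikedModel

namespace SpikedModel

/-! ### Moments of the scores -/

/-- Centred, uncorrelated, standardised scores with bounded fourth moments. -/
structure ScoreMoments (μ : Measure (ℕ → ℝ)) (C : ℝ) : Prop where
  prob : IsProbabilityMeasure μ
  fourth : ∀ i : ℕ, Integrable (fun z : ℕ → ℝ => z i ^ 4) μ ∧ ∫ z, z i ^ 4 ∂μ ≤ C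
  uncorrelated : ∀ i j : ℕ, ∫ z, z i * z j ∂μ = if i = j then 1 else 0

theorem HasScores.exists_moments {M : SpikedModel} (h : M.HasScores) (k : Fin 2) :
    ∃ C, ScoreMoments (M.scoreLaw k) C :=
  (h.fourth k).imp fun _ hC => ⟨h.prob k, hC, h.uncorrelated k⟩

namespace ScoreMoments

variable {μ : Measure (ℕ → ℝ)} {C : ℝ}

theorem measurable_coord (i : ℕ) : Measurable fun z : ℕ → ℝ => z i := measurable_pi_apply i

theorem measurable_coord_sq (i : ℕ) : Measurable fun z : ℕ → ℝ => z i ^ 2 :=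
  (measurable_coord i).pow_const 2

theorem memLp_sq (h : ScoreMoments μ C) (i : ℕ) : MemLp (fun z : ℕ → ℝ => z i ^ 2) 2 μ := by
  refine (memLp_two_iff_integrable_sq (measurable_coord_sq i).aestronglyMeasurable).2 ((h.fourth i).1.congr ?_)
  exact Eventually.of_forall fun z => by simp only; ring

theorem memLp (h : ScoreMoments μ C) (i : ℕ) : MemLp (fun z : ℕ → ℝ => z i) 2 μ := by
  have := h.prob
  exact (memLp_two_iff_integrable_sq (measurable_coord i).aestronglyMeasurable).2
    ((h.memLp_sq i).integrable (by norm_num))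

theorem integral_sq (h : ScoreMoments μ C) (i : ℕ) : ∫ z, z i ^ 2 ∂μ = 1 := by
  have := h.uncorrelated i i
  simp only [if_true, ← sq] at this
  exact this

theorem integrable_linear_sq (h : ScoreMoments μ C) {p : ℕ} (c : Fin p → ℝ) :
    Integrable (fun z : ℕ → ℝ => (∑ i : Fin p, c i * z i) ^ 2) μ := by
  refine MemLp.integrable_sq (memLp_finsetSum _ fun i _ => ?_)
  exact (h.memLp i).const_mul (c i)

theorem integral_linear_sq (h : ScoreMoments μ C) {p : ℕ} (c : Fin p → ℝ) :
    ∫ z, (∑ i : Fin p, c i * z i) ^ 2 ∂μ = ∑ i, c i ^ 2 := by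
  have h1 : ∀ z : ℕ → ℝ, (∑ i : Fin p, c i * z i) ^ 2 =
      ∑ i : Fin p, ∑ j : Fin p, (c i * c j) * (z i * z j) := fun z => by
    rw [sq, Finset.sum_mul_sum]
    exact Finset.sum_congr rfl fun i _ => Finset.sum_congr rfl fun j _ => by ring
  have hint : ∀ i j : Fin p, Integrable (fun z : ℕ → ℝ => (c i * c j) * (z i * z j)) μ := fun i j =>
    ((h.memLp i).integrable_mul (h.memLp j)).const_mul _
  simp only [h1]
  rw [integral_finsetSum _ fun i _ => integrable_finsetSum _ fun j _ => hint i j]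
  refine Finset.sum_congr rfl fun i _ => ?_
  rw [integral_finsetSum _ fun j _ => hint i j, Finset.sum_eq_single i]
  · rw [integral_const_mul, h.uncorrelated, if_pos rfl]; ring
  · intro j _ hj
    rw [integral_const_mul, h.uncorrelated, if_neg, mul_zero]
    exact fun hij => hj (Fin.ext hij.symm)
  · simp

theorem lintegral_linear_sq (h : ScoreMoments μ C) {p : ℕ} (c : Fin p → ℝ) :
    ∫⁻ z, ENNReal.ofReal ((∑ i : Fin p, c i * z i) ^ 2) ∂μ = ENNReal.ofReal (∑ i, c i ^ 2) := by
  rw [← h.integral_linear_sq c, ofReal_integral_eq_lintegral_ofReal (h.integrable_linear_sq c)]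
  exact Eventually.of_forall fun z => sq_nonneg _

/-- Squared scores, centred. -/
def sqDev (i : ℕ) (z : ℕ → ℝ) : ℝ := z i ^ 2 - 1

theorem memLp_sqDev (h : ScoreMoments μ C) (i : ℕ) : MemLp (sqDev i) 2 μ := by
  have := h.prob
  exact (h.memLp_sq i).sub (memLp_const 1)

theorem covariance_sq (h : ScoreMoments μ C) (i j : ℕ) :
    covariance (fun z => z i ^ 2) (fun z => z j ^ 2) μ = ∫ z, sqDev i z * sqDev j z ∂μ := by
  rw [covariance, h.integral_sq, h.integral_sq]
  rfl

theorem variance_sq_le (h : ScoreMoments μ C) (i : ℕ) : variance (fun z => z i ^ 2) μ ≤ C := by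
  have := h.prob
  refine (variance_le_expectation_sq (measurable_coord_sq i).aestronglyMeasurable).trans (le_trans (le_of_eq ?_) (h.fourth i).2)
  refine integral_congr_ae (Eventually.of_forall fun z => ?_)
  simp only [Pi.pow_apply]; ring

theorem const_nonneg (h : ScoreMoments μ C) : 0 ≤ C :=
  (variance_nonneg _ _).trans (h.variance_sq_le 0)

theorem abs_integral_le (h : ScoreMoments μ C) (i j : ℕ) :
    |∫ z, sqDev i z * sqDev j z ∂μ| ≤ C := by
  have h1 : ∀ i, ∫ z, sqDev i z ^ 2 ∂μ ≤ C := fun i => by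
    refine le_trans (le_of_eq ?_) (h.variance_sq_le i)
    rw [variance_eq_integral (measurable_coord_sq i).aemeasurable, h.integral_sq]
    rfl
  have hi := fun i => (h.memLp_sqDev i).integrable_sq
  calc |∫ z, sqDev i z * sqDev j z ∂μ| ≤ ∫ z, |sqDev i z * sqDev j z| ∂μ := abs_integral_le_integral_abs
    _ ≤ ∫ z, (2⁻¹ * sqDev i z ^ 2 + 2⁻¹ * sqDev j z ^ 2) ∂μ := by
        refine integral_mono ((h.memLp_sqDev i).integrable_mul (h.memLp_sqDev j)).abs
          (((hi i).const_mul _).add ((hi j).const_mul _)) fun z => ?_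
        simp only [abs_mul]
        nlinarith [sq_nonneg (|sqDev i z| - |sqDev j z|), sq_abs (sqDev i z), sq_abs (sqDev j z)]
    _ ≤ C := by
        rw [integral_add ((hi i).const_mul _) ((hi j).const_mul _), integral_const_mul,
          integral_const_mul]
        linarith [h1 i, h1 j]

theorem abs_integral_le_mixing (h : ScoreMoments μ C) {π : Equiv.Perm ℕ} {ρ : ℕ → ℝ}
    (hρ : ∀ (m j : ℕ) (f g : (ℕ → ℝ) → ℝ),
      Measurable[⨆ i ∈ Set.Iic j, MeasurableSpace.comap (fun z : ℕ → ℝ => z (π i)) inferInstance] f →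
      Measurable[⨆ i ∈ Set.Ici (j + m),
        MeasurableSpace.comap (fun z : ℕ → ℝ => z (π i)) inferInstance] g →
      MemLp f 2 μ → MemLp g 2 μ →
      |covariance f g μ| ≤ ρ m * (√(variance f μ) * √(variance g μ))) (a m : ℕ) :
    |∫ z, sqDev (π a) z * sqDev (π (a + m)) z ∂μ| ≤ |ρ m| * C := by
  have hmeas : ∀ (S : Set ℕ) (i : ℕ), i ∈ S →
      Measurable[⨆ i ∈ S, MeasurableSpace.comap (fun z : ℕ → ℝ => z (π i)) inferInstance]
        (fun z : ℕ → ℝ => z (π i) ^ 2) := fun S i hi => by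
    have h1 : Measurable[⨆ i ∈ S, MeasurableSpace.comap (fun z : ℕ → ℝ => z (π i)) inferInstance]
        (fun z : ℕ → ℝ => z (π i)) :=
      (comap_measurable _).mono (le_iSup₂ (f := fun i (_ : i ∈ S) =>
        MeasurableSpace.comap (fun z : ℕ → ℝ => z (π i)) inferInstance) i hi) le_rfl
    exact (measurable_id.pow_const 2).comp h1
  have h1 := hρ m a _ _ (hmeas (Set.Iic a) a Set.self_mem_Iic) (hmeas (Set.Ici (a + m)) (a + m) Set.self_mem_Ici)
    (h.memLp_sq _) (h.memLp_sq _)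
  rw [h.covariance_sq] at h1
  refine h1.trans (mul_le_mul (le_abs_self _) ?_ (by positivity) (abs_nonneg _))
  calc _ ≤ √C * √C := mul_le_mul (Real.sqrt_le_sqrt (h.variance_sq_le _))
        (Real.sqrt_le_sqrt (h.variance_sq_le _)) (by positivity) (by positivity)
    _ = C := Real.mul_self_sqrt h.const_nonneg

/-- In the order given by the permutation, at most 2m₀ + 1 indices are within distance m₀ of a given
one, each with covariance at most C. All others have covariance at most ε by mixing. -/
theorem sum_abs_integral_le (h : ScoreMoments μ C)
    (hmix : ∃ π : Equiv.Perm ℕ, IsRhoMixing μ (fun i z => z (π i))) {ε : ℝ} (hε : 0 < ε) :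
    ∃ K : ℝ, ∀ i p : ℕ, ∑ j ∈ Finset.range p, |∫ z, sqDev i z * sqDev j z ∂μ| ≤ K + ε * p := by
  classical
  obtain ⟨π, ρ, hlim, hρ⟩ := hmix
  have h0 : Tendsto (fun m => |ρ m| * C) atTop (𝓝 0) := by simpa using hlim.abs.mul_const C
  obtain ⟨m₀, hm₀⟩ := eventually_atTop.1 (h0.eventually_le_const hε)
  have hfar : ∀ i j, (π.symm i + m₀ ≤ π.symm j ∨ π.symm j + m₀ ≤ π.symm i) →
      |∫ z, sqDev i z * sqDev j z ∂μ| ≤ ε := by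
    rintro i j (hij | hij)
    · have := h.abs_integral_le_mixing hρ (π.symm i) (π.symm j - π.symm i)
      rw [Nat.add_sub_cancel' (by omega), π.apply_symm_apply, π.apply_symm_apply] at this
      exact this.trans (hm₀ _ (by omega))
    · have := h.abs_integral_le_mixing hρ (π.symm j) (π.symm i - π.symm j)
      rw [Nat.add_sub_cancel' (by omega), π.apply_symm_apply, π.apply_symm_apply] at this
      simp only [mul_comm (sqDev i _)]
      exact this.trans (hm₀ _ (by omega))
  refine ⟨(2 * m₀ + 1 : ℕ) * C, fun i p => ?_⟩
  let N : Finset ℕ := (Finset.Icc (π.symm i - m₀) (π.symm i + m₀)).map π.toEmbedding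
  have hN : N.card ≤ 2 * m₀ + 1 := by
    simp only [N, Finset.card_map, Nat.card_Icc]; omega
  have hterm : ∀ j, |∫ z, sqDev i z * sqDev j z ∂μ| ≤ (if j ∈ N then C else 0) + ε := fun j => by
    by_cases hj : j ∈ N
    · rw [if_pos hj]; linarith [h.abs_integral_le i j]
    · rw [if_neg hj, zero_add]
      refine hfar i j ?_
      by_contra! hc
      refine hj (Finset.mem_map.2 ⟨π.symm j, Finset.mem_Icc.2 ⟨by omega, by omega⟩, by simp⟩)
  calc ∑ j ∈ Finset.range p, |∫ z, sqDev i z * sqDev j z ∂μ|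
      ≤ ∑ j ∈ Finset.range p, ((if j ∈ N then C else 0) + ε) := Finset.sum_le_sum fun j _ => hterm j
    _ = ∑ j ∈ Finset.range p, (if j ∈ N then C else 0) + ε * p := by
        rw [Finset.sum_add_distrib, Finset.sum_const, Finset.card_range, nsmul_eq_mul, mul_comm ε]
    _ ≤ (2 * m₀ + 1 : ℕ) * C + ε * p := by
        gcongr
        rw [← Finset.sum_filter, Finset.sum_const, nsmul_eq_mul]
        refine mul_le_mul_of_nonneg_right ?_ h.const_nonneg
        have : ((Finset.range p).filter (· ∈ N)).card ≤ N.card :=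
          Finset.card_le_card fun j hj => (Finset.mem_filter.1 hj).2
        exact_mod_cast this.trans hN

theorem memLp_sqDev_sum (h : ScoreMoments μ C) (c : ℕ → ℝ) (p : ℕ) :
    MemLp (fun z => ∑ i ∈ Finset.range p, c i * sqDev i z) 2 μ :=
  memLp_finsetSum _ fun i _ => (h.memLp_sqDev i).const_mul (c i)

/-- Weak law of large numbers for the squared scores. -/
theorem tendsto_lintegral_sqDev (h : ScoreMoments μ C)
    (hmix : ∃ π : Equiv.Perm ℕ, IsRhoMixing μ (fun i z => z (π i))) (c : ℕ → ℝ) {B : ℝ}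
    (hc : ∀ i, |c i| ≤ B) :
    Tendsto (fun p : ℕ => ∫⁻ z, ENNReal.ofReal
      (((p : ℝ)⁻¹ * ∑ i ∈ Finset.range p, c i * sqDev i z) ^ 2) ∂μ) atTop (𝓝 0) := by
  have hB : 0 ≤ B := (abs_nonneg _).trans (hc 0)
  have hsq : ∀ p : ℕ, ∫ z, (∑ i ∈ Finset.range p, c i * sqDev i z) ^ 2 ∂μ ≤
      B ^ 2 * ∑ i ∈ Finset.range p, ∑ j ∈ Finset.range p, |∫ z, sqDev i z * sqDev j z ∂μ| := by
    intro p
    have h1 : ∀ z, (∑ i ∈ Finset.range p, c i * sqDev i z) ^ 2 = ∑ i ∈ Finset.range p,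
        ∑ j ∈ Finset.range p, (c i * c j) * (sqDev i z * sqDev j z) := fun z => by
      rw [sq, Finset.sum_mul_sum]
      exact Finset.sum_congr rfl fun i _ => Finset.sum_congr rfl fun j _ => by ring
    have hint : ∀ i j, Integrable (fun z => (c i * c j) * (sqDev i z * sqDev j z)) μ := fun i j =>
      ((h.memLp_sqDev i).integrable_mul (h.memLp_sqDev j)).const_mul _
    simp only [h1]
    rw [integral_finsetSum _ fun i _ => integrable_finsetSum _ fun j _ => hint i j, Finset.mul_sum]
    refine Finset.sum_le_sum fun i _ => ?_
    rw [integral_finsetSum _ fun j _ => hint i j, Finset.mul_sum]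
    refine Finset.sum_le_sum fun j _ => ?_
    rw [integral_const_mul]
    refine (le_abs_self _).trans ?_
    rw [abs_mul, abs_mul, sq]
    exact mul_le_mul_of_nonneg_right (mul_le_mul (hc i) (hc j) (abs_nonneg _) hB) (abs_nonneg _)
  have hreal : Tendsto (fun p : ℕ => ∫ z, ((p : ℝ)⁻¹ * ∑ i ∈ Finset.range p, c i * sqDev i z) ^ 2 ∂μ)
      atTop (𝓝 0) := by
    rw [Metric.tendsto_atTop]
    intro ε hε
    -- The weights contribute a factor B², so this choice keeps the mixing part below ε / 2; the
    -- constant K contributes only O(1 / p).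
    obtain ⟨K, hK⟩ := h.sum_abs_integral_le hmix (ε := ε / (2 * (B ^ 2 + 1))) (by positivity)
    have hlim : Tendsto (fun p : ℕ => B ^ 2 * K / p) atTop (𝓝 0) :=
      tendsto_const_div_atTop_nhds_zero_nat _
    obtain ⟨p₀, hp₀⟩ := eventually_atTop.1 ((hlim.eventually_lt_const (half_pos hε)).and
      (eventually_gt_atTop 0))
    refine ⟨p₀, fun p hp => ?_⟩
    obtain ⟨h1, h2⟩ := hp₀ p hp
    have hp' : (0 : ℝ) < p := by exact_mod_cast h2
    rw [Real.dist_0_eq_abs, abs_of_nonneg (integral_nonneg fun z => sq_nonneg _)]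
    simp only [mul_pow]
    rw [integral_const_mul]
    have h3 : ∑ i ∈ Finset.range p, ∑ j ∈ Finset.range p, |∫ z, sqDev i z * sqDev j z ∂μ| ≤
        p * (K + ε / (2 * (B ^ 2 + 1)) * p) := by
      refine (Finset.sum_le_sum fun i _ => hK i p).trans ?_
      rw [Finset.sum_const, Finset.card_range, nsmul_eq_mul]
    have h4 := (hsq p).trans (mul_le_mul_of_nonneg_left h3 (sq_nonneg B))
    calc ((p : ℝ)⁻¹) ^ 2 * ∫ z, (∑ i ∈ Finset.range p, c i * sqDev i z) ^ 2 ∂μ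
        ≤ ((p : ℝ)⁻¹) ^ 2 * (B ^ 2 * (p * (K + ε / (2 * (B ^ 2 + 1)) * p))) := by gcongr
      _ = B ^ 2 * K / p + (B ^ 2 / (B ^ 2 + 1)) * (ε / 2) := by field_simp
      _ < ε / 2 + ε / 2 := by
          refine add_lt_add_of_lt_of_le h1 (mul_le_of_le_one_left (by positivity) ?_)
          rw [div_le_one (by positivity)]
          linarith
      _ = ε := add_halves ε
  have h5 := (ENNReal.continuous_ofReal.tendsto 0).comp hreal
  rw [ENNReal.ofReal_zero] at h5
  refine h5.congr fun p => ?_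
  rw [Function.comp_apply, ofReal_integral_eq_lintegral_ofReal]
  · exact ((h.memLp_sqDev_sum c p).const_mul _).integrable_sq
  · exact Eventually.of_forall fun z => sq_nonneg _

end ScoreMoments

end SpikedModel

namespace SpikedModel

/-! ### Convergence along subsequences -/

theorem exists_seq_tendsto_ae_of_sq {S κ : Type*} [MeasurableSpace S] [Fintype κ] {P : Measure S}
    (f : κ → ℕ → S → ℝ) (hm : ∀ c p, Measurable (f c p))
    (hf : ∀ c, Tendsto (fun p => ∫⁻ x, ENNReal.ofReal (f c p x ^ 2) ∂P) atTop (𝓝 0))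
    {ns : ℕ → ℕ} (hns : Tendsto ns atTop atTop) :
    ∃ ms : ℕ → ℕ, StrictMono ms ∧
      ∀ᵐ x ∂P, ∀ c, Tendsto (fun i => f c (ns (ms i)) x) atTop (𝓝 0) := by
  have hW : ∀ p x, 0 ≤ ∑ c, f c p x ^ 2 := fun p x => Finset.sum_nonneg fun c _ => sq_nonneg _
  have hlim : Tendsto (fun p => ∫⁻ x, ENNReal.ofReal (∑ c, f c p x ^ 2) ∂P) atTop (𝓝 0) := by
    have h1 := tendsto_finsetSum Finset.univ fun c _ => hf c
    rw [Finset.sum_const_zero] at h1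
    refine h1.congr fun p => ?_
    rw [← lintegral_finsetSum _ fun c _ => ((hm c p).pow_const 2).ennreal_ofReal]
    simp only [ENNReal.ofReal_sum_of_nonneg fun c _ => sq_nonneg _]
  have hmeas : TendstoInMeasure P (fun p x => ∑ c, f c p x ^ 2) atTop fun _ => 0 := by
    refine tendstoInMeasure_of_tendsto_eLpNorm (p := 1) one_ne_zero (fun p => ?_)
      aestronglyMeasurable_const (hlim.congr fun p => ?_)
    · exact (Finset.measurable_sum _ fun c _ => (hm c p).pow_const 2).aestronglyMeasurable
    · rw [eLpNorm_one_eq_lintegral_enorm]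
      refine lintegral_congr fun x => ?_
      simp only [Pi.sub_apply, sub_zero]
      rw [Real.enorm_of_nonneg (hW p x)]
  obtain ⟨ms, hms, hae⟩ := (hmeas.comp hns).exists_seq_tendsto_ae
  refine ⟨ms, hms, ?_⟩
  filter_upwards [hae] with x hx c
  have h2 : Tendsto (fun i => f c (ns (ms i)) x ^ 2) atTop (𝓝 0) :=
    squeeze_zero (fun i => sq_nonneg _) (fun i => Finset.single_le_sum
      (f := fun c => f c (ns (ms i)) x ^ 2) (fun c _ => sq_nonneg _) (Finset.mem_univ c)) hx
  have h3 := h2.sqrt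
  simp only [Real.sqrt_zero, Real.sqrt_sq_eq_abs] at h3
  exact (tendsto_zero_iff_abs_tendsto_zero _).2 h3

variable (M : SpikedModel)

/-! ### Second moments of the noise -/

theorem measurable_noise (k : Fin 2) (p : ℕ) : Measurable fun z => M.noise k p z := by
  unfold noise
  refine Finset.measurable_sum _ fun i _ => ?_
  exact ((ScoreMoments.measurable_coord i).const_mul _).smul_const _

/-- Tail eigenvalues, with the leading one replaced by `0`. -/
noncomputable def tailVar (k : Fin 2) (i : ℕ) : ℝ := if i = 0 then 0 else M.tail k i

theorem inner_noise (k : Fin 2) (p : ℕ) (z : ℕ → ℝ) (v : RR p) : inner ℝ (M.noise k p z) v =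
    ∑ i : Fin p, ((if (i : ℕ) = 0 then 0 else √(M.tail k i)) * inner ℝ (M.axis k p i) v) * z i := by
  rw [noise, sum_inner]
  refine Finset.sum_congr rfl fun i _ => ?_
  rw [real_inner_smul_left]; ring

variable {M} {t : Fin 2 → ℝ}

theorem HasSpectrum.exists_bound (h : M.HasSpectrum t) :
    ∃ B : ℝ, 0 ≤ B ∧ ∀ k i, 0 ≤ M.tailVar k i ∧ M.tailVar k i ≤ B := by
  obtain ⟨B, hB⟩ := h.tail_bdd
  have hB0 : 0 ≤ B := (h.tail_pos 0 0).le.trans (hB 0 0)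
  refine ⟨B, hB0, fun k i => ?_⟩
  rw [tailVar]
  split_ifs
  · exact ⟨le_rfl, hB0⟩
  · exact ⟨(h.tail_pos k i).le, hB k i⟩

theorem HasSpectrum.sd_sq (h : M.HasSpectrum t) (k : Fin 2) (i : ℕ) :
    (if i = 0 then 0 else √(M.tail k i)) ^ 2 = M.tailVar k i := by
  rw [tailVar]
  split_ifs
  · simp
  · rw [Real.sq_sqrt (h.tail_pos k i).le]

theorem HasSpectrum.norm_noise_sq (h : M.HasSpectrum t) (k : Fin 2) (p : ℕ) (z : ℕ → ℝ) :
    inner ℝ (M.noise k p z) (M.noise k p z) =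
      ∑ i ∈ Finset.range p, M.tailVar k i * ScoreMoments.sqDev i z +
        ∑ i ∈ Finset.range p, M.tailVar k i := by
  rw [← Finset.sum_add_distrib, ← Fin.sum_univ_eq_sum_range
    (fun i => M.tailVar k i * ScoreMoments.sqDev i z + M.tailVar k i) p]
  nth_rewrite 2 [noise]
  rw [inner_sum]
  refine Finset.sum_congr rfl fun i _ => ?_
  rw [real_inner_smul_right, noise, (M.axis k p).orthonormal.inner_left_fintype,
    ← h.sd_sq, ScoreMoments.sqDev]
  simp only [conj_trivial]
  ring

section Moments

variable {B : ℝ} (hspec : M.HasSpectrum t) (hsc : M.HasScores)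
  (hB : 0 ≤ B ∧ ∀ k i, 0 ≤ M.tailVar k i ∧ M.tailVar k i ≤ B)
include hspec hsc hB

/-- The scores are uncorrelated with unit variance, so the second moment is a weighted sum of
squared coordinates of `v` with weights at most B. -/
theorem lintegral_inner_noise_le (k : Fin 2) (p : ℕ) (v : RR p) :
    ∫⁻ z, ENNReal.ofReal (inner ℝ (M.noise k p z) v ^ 2) ∂M.scoreLaw k ≤
      ENNReal.ofReal (B * ‖v‖ ^ 2) := by
  obtain ⟨C, hC⟩ := hsc.exists_moments k
  simp only [inner_noise]
  rw [hC.lintegral_linear_sq]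
  refine ENNReal.ofReal_le_ofReal ?_
  rw [← (M.axis k p).sum_sq_norm_inner_right, Finset.mul_sum]
  refine Finset.sum_le_sum fun i _ => ?_
  rw [mul_pow, hspec.sd_sq, Real.norm_eq_abs, sq_abs]
  exact mul_le_mul_of_nonneg_right (hB.2 k i).2 (sq_nonneg _)

theorem lintegral_norm_noise_le (k : Fin 2) (p : ℕ) :
    ∫⁻ z, ENNReal.ofReal (‖M.noise k p z‖ ^ 2) ∂M.scoreLaw k ≤ ENNReal.ofReal (B * p) := by
  have h1 : ∀ z, ENNReal.ofReal (‖M.noise k p z‖ ^ 2) =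
      ∑ i, ENNReal.ofReal (inner ℝ (M.noise k p z) (M.axis k p i) ^ 2) := fun z => by
    rw [← ENNReal.ofReal_sum_of_nonneg fun i _ => sq_nonneg _,
      ← (M.axis k p).sum_sq_norm_inner_right]
    simp only [Real.norm_eq_abs, sq_abs, real_inner_comm]
  simp only [h1]
  rw [lintegral_finsetSum _ fun i _ => (((M.measurable_noise k p).inner_const).pow_const
    2).ennreal_ofReal]
  refine (Finset.sum_le_sum fun i _ => lintegral_inner_noise_le hspec hsc hB k p _).trans ?_
  simp only [(M.axis k p).norm_eq_one, one_pow, mul_one]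
  rw [Finset.sum_const, Finset.card_univ, Fintype.card_fin, nsmul_eq_mul, mul_comm B,
    ENNReal.ofReal_mul (Nat.cast_nonneg p), ENNReal.ofReal_natCast]

/-- With one noise vector held fixed the previous bounds apply. The result is of order p, against
the factor p⁻² that scaling brings, so distinct noise vectors become orthogonal. -/
theorem lintegral_noise_noise_le (k l : Fin 2) (p : ℕ) :
    ∫⁻ y, ENNReal.ofReal (inner ℝ (M.noise k p y.1) (M.noise l p y.2) ^ 2)
      ∂(M.scoreLaw k).prod (M.scoreLaw l) ≤ ENNReal.ofReal (B * (B * p)) := by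
  have := hsc.prob k
  have := hsc.prob l
  have hm : Measurable fun y : (ℕ → ℝ) × (ℕ → ℝ) =>
      ENNReal.ofReal (inner ℝ (M.noise k p y.1) (M.noise l p y.2) ^ 2) :=
    ((((M.measurable_noise k p).comp measurable_fst).inner
      ((M.measurable_noise l p).comp measurable_snd)).pow_const 2).ennreal_ofReal
  rw [lintegral_prod_symm _ hm.aemeasurable]
  refine (lintegral_mono fun z' => lintegral_inner_noise_le hspec hsc hB k p _).trans ?_
  simp only [ENNReal.ofReal_mul hB.1]
  rw [lintegral_const_mul _ ((M.measurable_noise l p).norm.pow_const 2).ennreal_ofReal]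
  gcongr
  rw [← ENNReal.ofReal_mul hB.1]
  exact lintegral_norm_noise_le hspec hsc hB l p

theorem tendsto_scaled_noise (k : Fin 2) (v : (p : ℕ) → RR p) (C : ℝ)
    (hv : ∀ᶠ p in atTop, ‖v p‖ ≤ C) :
    Tendsto (fun p : ℕ => ∫⁻ z, ENNReal.ofReal (inner ℝ ((√(p : ℝ))⁻¹ • M.noise k p z) (v p) ^ 2)
      ∂M.scoreLaw k) atTop (𝓝 0) := by
  have h1 : Tendsto (fun p : ℕ => ENNReal.ofReal (B * C ^ 2 / p)) atTop (𝓝 0) := by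
    have := (ENNReal.continuous_ofReal.tendsto 0).comp
      (tendsto_const_div_atTop_nhds_zero_nat (B * C ^ 2))
    rwa [ENNReal.ofReal_zero] at this
  refine tendsto_of_tendsto_of_tendsto_of_le_of_le' tendsto_const_nhds h1
    (Eventually.of_forall fun _ => zero_le) ?_
  filter_upwards [hv, eventually_gt_atTop 0] with p hp hp0
  have hp' : (0 : ℝ) < p := by exact_mod_cast hp0
  have h2 := lintegral_inner_noise_le hspec hsc hB k p ((√(p : ℝ))⁻¹ • v p)
  simp only [real_inner_smul_right, ← real_inner_smul_left] at h2
  refine h2.trans (ENNReal.ofReal_le_ofReal ?_)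
  rw [norm_smul, mul_pow, norm_inv, inv_pow, Real.norm_eq_abs, sq_abs, Real.sq_sqrt hp'.le,
    div_eq_inv_mul, mul_left_comm]
  have h3 : ‖v p‖ ^ 2 ≤ C ^ 2 := pow_le_pow_left₀ (norm_nonneg _) hp 2
  have := mul_le_mul_of_nonneg_left h3 hB.1
  exact mul_le_mul_of_nonneg_left this (inv_nonneg.2 hp'.le)

end Moments

/-! ### The training sample -/

theorem HasSpectrum.tendsto_tailVar (h : M.HasSpectrum t) (k : Fin 2) :
    Tendsto (fun p : ℕ => (p : ℝ)⁻¹ * ∑ i ∈ Finset.range p, M.tailVar k i) atTop (𝓝 (t k)) := by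
  have h1 := (h.tail_avg k).sub (tendsto_const_div_atTop_nhds_zero_nat (M.tail k 0))
  rw [sub_zero] at h1
  refine h1.congr' ?_
  filter_upwards [eventually_gt_atTop 0] with p hp
  have h2 : ∑ i ∈ Finset.range p, M.tailVar k i = ∑ i ∈ Finset.range p, M.tail k i - M.tail k 0 := by
    obtain ⟨r, rfl⟩ : ∃ r, p = r + 1 := ⟨p - 1, by omega⟩
    rw [Finset.sum_range_succ', Finset.sum_range_succ']
    simp [tailVar]
  rw [h2]
  ring

variable {Ω : Type*} [MeasurableSpace Ω] {P : Measure Ω} [IsProbabilityMeasure P]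
  {Z : (k : Fin 2) → Fin (M.size k) → Ω → ℕ → ℝ}

omit [IsProbabilityMeasure P] in
theorem IsTrainingSample.lintegral_comp (hZ : M.IsTrainingSample P Z) (a : M.Idx)
    {g : (ℕ → ℝ) → ENNReal} (hg : Measurable g) :
    ∫⁻ ω, g (Z a.1 a.2 ω) ∂P = ∫⁻ z, g z ∂M.scoreLaw a.1 := by
  rw [← hZ.law a.1 a.2, lintegral_map hg (hZ.meas a.1 a.2)]

theorem IsTrainingSample.lintegral_comp_pair (hZ : M.IsTrainingSample P Z) {a b : M.Idx}
    (hab : a ≠ b) {g : (ℕ → ℝ) × (ℕ → ℝ) → ENNReal} (hg : Measurable g) :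
    ∫⁻ ω, g (Z a.1 a.2 ω, Z b.1 b.2 ω) ∂P =
      ∫⁻ y, g y ∂(M.scoreLaw a.1).prod (M.scoreLaw b.1) := by
  have h1 := (indepFun_iff_map_prod_eq_prod_map_map (hZ.meas a.1 a.2).aemeasurable
    (hZ.meas b.1 b.2).aemeasurable).1 (hZ.indep.indepFun hab)
  rw [← hZ.law a.1 a.2, ← hZ.law b.1 b.2, ← h1, lintegral_map hg
    ((hZ.meas a.1 a.2).prodMk (hZ.meas b.1 b.2))]

/-- All random quantities tend to zero in mean square and there are finitely many of them, so one
subsequence, chosen before the realisation, serves almost every realisation. -/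
theorem exists_seq_noiseLimit (hZ : M.IsTrainingSample P Z) {δ : ℝ} (hgap : M.HasMeanGap δ)
    (hspec : M.HasSpectrum t) (hsc : M.HasScores) {R : Fin 2 → RR 2} (hR : M.HasCommonEigenspace R)
    {m : Fin 2 → ℝ}
    (hm : ∀ l, Tendsto (fun p => inner ℝ (M.scaledMean p) (M.lead l p)) atTop (𝓝 (m l)))
    {ns : ℕ → ℕ} (hns : Tendsto ns atTop atTop) :
    ∃ ms : ℕ → ℕ, StrictMono ms ∧ ∀ᵐ ω ∂P,
      M.NoiseLimit (fun k j => Z k j ω) t (inner ℝ (R 0) (R 1)) m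
        (map (fun i => ns (ms i)) atTop) := by
  classical
  obtain ⟨B, hB⟩ := hspec.exists_bound
  have hbdd : ∀ᶠ p : ℕ in atTop, ‖M.scaledMean p‖ ≤ δ + 1 := by
    simp only [norm_scaledMean]
    exact (hgap.eventually_lt_const (lt_add_one δ)).mono fun _ => le_of_lt
  have hsn : ∀ p (a : M.Idx), Measurable fun ω => M.scaledNoise (fun k j => Z k j ω) p a :=
    fun p a => by
      change Measurable fun ω => (√(p : ℝ))⁻¹ • M.noise a.1 p (Z a.1 a.2 ω)
      exact ((M.measurable_noise a.1 p).comp (hZ.meas a.1 a.2)).const_smul (√(p : ℝ))⁻¹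
  -- Four families: products of distinct noise vectors, deviations of squared noise norms from their
  -- mean, and products of noise with the mean difference and with the leading eigenvectors.
  -- Diagonal pairs are set to 0, the second family being responsible for them.
  let f : (M.Idx × M.Idx) ⊕ M.Idx ⊕ M.Idx ⊕ (M.Idx × Fin 2) → ℕ → Ω → ℝ := fun c p ω =>
    Sum.elim (fun ab => if ab.1 = ab.2 then 0 else inner ℝ (M.scaledNoise (fun k j => Z k j ω) p ab.1)
        (M.scaledNoise (fun k j => Z k j ω) p ab.2))
      (Sum.elim (fun a => (p : ℝ)⁻¹ * ∑ i ∈ Finset.range p,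
        M.tailVar a.1 i * ScoreMoments.sqDev i (Z a.1 a.2 ω))
      (Sum.elim (fun a => inner ℝ (M.scaledNoise (fun k j => Z k j ω) p a) (M.scaledMean p))
      fun al => inner ℝ (M.scaledNoise (fun k j => Z k j ω) p al.1) (M.lead al.2 p))) c
  have hsq : ∀ p, Measurable fun z : (ℕ → ℝ) => ScoreMoments.sqDev p z := fun p =>
    (ScoreMoments.measurable_coord_sq p).sub_const 1
  have hfm : ∀ c p, Measurable (f c p) := by
    rintro (⟨a, b⟩ | a | a | ⟨a, l⟩) p
    · simp only [f, Sum.elim_inl]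
      split_ifs
      · exact measurable_const
      · exact (hsn p a).inner (hsn p b)
    · simp only [f, Sum.elim_inl, Sum.elim_inr]
      exact (Finset.measurable_sum _ fun i _ =>
        ((hsq i).comp (hZ.meas a.1 a.2)).const_mul _).const_mul _
    · exact (hsn p a).inner_const
    · exact (hsn p a).inner_const
  have hin : ∀ (k : Fin 2) (p : ℕ) (w : RR p),
      Measurable fun z : ℕ → ℝ => inner ℝ ((√(p : ℝ))⁻¹ • M.noise k p z) w := fun k p w => by
    have h1 : Measurable fun z : ℕ → ℝ => (√(p : ℝ))⁻¹ • M.noise k p z :=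
      (M.measurable_noise k p).const_smul (√(p : ℝ))⁻¹
    exact h1.inner_const
  have hlim : ∀ c, Tendsto (fun p => ∫⁻ ω, ENNReal.ofReal (f c p ω ^ 2) ∂P) atTop (𝓝 0) := by
    rintro (⟨a, b⟩ | a | a | ⟨a, l⟩)
    · simp only [f, Sum.elim_inl]
      split_ifs with hab
      · simp
      · have h1 : Tendsto (fun p : ℕ => ENNReal.ofReal (B * B / p)) atTop (𝓝 0) := by
          have := (ENNReal.continuous_ofReal.tendsto 0).comp
            (tendsto_const_div_atTop_nhds_zero_nat (B * B))
          rwa [ENNReal.ofReal_zero] at this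
        refine tendsto_of_tendsto_of_tendsto_of_le_of_le' tendsto_const_nhds h1
          (Eventually.of_forall fun _ => zero_le) ?_
        filter_upwards [eventually_gt_atTop 0] with p hp0
        have hp' : (0 : ℝ) < p := by exact_mod_cast hp0
        have hg : Measurable fun y : (ℕ → ℝ) × (ℕ → ℝ) =>
            ENNReal.ofReal (inner ℝ (M.noise a.1 p y.1) (M.noise b.1 p y.2) ^ 2) :=
          ((((M.measurable_noise a.1 p).comp measurable_fst).inner
            ((M.measurable_noise b.1 p).comp measurable_snd)).pow_const 2).ennreal_ofReal
        have h2 := (hZ.lintegral_comp_pair hab hg).trans_le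
          (lintegral_noise_noise_le hspec hsc hB a.1 b.1 p)
        have h3 : ∀ ω, ENNReal.ofReal (inner ℝ (M.scaledNoise (fun k j => Z k j ω) p a)
            (M.scaledNoise (fun k j => Z k j ω) p b) ^ 2) = ENNReal.ofReal (((p : ℝ)⁻¹) ^ 2) *
            ENNReal.ofReal (inner ℝ (M.noise a.1 p (Z a.1 a.2 ω)) (M.noise b.1 p (Z b.1 b.2 ω)) ^ 2)
            := fun ω => by
          rw [← ENNReal.ofReal_mul (sq_nonneg _), ← mul_pow, scaledNoise, scaledNoise,
            real_inner_smul_left, real_inner_smul_right, ← mul_assoc, ← mul_inv,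
            Real.mul_self_sqrt hp'.le]
        simp only [h3]
        rw [lintegral_const_mul' _ _ ENNReal.ofReal_ne_top]
        refine (mul_le_mul_right h2 _).trans ?_
        rw [← ENNReal.ofReal_mul (sq_nonneg _)]
        refine ENNReal.ofReal_le_ofReal (le_of_eq ?_)
        field_simp
    · obtain ⟨C, hC⟩ := hsc.exists_moments a.1
      refine (hC.tendsto_lintegral_sqDev (hsc.mixing a.1) (M.tailVar a.1) (B := B)
        fun i => ?_).congr fun p => ?_
      · rw [abs_of_nonneg (hB.2 a.1 i).1]
        exact (hB.2 a.1 i).2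
      · exact (hZ.lintegral_comp a ((((Finset.measurable_sum _ fun i _ =>
          (hsq i).const_mul _).const_mul _).pow_const 2).ennreal_ofReal)).symm
    · refine (tendsto_scaled_noise hspec hsc hB a.1 M.scaledMean (δ + 1) hbdd).congr fun p => ?_
      exact (hZ.lintegral_comp a (((hin a.1 p _).pow_const 2).ennreal_ofReal)).symm
    · refine (tendsto_scaled_noise hspec hsc hB a.1 (M.lead l) 1
        (Eventually.of_forall (M.norm_lead_le l))).congr fun p => ?_
      exact (hZ.lintegral_comp a (((hin a.1 p _).pow_const 2).ennreal_ofReal)).symm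
  obtain ⟨ms, hms, hae⟩ := exists_seq_tendsto_ae_of_sq (P := P) f hfm hlim hns
  refine ⟨ms, hms, ?_⟩
  filter_upwards [hae] with ω hω
  have hnm : Tendsto (fun i => ns (ms i)) atTop atTop := hns.comp hms.tendsto_atTop
  refine ⟨fun a b => ?_, fun a => ?_, fun a l => ?_, fun k l => ?_, fun l => ?_, ?_, fun k => ?_⟩
  · rw [tendsto_map'_iff]
    by_cases hab : a = b
    · subst hab
      have h1 := (hω (Sum.inr (Sum.inl a))).add ((hspec.tendsto_tailVar a.1).comp hnm)
      rw [zero_add] at h1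
      rw [if_pos rfl]
      refine h1.congr fun i => ?_
      simp only [f, Sum.elim_inl, Sum.elim_inr, Function.comp_apply, scaledNoise,
        real_inner_smul_left, real_inner_smul_right, hspec.norm_noise_sq]
      rw [← mul_assoc, ← mul_inv, Real.mul_self_sqrt (Nat.cast_nonneg _), mul_add]
    · have h1 := hω (Sum.inl (a, b))
      simp only [f, Sum.elim_inl, if_neg hab] at h1
      rw [if_neg hab]
      exact h1
  · exact tendsto_map'_iff.2 (hω (Sum.inr (Sum.inr (Sum.inl a))))
  · exact tendsto_map'_iff.2 (hω (Sum.inr (Sum.inr (Sum.inr (a, l)))))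
  · rw [← hR.inner_eq_corr]
    exact (hR.tendsto_lead k l).mono_left hnm
  · exact (hm l).mono_left hnm
  · exact ⟨δ + 1, hnm hbdd⟩
  · exact (M.tendsto_scaledSpike hspec k).mono_left hnm

/-! ### Test points -/

/-- The quantity whose convergence to `0` is second data piling. -/
noncomputable def testGap (M : SpikedModel) (k : Fin 2) (p : ℕ) (w : RR p)
    (y : (ℕ → ℝ) × (ℕ → ℝ)) : ℝ :=
  (√(p : ℝ))⁻¹ * inner ℝ w (M.obs k p y.1 - M.obs k p y.2)

theorem ae_fst_ne_snd (hsc : M.HasScores) (k : Fin 2) :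
    ∀ᵐ y ∂(M.scoreLaw k).prod (M.scoreLaw k), y.1 0 ≠ y.2 0 := by
  have := hsc.prob k
  have hm : MeasurableSet {y : (ℕ → ℝ) × (ℕ → ℝ) | y.1 0 ≠ y.2 0} :=
    (measurableSet_eq_fun ((measurable_pi_apply 0).comp measurable_fst)
      ((measurable_pi_apply 0).comp measurable_snd)).compl
  rw [Measure.ae_prod_iff_ae_ae hm]
  refine Eventually.of_forall fun z => ?_
  have h1 : ∀ᵐ r : ℝ, r ≠ z 0 := by
    rw [ae_iff]; simp
  have h2 := ae_of_ae_map (measurable_pi_apply 0).aemeasurable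
    ((M.scoreLaw_lead_absolutelyContinuous hsc k).ae_le h1)
  filter_upwards [h2] with z' hz'
  exact hz'.symm

/-- Y - Y' is a leading part proportional to the difference of the leading scores, plus noise that
unit-bounded directions do not see after scaling. One pair of test points with distinct leading
scores suffices to divide by that difference. -/
theorem exists_seq_tendsto_inner_lead (hspec : M.HasSpectrum t) (hsc : M.HasScores) (k : Fin 2)
    (w : (p : ℕ) → RR p) (hw : ∀ p, ‖w p‖ ≤ 1) {ns : ℕ → ℕ} (hns : Tendsto ns atTop atTop)
    (h : ∀ᵐ y ∂(M.scoreLaw k).prod (M.scoreLaw k),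
      Tendsto (fun i => M.testGap k (ns i) (w (ns i)) y) atTop (𝓝 0)) :
    ∃ ms : ℕ → ℕ, StrictMono ms ∧
      Tendsto (fun i => inner ℝ (w (ns (ms i))) (M.lead k (ns (ms i)))) atTop (𝓝 0) := by
  have := hsc.prob k
  obtain ⟨B, hB⟩ := hspec.exists_bound
  let f : Bool → ℕ → (ℕ → ℝ) × (ℕ → ℝ) → ℝ := fun c p y =>
    inner ℝ ((√(p : ℝ))⁻¹ • M.noise k p (cond c y.1 y.2)) (w p)
  have hm : ∀ p : ℕ, Measurable fun z : ℕ → ℝ => inner ℝ ((√(p : ℝ))⁻¹ • M.noise k p z) (w p) :=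
      fun p => by
    have h1 : Measurable fun z : ℕ → ℝ => (√(p : ℝ))⁻¹ • M.noise k p z :=
      (M.measurable_noise k p).const_smul (√(p : ℝ))⁻¹
    exact h1.inner_const
  have hlim := tendsto_scaled_noise hspec hsc hB k w 1 (Eventually.of_forall hw)
  obtain ⟨ms, hms, hae⟩ := exists_seq_tendsto_ae_of_sq (P := (M.scoreLaw k).prod (M.scoreLaw k)) f
    (by
      rintro (_ | _) p
      · exact (hm p).comp measurable_snd
      · exact (hm p).comp measurable_fst)
    (by
      rintro (_ | _)
      · refine hlim.congr fun p => ?_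
        exact ((measurePreserving_snd (μ := M.scoreLaw k) (ν := M.scoreLaw k)).lintegral_comp
          (((hm p).pow_const 2).ennreal_ofReal)).symm
      · refine hlim.congr fun p => ?_
        exact ((measurePreserving_fst (μ := M.scoreLaw k) (ν := M.scoreLaw k)).lintegral_comp
          (((hm p).pow_const 2).ennreal_ofReal)).symm) hns
  obtain ⟨y, hy1, hy2, hy3⟩ := (hae.and (h.and (ae_fst_ne_snd hsc k))).exists
  refine ⟨ms, hms, ?_⟩
  have hnm : Tendsto (fun i => ns (ms i)) atTop atTop := hns.comp hms.tendsto_atTop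
  have hne : M.spike k * (y.1 0 - y.2 0) ≠ 0 :=
    mul_ne_zero (hspec.spike_pos k).ne' (sub_ne_zero.2 hy3)
  have hs := (((M.tendsto_scaledSpike hspec k).comp hnm).mul_const (y.1 0 - y.2 0))
  have h1 := ((hy2.comp hms.tendsto_atTop).sub ((hy1 true).sub (hy1 false))).div hs hne
  simp only [sub_zero, zero_div] at h1
  refine h1.congr' ?_
  filter_upwards [hs.eventually_ne hne] with i hi
  simp only [Function.comp_apply, Pi.div_apply] at hi ⊢
  rw [div_eq_iff hi]
  simp only [f, testGap, obs_eq, scaledSpike, cond_true, cond_false, inner_sub_right,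
    inner_add_right, real_inner_smul_right, real_inner_smul_left]
  rw [real_inner_comm (M.noise k _ y.1), real_inner_comm (M.noise k _ y.2)]
  ring

end SpikedModel

/-! ### Assembly -/

namespace SpikedModel

variable {M : SpikedModel} {t : Fin 2 → ℝ}

theorem NoiseLimit.mono {z : (k : Fin 2) → Fin (M.size k) → ℕ → ℝ} {ρ : ℝ} {m : Fin 2 → ℝ}
    {F F' : Filter ℕ} (h : M.NoiseLimit z t ρ m F) (hF : F' ≤ F) : M.NoiseLimit z t ρ m F' :=
  ⟨fun a b => (h.noise a b).mono_left hF, fun a => (h.noise_mean a).mono_left hF,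
    fun a l => (h.noise_lead a l).mono_left hF, fun k l => (h.lead k l).mono_left hF,
    fun l => (h.mean_lead l).mono_left hF, h.mean_bdd.imp fun _ hC => hF hC,
    fun k => (h.spike k).mono_left hF⟩

/-- For fixed, generic training data, a ridge direction does not pile along any sequence of
dimensions on which the noise behaves as in the limit. -/
theorem not_ae_tendsto_testGap (hn : ∀ k, 2 ≤ M.size k) (hspec : M.HasSpectrum t)
    (hsc : M.HasScores) {R : Fin 2 → RR 2} (hR : M.HasCommonEigenspace R) (ht : t 1 < t 0)
    {m : Fin 2 → ℝ} {z : (k : Fin 2) → Fin (M.size k) → ℕ → ℝ} {ns : ℕ → ℕ}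
    (hns : Tendsto ns atTop atTop) (hL : M.NoiseLimit z t (inner ℝ (R 0) (R 1)) m (map ns atTop))
    (hG : M.Generic z t (inner ℝ (R 0) (R 1)) m)
    {lam : (p : ℕ) → Fin p → ℝ} {U : (p : ℕ) → OrthonormalBasis (Fin p) ℝ (RR p)}
    (hE : ∀ p, M.IsEigenDecomp p z (lam p) (U p)) {k₀ : ℕ} (hk : M.IsLeadCount z t R k₀) {α : ℝ}
    (hdef : GramLimit.leadChar t (inner ℝ (R 0) (R 1)) (M.leadScatter z) (-α) ≠ 0 ∨
      ∀ᶠ p in atTop, M.RidgeDefined p k₀ α (lam p))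
    (h : ∀ k, ∀ᵐ y ∂(M.scoreLaw k).prod (M.scoreLaw k), Tendsto (fun i => M.testGap k (ns i)
      (M.ridgeDirection (ns i) z k₀ α (lam (ns i)) (U (ns i))) y) atTop (𝓝 0)) : False := by
  have hw := fun p => M.norm_ridgeDirection_le z k₀ α (lam p) (U p)
  obtain ⟨ms, hms, h0⟩ := exists_seq_tendsto_inner_lead hspec hsc 0
    (fun p => M.ridgeDirection p z k₀ α (lam p) (U p)) hw hns (h 0)
  have hns' : Tendsto (fun i => ns (ms i)) atTop atTop := hns.comp hms.tendsto_atTop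
  obtain ⟨ms', hms', h1⟩ := exists_seq_tendsto_inner_lead hspec hsc 1
    (fun p => M.ridgeDirection p z k₀ α (lam p) (U p)) hw hns'
    ((h 1).mono fun y hy => hy.comp hms.tendsto_atTop)
  have hle : map (fun i => ns (ms (ms' i))) atTop ≤ map ns atTop := by
    have : Tendsto (fun i => ms (ms' i)) atTop atTop := hms.tendsto_atTop.comp hms'.tendsto_atTop
    exact map_mono (m := ns) this
  have hle' : map (fun i => ns (ms (ms' i))) atTop ≤ atTop := hle.trans hns
  refine M.not_tendsto_ridgeDirection z hn R hspec.limit_pos ht hR.corr_sq_lt_one hle'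
    (hL.mono hle) hG hE hk (hdef.imp id fun h => hle' h) fun l => ?_
  fin_cases l
  · exact tendsto_map'_iff.2 (h0.comp hms'.tendsto_atTop)
  · exact tendsto_map'_iff.2 h1

theorem ae_generic {Ω : Type*} [MeasurableSpace Ω] {P : Measure Ω} [IsProbabilityMeasure P]
    {Z : (k : Fin 2) → Fin (M.size k) → Ω → ℕ → ℝ} (hn : ∀ k, 2 ≤ M.size k)
    (hZ : M.IsTrainingSample P Z) (hspec : M.HasSpectrum t) (hsc : M.HasScores) {ρ : ℝ}
    (hρ : ρ ^ 2 < 1) (m : Fin 2 → ℝ) :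
    ∀ᵐ ω ∂P, M.Generic (fun k j => Z k j ω) t ρ m := by
  filter_upwards [hZ.ae_lead hsc (M.ae_generic_ofLead hn hspec.spike_pos (t := t) hρ m)] with ω hω
  exact ⟨hω.1, hω.2, hω.3, hω.4, hω.5⟩

end SpikedModel

open SpikedModel

theorem mainTheorem11 {Ω : Type*} [MeasurableSpace Ω] (P : Measure Ω) [IsProbabilityMeasure P]
    (M : SpikedModel) (hn : ∀ k, 2 ≤ M.size k)
    (Z : (k : Fin 2) → Fin (M.size k) → Ω → ℕ → ℝ) (hZ : M.IsTrainingSample P Z)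
    (δ : ℝ) (hδ : 0 < δ) (hgap : M.HasMeanGap δ)
    (t : Fin 2 → ℝ) (hspec : M.HasSpectrum t) (hscores : M.HasScores)
    (hangles : M.HasLeadAngles)
    (R : Fin 2 → RR 2) (hR : M.HasCommonEigenspace R)
    (ht : t 1 < t 0) :
    -- for almost every realisation `ω` of the training data, no `α` yields second data piling
    (∀ᵐ ω ∂P,
      ∀ (lam : (p : ℕ) → Fin p → ℝ) (U : (p : ℕ) → OrthonormalBasis (Fin p) ℝ (RR p)) (k₀ : ℕ),
        (∀ p, M.IsEigenDecomp p (fun k j => Z k j ω) (lam p) (U p)) →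
        M.IsLeadCount (fun k j => Z k j ω) t R k₀ →
        ∀ α : ℝ, (∀ᶠ p in atTop, M.RidgeDefined p k₀ α (lam p)) →
          ¬ M.PilesGiven
            (fun p => M.ridgeDirection p (fun k j => Z k j ω) k₀ α (lam p) (U p))) ∧
    -- for no `α` does second data piling hold in the joint probability
    (∀ (lam : (p : ℕ) → Ω → Fin p → ℝ)
        (U : (p : ℕ) → Ω → OrthonormalBasis (Fin p) ℝ (RR p)) (k₀ : Ω → ℕ),
        (∀ p ω, M.IsEigenDecomp p (fun k j => Z k j ω) (lam p ω) (U p ω)) →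
        (∀ ω, M.IsLeadCount (fun k j => Z k j ω) t R (k₀ ω)) →
        ∀ α : ℝ, ¬ M.Piles P
          (fun p ω => M.ridgeDirection p (fun k j => Z k j ω) (k₀ ω) α (lam p ω) (U p ω))) := by
  obtain ⟨m, hm⟩ := hR.exists_tendsto_mean hgap
  have hgen := ae_generic hn hZ hspec hscores hR.corr_sq_lt_one m
  constructor
  -- The sequence of dimensions and the null set are fixed before eigenvectors, k₀ and α are chosen;
  -- only the later refinements for the test points depend on these.
  · obtain ⟨ns, hns, hL⟩ := exists_seq_noiseLimit hZ hgap hspec hscores hR hm tendsto_id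
    filter_upwards [hL, hgen] with ω hω hG lam U k₀ hE hk α hdef hpile
    obtain ⟨ms₀, hms₀, h₀⟩ := ((hpile 0).comp hns.tendsto_atTop).exists_seq_tendsto_ae
    have hns' := hns.tendsto_atTop.comp hms₀.tendsto_atTop
    obtain ⟨ms₁, hms₁, h₁⟩ := ((hpile 1).comp hns').exists_seq_tendsto_ae
    have hms := hms₀.tendsto_atTop.comp hms₁.tendsto_atTop
    have hle : map (fun i => ns (ms₀ (ms₁ i))) atTop ≤ map (fun i => id (ns i)) atTop :=
      map_mono (m := ns) hms
    refine not_ae_tendsto_testGap hn hspec hscores hR ht (ns := fun i => ns (ms₀ (ms₁ i)))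
      (hns.tendsto_atTop.comp hms) (hω.mono hle) hG hE hk (Or.inr hdef) fun k => ?_
    fin_cases k
    · filter_upwards [h₀] with y hy
      exact hy.comp hms₁.tendsto_atTop
    · exact h₁
  · intro lam U k₀ hE hk α hpile
    have := hscores.prob 0
    have := hscores.prob 1
    obtain ⟨ns₀, hns₀, h₀⟩ := (hpile 0).exists_seq_tendsto_ae
    obtain ⟨ns₁, hns₁, h₁⟩ := ((hpile 1).comp hns₀.tendsto_atTop).exists_seq_tendsto_ae
    obtain ⟨ms, hms, hL⟩ := exists_seq_noiseLimit hZ hgap hspec hscores hR hm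
      (hns₀.tendsto_atTop.comp hns₁.tendsto_atTop)
    -- As α does not depend on the realisation, -α is almost surely not a signal eigenvalue, and no
    -- condition on the denominators is needed.
    have hchar := hZ.ae_lead hscores
      (M.ae_leadChar_ofLead hn hspec.spike_pos t hR.corr_sq_lt_one (-α))
    -- By Fubini, joint almost sure convergence holds for almost every realisation with almost every
    -- test pair, so one good realisation already gives the contradiction.
    obtain ⟨ω, hω, hG, hc, hω₀, hω₁⟩ := (hL.and (hgen.and (hchar.and
      ((Measure.ae_ae_of_ae_prod h₀).and (Measure.ae_ae_of_ae_prod h₁))))).exists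
    refine not_ae_tendsto_testGap hn hspec hscores hR ht (ns := fun i => ns₀ (ns₁ (ms i)))
      (hns₀.tendsto_atTop.comp (hns₁.tendsto_atTop.comp hms.tendsto_atTop)) hω hG
      (fun p => hE p ω) (hk ω) (Or.inl hc) fun k => ?_
    fin_cases k
    · filter_upwards [hω₀] with y hy
      exact hy.comp (hns₁.tendsto_atTop.comp hms.tendsto_atTop)
    · filter_upwards [hω₁] with y hy
      exact hy.comp hms.tendsto_atTop
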